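/- **Model.** For each index $n\to\infty$ there are sizes $N_1,N_2,T\to\infty$, dimensions $p_1,p_2\ge 0$, true group numbers $G_0,H_0$ and working group numbers $G\ge G_0$, $H\ge H_0$ (all may depend on $n$; so may $c_{gap},c_\pi$). Write $m=p_1+p_2+3$. Let $A_1,A_2$ be $0/1$ adjacency matrices with zero diagonal, $w_{1ik}=a_{1ik}/\sum_l a_{1il}$ and $w_{2kj}=a_{2kj}/\sum_l a_{2lj}$ (with $0/0=0$). The responses follow the stationary group matrix network autoregression ($t\in\mathbb Z$) $$Y_{ijt}=\lambda^0_{g_i^0}\sum_k w_{1ik}Y_{kj(t-1)}+\gamma^0_{h_j^0}\sum_k Y_{ik(t-1)}w_{2kj}+\alpha^0_{g_i^0h_j^0}Y_{ij(t-1)}+x_{it}^\top\zeta^0_{g_i^0}+z_{jt}^\top\delta^0_{h_j^0}+\varepsilon_{ijt},$$ with $g_i^0\in[G_0]$, $h_j^0\in[H_0]$ and $E Y_{ijt}^2<\infty$. Put $\theta_g^r=(\lambda_g,\zeta_g)$, $\theta_h^c=(\gamma_h,\delta_h)$, $\Theta_{ij}=(\theta_{g_i}^r,\theta_{h_j}^c,\alpha_{g_ih_j})$,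 let $\mathcal X_{ijt}$ be the corresponding regressor vector, so that $Y_{ijt}=\mathcal X_{ijt}^\top\Theta^0_{ij}+\varepsilon_{ijt}$, and suppose that $\Sigma_{ij}=E(\mathcal X_{ijt}\mathcal X_{ijt}^\top)$ does not depend on $t$. **Assumptions**, with constants $R,\tau_{lo},\tau_{hi},\sigma,K,c>0$ and $\kappa<1$ not depending on $n$: (A1) $\|\Theta^0\|_{\max}<R$. (A2) $\tau_{\min}=\min_{i,j}\lambda_{\min}(\Sigma_{ij})\ge\tau_{lo}$ and $\tau_{\max}=\max_{i,j}\lambda_{\max}(\Sigma_{ij})\le\tau_{hi}$. (A3) The $\varepsilon_{ijt}$ are i.i.d., centred, sub-Gaussian ($E e^{u\varepsilon_{ijt}}\le e^{\sigma^2u^2/2}$ for all $u$), $\varepsilon_{ijt}$ is independent of $\{Y_s:s\le t-1\}$, $\{x_{\cdot s},z_{\cdot s}:s\le t\}$, and the noise is independent of the (exogenous) covariate process. (A4) $E x_{it}=0$, $E z_{jt}=0$, and for all nonrandom vectors $\eta_{1i},\eta_{1i}'\in\mathbb R^{p_1}$, $\eta_{2j},\eta_{2j}'\in\mathbb R^{p_2}$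 of norm at most $c$ and all $s\in\mathbb Z$ the vector $V$ of all $x_{it}^\top\eta_{1i}$, $x_{it}^\top\eta_{1i}'$, $z_{jt}^\top\eta_{2j}$, $z_{jt}^\top\eta_{2j}'$, $s\le t\le s+T$, has the $K$-convex concentration property: for each convex 1-Lipschitz $\varphi$, $\varphi(V)$ is integrable and $P(|\varphi(V)-E\varphi(V)|\ge u)\le 2e^{-u^2/K^2}$ for all $u>0$. (A5) $|\lambda_g^0|+|\gamma_h^0|+|\alpha_{gh}^0|\le\kappa$ for all $g,h$. (A6) $\|\theta_{g}^{r0}-\theta_{g'}^{r0}\|^2+\max_h|\alpha^0_{gh}-\alpha^0_{g'h}|^2\ge c_{gap}$ for $g\ne g'$ and $\|\theta_{h}^{c0}-\theta_{h'}^{c0}\|^2+\max_g|\alpha^0_{gh}-\alpha^0_{gh'}|^2\ge c_{gap}$ for $h\ne h'$, where $c_{gap}>0$ is bounded and may tend to $0$. (A7) Each true row group contains at least $c_\pi N_1$ rows and each true column group at least $c_\pi N_2$ columns, where $c_\pi>0$ may tend to $0$. **Notation.** For parameters $\theta$ with $G$ row and $H$ column groups and row memberships $\mathcal G=(g_i)$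 let $$D(h,h_0)=\|\theta_h^c-\theta_{h_0}^{c0}\|^2+\tfrac1{N_1}\sum_i|\alpha_{g_ih}-\alpha^0_{g_i^0h_0}|^2,$$ $d_H(\theta,\theta^0)=\max\{\max_{h_0\in[H_0]}\min_{h\in[H]}D(h,h_0),\ \max_{h\in[H]}\min_{h_0\in[H_0]}D(h,h_0)\}$, $\mathcal N_\eta=\{\theta:d_H(\theta,\theta^0)<\eta\}$ and $\mathcal A_\eta(\theta,h_0)=\{h\in[H]:D(h,h_0)\le\eta\}$. With column memberships $\mathcal H$ put also $d(\Theta,\Theta^0)=\frac1{N_1N_2}\sum_{i,j}\|\Theta_{ij}-\Theta^0_{ij}\|^2$. Given $\theta$ and $\mathcal G$, least squares column labels are any $\hat h_j\in\arg\min_{h\in[H]}\sum_{i}\sum_{t=1}^T\big(Y_{ijt}-\mathcal X_{ijt}^\top(\theta_{g_i}^r,\theta_h^c,\alpha_{g_ih})\big)^2$, $j\in[N_2]$. **Theorem.** There are $c_1,c_2>0$, depending only on $R,\tau_{lo},\tau_{hi},\sigma,K,c,\kappa$, such that: (i) For every $n$, $\mathcal G$, $\eta<c_\pi c_{gap}/4$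 and $\theta\in\mathcal N_\eta$, the sets $\mathcal A_\eta(\theta,h_0)$, $h_0\in[H_0]$, form a partition of $[H]$ into nonempty sets. (ii) Let $r_n=o(c_{gap}c_\pi)$ be nonrandom. For all large $n$ and all $\eta<\tau_{\min}c_{gap}c_\pi/\{4(\tau_{\min}+\tau_{\max})\}$, with probability at least $$1-HN_1N_2\exp\big(-c_1T^{1/2}c_{gap}c_\pi+c_2m\big)$$ the following holds simultaneously for all $(\theta,\mathcal G,\mathcal H)$ with $\theta\in\mathcal N_\eta$ and $d(\Theta,\Theta^0)\le r_n$: all least squares column labels satisfy $\hat h_j\in\mathcal A_\eta(\theta,h_j^0)$ for every $j\in[N_2]$. (iii) Let $(\hat\theta,\hat{\mathcal G},\tilde{\mathcal H})$ be random with $d(\hat\Theta,\Theta^0)=O_p(T^{-1/2}(m+\log(N_1N_2)))$, let $\hat h_j$ be least squares column labels given $(\hat\theta,\hat{\mathcal G})$, and let $T^{1/2}c_{gap}c_\pi^2\gg\log(N_1N_2H)+m$. Then for every fixed $a>0$, with probability tending to $1$: $\hat\theta\in\mathcal N_\eta$ for $\eta=a\,c_{gap}c_\pi$, provided that no estimated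 column group $\hat{\mathcal C}_{\tilde h}=\{j:\hat h_j=\tilde h\}$ is empty; and (with or without empty groups) for each $\tilde h\in[H]$ there is $h\in[H_0]$ with $\hat{\mathcal C}_{\tilde h}\subset\mathcal C_h^0=\{j:h_j^0=h\}$. So true groups may split, but never merge. -/

import Mathlib

open MeasureTheory ProbabilityTheory Filter Topology

noncomputable section

namespace GMNAR

/-- Index set of the `p1 + p2 + 3` coordinates of one regressor `𝒳_ijt` (and of one `Θ_ij`):
row network term, row covariates, column network term, column covariates, own lag. -/
abbrev RegIdx (p1 p2 : ℕ) : Type := (Unit ⊕ Fin p1) ⊕ ((Unit ⊕ Fin p2) ⊕ Unit)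

/-- Group parameters with `G` row groups and `H` column groups:
`θ_g^r = (lam g, zeta g)`, `θ_h^c = (gam h, del h)` and `alpha g h`. -/
structure Params (p1 p2 G H : ℕ) where
  lam : Fin G → ℝ
  zeta : Fin G → Fin p1 → ℝ
  gam : Fin H → ℝ
  del : Fin H → Fin p2 → ℝ
  alpha : Fin G → Fin H → ℝ

/-- The row parameter `θ_g^r = (λ_g, ζ_g)`. -/
def Params.row {p1 p2 G H : ℕ} (θ : Params p1 p2 G H) (g : Fin G) : Unit ⊕ Fin p1 → ℝ :=
  Sum.elim (fun _ => θ.lam g) (θ.zeta g)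

/-- The column parameter `θ_h^c = (γ_h, δ_h)`. -/
def Params.col {p1 p2 G H : ℕ} (θ : Params p1 p2 G H) (h : Fin H) : Unit ⊕ Fin p2 → ℝ :=
  Sum.elim (fun _ => θ.gam h) (θ.del h)

/-- The vector `(θ_g^r, θ_h^c, α_gh)`; with `g = g_i` and `h = h_j` this is `Θ_ij`. -/
def Params.coef {p1 p2 G H : ℕ} (θ : Params p1 p2 G H) (g : Fin G) (h : Fin H) :
    RegIdx p1 p2 → ℝ :=
  Sum.elim (θ.row g) (Sum.elim (θ.col h) (fun _ => θ.alpha g h))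

/-- Squared Euclidean distance of two coordinate vectors. -/
def sqDist {ι : Type} [Fintype ι] (u v : ι → ℝ) : ℝ := ∑ a, (u a - v a) ^ 2

/-- `K`-convex concentration of a random vector: every convex `1`-Lipschitz function `φ` of it is
integrable and `P(|φ(V) - E φ(V)| ≥ t) ≤ 2 exp(-t² / K²)` for all `t > 0`. -/
def ConvexConcentration {Ω : Type*} [MeasurableSpace Ω] (μ : Measure Ω) {ι : Type} [Fintype ι]
    (K : ℝ) (V : Ω → EuclideanSpace ℝ ι) : Prop :=
  ∀ φ : EuclideanSpace ℝ ι → ℝ, ConvexOn ℝ Set.univ φ → LipschitzWith 1 φ →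
    Integrable (fun ω => φ (V ω)) μ ∧
    ∀ t : ℝ, 0 < t →
      μ.real {ω | t ≤ |φ (V ω) - ∫ ω', φ (V ω') ∂μ|} ≤ 2 * Real.exp (-t ^ 2 / K ^ 2)

/-- Smallest eigenvalue (of a symmetric matrix). -/
def lambdaMin {ι : Type} [Fintype ι] [DecidableEq ι] (M : Matrix ι ι ℝ) : ℝ :=
  sInf (spectrum ℝ M)

/-- Largest eigenvalue (of a symmetric matrix). -/
def lambdaMax {ι : Type} [Fintype ι] [DecidableEq ι] (M : Matrix ι ι ℝ) : ℝ :=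
  sSup (spectrum ℝ M)

/-- Networks, true parameters, true memberships, covariates, noise and responses.  Time runs
through `ℤ`; the responses at times `0, …, T` and the covariates at times `1, …, T` are what the
estimation uses. -/
structure Panel (Ω : Type*) (N1 N2 p1 p2 G0 H0 : ℕ) where
  A1 : Matrix (Fin N1) (Fin N1) ℝ
  A2 : Matrix (Fin N2) (Fin N2) ℝ
  par : Params p1 p2 G0 H0
  g0 : Fin N1 → Fin G0
  h0 : Fin N2 → Fin H0
  X : Fin N1 → ℤ → Ω → Fin p1 → ℝ
  Z : Fin N2 → ℤ → Ω → Fin p2 → ℝ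
  eps : Fin N1 → Fin N2 → ℤ → Ω → ℝ
  Y : Fin N1 → Fin N2 → ℤ → Ω → ℝ

namespace Panel

variable {Ω : Type*} {N1 N2 p1 p2 G0 H0 G H : ℕ}

/-- Row-normalised adjacency matrix of the row network. -/
def W1 (M : Panel Ω N1 N2 p1 p2 G0 H0) : Matrix (Fin N1) (Fin N1) ℝ :=
  fun i k => M.A1 i k / ∑ l, M.A1 i l

/-- Column-normalised adjacency matrix of the column network. -/
def W2 (M : Panel Ω N1 N2 p1 p2 G0 H0) : Matrix (Fin N2) (Fin N2) ℝ :=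
  fun k j => M.A2 k j / ∑ l, M.A2 l j

/-- The regressor `𝒳_ijt`. -/
def reg (M : Panel Ω N1 N2 p1 p2 G0 H0) (i : Fin N1) (j : Fin N2) (t : ℤ) (ω : Ω) :
    RegIdx p1 p2 → ℝ :=
  Sum.elim
    (Sum.elim (fun _ => ∑ k, M.W1 i k * M.Y k j (t - 1) ω) (M.X i t ω))
    (Sum.elim
      (Sum.elim (fun _ => ∑ k, M.Y i k (t - 1) ω * M.W2 k j) (M.Z j t ω))
      (fun _ => M.Y i j (t - 1) ω))

/-- `E(𝒳_ijt 𝒳_ijtᵀ)`. -/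
def secondMoment [MeasurableSpace Ω] (M : Panel Ω N1 N2 p1 p2 G0 H0) (μ : Measure Ω)
    (i : Fin N1) (j : Fin N2) (t : ℤ) : Matrix (RegIdx p1 p2) (RegIdx p1 p2) ℝ :=
  fun a b => ∫ ω, M.reg i j t ω a * M.reg i j t ω b ∂μ

/-- `τ_min = min_{i,j} λ_min(Σ_ij)`. -/
def tauMin [MeasurableSpace Ω] (M : Panel Ω N1 N2 p1 p2 G0 H0) (μ : Measure Ω) : ℝ :=
  ⨅ i, ⨅ j, lambdaMin (M.secondMoment μ i j 0)

/-- `τ_max = max_{i,j} λ_max(Σ_ij)`. -/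
def tauMax [MeasurableSpace Ω] (M : Panel Ω N1 N2 p1 p2 G0 H0) (μ : Measure Ω) : ℝ :=
  ⨆ i, ⨆ j, lambdaMax (M.secondMoment μ i j 0)

/-- Two linear projections of every covariate vector, at times `s, …, s + T`, stacked in one
random vector. -/
def projected (M : Panel Ω N1 N2 p1 p2 G0 H0) (T : ℕ) (s : ℤ)
    (η1 : Fin 2 → Fin N1 → Fin p1 → ℝ) (η2 : Fin 2 → Fin N2 → Fin p2 → ℝ) (ω : Ω) :
    EuclideanSpace ℝ (Fin (T + 1) × Fin 2 × (Fin N1 ⊕ Fin N2)) :=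
  WithLp.toLp 2 fun q => match q with
    | (l, b, Sum.inl i) => ∑ a, M.X i (s + (l : ℕ)) ω a * η1 b i a
    | (l, b, Sum.inr j) => ∑ a, M.Z j (s + (l : ℕ)) ω a * η2 b j a

/-- The stationary group matrix network autoregression. -/
structure IsModel [MeasurableSpace Ω] (M : Panel Ω N1 N2 p1 p2 G0 H0) (μ : Measure Ω) :
    Prop where
  adj1 : ∀ i k, M.A1 i k = 0 ∨ M.A1 i k = 1
  adj2 : ∀ k j, M.A2 k j = 0 ∨ M.A2 k j = 1
  diag1 : ∀ i, M.A1 i i = 0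
  diag2 : ∀ j, M.A2 j j = 0
  measurable_X : ∀ i t, Measurable (M.X i t)
  measurable_Z : ∀ j t, Measurable (M.Z j t)
  measurable_eps : ∀ i j t, Measurable (M.eps i j t)
  measurable_Y : ∀ i j t, Measurable (M.Y i j t)
  /-- the autoregression -/
  equation : ∀ i j t ω,
    M.Y i j t ω =
      M.par.lam (M.g0 i) * ∑ k, M.W1 i k * M.Y k j (t - 1) ω
      + M.par.gam (M.h0 j) * ∑ k, M.Y i k (t - 1) ω * M.W2 k j
      + M.par.alpha (M.g0 i) (M.h0 j) * M.Y i j (t - 1) ω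
      + ∑ a, M.X i t ω a * M.par.zeta (M.g0 i) a
      + ∑ a, M.Z j t ω a * M.par.del (M.h0 j) a
      + M.eps i j t ω
  /-- finite second moments, and `Σ_ij = E(𝒳_ijt 𝒳_ijtᵀ)` does not depend on `t` -/
  memLp_Y : ∀ i j t, MemLp (M.Y i j t) 2 μ
  stationary : ∀ i j t, M.secondMoment μ i j t = M.secondMoment μ i j 0

/-- The standing assumptions, with constants `R, τlo, τhi, σ, K, c, κ` and signal
levels `cgap, cpi`. -/
structure Assumptions [MeasurableSpace Ω] (M : Panel Ω N1 N2 p1 p2 G0 H0) (μ : Measure Ω)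
    (T : ℕ) (R τlo τhi σ K c κ cgap cpi : ℝ) : Prop where
  /-- parameter space -/
  bounded : ∀ i j a, |M.par.coef (M.g0 i) (M.h0 j) a| < R
  /-- convexity -/
  tauMin_ge : τlo ≤ M.tauMin μ
  tauMax_le : M.tauMax μ ≤ τhi
  /-- noise: i.i.d., sub-Gaussian with scale `σ`, independent of the past and of the (exogenous)
  covariates -/
  eps_indep : iIndepFun (fun q : Fin N1 × Fin N2 × ℤ => M.eps q.1 q.2.1 q.2.2) μ
  eps_ident : ∀ i j t i' j' t', IdentDistrib (M.eps i j t) (M.eps i' j' t') μ μ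
  eps_mean : ∀ i j t, ∫ ω, M.eps i j t ω ∂μ = 0
  eps_subG : ∀ i j t, HasSubgaussianMGF (M.eps i j t) (Real.toNNReal (σ ^ 2)) μ
  eps_past : ∀ i j t, IndepFun (M.eps i j t)
    (fun ω => ((fun (s : Set.Iic (t - 1)) k l => M.Y k l s ω),
      (fun (s : Set.Iic t) k => M.X k s ω), (fun (s : Set.Iic t) l => M.Z l s ω))) μ
  eps_exog : IndepFun (fun ω (q : Fin N1 × Fin N2 × ℤ) => M.eps q.1 q.2.1 q.2.2 ω)
    (fun ω => ((fun (s : ℤ) k => M.X k s ω), (fun (s : ℤ) l => M.Z l s ω))) μ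
  /-- covariates -/
  X_mean : ∀ i t a, ∫ ω, M.X i t ω a ∂μ = 0
  Z_mean : ∀ j t a, ∫ ω, M.Z j t ω a ∂μ = 0
  concentration : ∀ (s : ℤ) (η1 : Fin 2 → Fin N1 → Fin p1 → ℝ)
    (η2 : Fin 2 → Fin N2 → Fin p2 → ℝ),
    (∀ b i, ∑ a, η1 b i a ^ 2 ≤ c ^ 2) → (∀ b j, ∑ a, η2 b j a ^ 2 ≤ c ^ 2) →
    ConvexConcentration μ K (M.projected T s η1 η2)
  /-- stationarity -/
  stable : ∀ g h, |M.par.lam g| + |M.par.gam h| + |M.par.alpha g h| ≤ κ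
  /-- group difference -/
  cgap_pos : 0 < cgap
  gap_row : ∀ g g', g ≠ g' → cgap ≤ sqDist (M.par.row g) (M.par.row g')
    + ⨆ h, |M.par.alpha g h - M.par.alpha g' h| ^ 2
  gap_col : ∀ h h', h ≠ h' → cgap ≤ sqDist (M.par.col h) (M.par.col h')
    + ⨆ g, |M.par.alpha g h - M.par.alpha g h'| ^ 2
  /-- group proportions -/
  cpi_pos : 0 < cpi
  prop_row : ∀ g, cpi ≤ ((Finset.univ.filter fun i => M.g0 i = g).card : ℝ) / N1
  prop_col : ∀ h, cpi ≤ ((Finset.univ.filter fun j => M.h0 j = h).card : ℝ) / N2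

/-- The pseudo distance `d(Θ, Θ⁰) = (N1 N2)⁻¹ ∑_{i,j} ‖Θ_ij - Θ⁰_ij‖²`, where `Θ` is given by
`θ` and the memberships `gm`, `hm`. -/
def pseudoDist (M : Panel Ω N1 N2 p1 p2 G0 H0) (θ : Params p1 p2 G H)
    (gm : Fin N1 → Fin G) (hm : Fin N2 → Fin H) : ℝ :=
  1 / ((N1 : ℝ) * N2) *
    ∑ i, ∑ j, sqDist (θ.coef (gm i) (hm j)) (M.par.coef (M.g0 i) (M.h0 j))

/-- `‖θ_h^c - θ_{h0}^{c0}‖² + N1⁻¹ ∑_i |α_{g_i h} - α⁰_{g_i⁰ h0}|²`. -/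
def colDisc (M : Panel Ω N1 N2 p1 p2 G0 H0) (θ : Params p1 p2 G H)
    (gm : Fin N1 → Fin G) (h : Fin H) (h0 : Fin H0) : ℝ :=
  sqDist (θ.col h) (M.par.col h0)
    + 1 / (N1 : ℝ) * ∑ i, |θ.alpha (gm i) h - M.par.alpha (M.g0 i) h0| ^ 2

/-- The Hausdorff distance `d_H(θ, θ⁰; 𝒢, 𝒢⁰)`. -/
def hausdorff (M : Panel Ω N1 N2 p1 p2 G0 H0) (θ : Params p1 p2 G H)
    (gm : Fin N1 → Fin G) : ℝ :=
  max (⨆ h0, ⨅ h, M.colDisc θ gm h h0) (⨆ h, ⨅ h0, M.colDisc θ gm h h0)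

/-- The neighbourhood `𝒩_η` of the true parameter. -/
def nbhd (M : Panel Ω N1 N2 p1 p2 G0 H0) (gm : Fin N1 → Fin G) (η : ℝ) :
    Set (Params p1 p2 G H) :=
  {θ | M.hausdorff θ gm < η}

/-- The set `𝒜_η(θ, h0)` of labels that correspond to the true label `h0`. -/
def labelSet (M : Panel Ω N1 N2 p1 p2 G0 H0) (θ : Params p1 p2 G H)
    (gm : Fin N1 → Fin G) (η : ℝ) (h0 : Fin H0) : Set (Fin H) :=
  {h | M.colDisc θ gm h h0 ≤ η}

/-- The least squares criterion for the label `h` of column `j`, given `θ` and `gm`. -/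
def colLoss (M : Panel Ω N1 N2 p1 p2 G0 H0) (T : ℕ) (θ : Params p1 p2 G H)
    (gm : Fin N1 → Fin G) (ω : Ω) (j : Fin N2) (h : Fin H) : ℝ :=
  ∑ i, ∑ t ∈ Finset.Icc (1 : ℤ) T,
    (M.Y i j t ω - ∑ a, M.reg i j t ω a * θ.coef (gm i) h a) ^ 2

/-- `hm` is a choice of least squares column labels, given `θ` and `gm`. -/
def IsColArgmin (M : Panel Ω N1 N2 p1 p2 G0 H0) (T : ℕ) (θ : Params p1 p2 G H)
    (gm : Fin N1 → Fin G) (ω : Ω) (hm : Fin N2 → Fin H) : Prop :=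
  ∀ j h, M.colLoss T θ gm ω j (hm j) ≤ M.colLoss T θ gm ω j h

end Panel

end GMNAR

end

/-! Everything happens on one event, `Good`. On it, for every cell and every direction `u`, the
sample energy `∑ (𝒳ᵀu)²` is within `ε T ‖u‖²` of `T uᵀΣu`, and the sum of `ε_t 𝒳_tᵀu` is at most `ε'
√A T ‖u‖` in absolute value, where `A = cgap * cpi`. Then the criterion of column `j` at label `h`,
minus the pure noise sum, lies between about `τ_min` and about `τ_max` times `T N1 (ρ + D(h,
h_j⁰))`, up to a small multiple of `T N1 A` (`colLoss_bounds`). Here `ρ` is the mean squared error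
of the row parameters, the same for all labels. The event concerns directions, not parameters, so no
union over parameters or labels is needed.

Two true column groups are at averaged distance at least `A`, because the row group on which they
differ most has a share of at least `cpi` (`gap_le_trueDisc`). For (i), a label cannot be within
less than `A / 4` of two true groups. For (ii), a wrong label has `D ≥ A / 2 - η` while the
neighbourhood offers one with `D < η`, and the bound on `η` makes the wrong one lose. For (iii),
averaging over a true column group yields a label with `D ≤ d / cpi`, small against `A`
(`exists_colDisc_le`). The minimiser then has `D < α A`, and `α ≤ 1 / 8` forbids two true groups to
share a label.

The probabilistic core is `exists_quad_tail`, the concentration of the energy for one cell and one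
direction. Unrolling the autoregression from time `0` splits `𝒳ᵀu` into a start part (responses at
time `0`), a covariate part and a noise part, with lag coefficients of `ℓ¹` norm at most `3 κ^τ`,
whatever the size of the panel. The covariate energy is the squared norm of a linear image of a
vector with convex concentration. The noise energy is a double sum over lags, to which Jensen's
inequality applies with geometric weights. The cross term is linear in the covariates once the noise
is frozen. The start part has only an exponential tail, and its square must stay below a multiple of
`T`: this is the origin of the rate `T^{1/2}`.

The noise sum has a martingale tail (`noise_tail`). Finite nets carry both bounds from single
directions to all of them, at a cost `exp (c2 m)` (`exists_good_tail`). The true coefficients have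
norms bounded free of dimension, because `τlo ‖Θ⁰‖² ≤ E Y² ≤ τhi` (`coef0_sq_le`). -/

noncomputable section

namespace GMNAR

set_option linter.unusedSectionVars false

section

/-! ### Exponential moments: Jensen, Markov, squares of sub-Gaussian variables. -/

section ExpMoments

variable {Ω : Type*} [MeasurableSpace Ω] {μ : Measure Ω}

/-- Exponential moment `E exp f`, as an extended nonnegative real. -/
def expMom (μ : Measure Ω) (f : Ω → ℝ) : ENNReal := ∫⁻ ω, ENNReal.ofReal (Real.exp (f ω)) ∂μ

lemma expMom_mono {f g : Ω → ℝ} (h : ∀ ω, f ω ≤ g ω) : expMom μ f ≤ expMom μ g :=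
  lintegral_mono fun ω => ENNReal.ofReal_le_ofReal (Real.exp_le_exp.2 (h ω))

lemma expMom_const_add (c : ℝ) (f : Ω → ℝ) :
    expMom μ (fun ω => c + f ω) = ENNReal.ofReal (Real.exp c) * expMom μ f := by
  unfold expMom
  rw [← lintegral_const_mul' _ _ ENNReal.ofReal_ne_top]
  congr 1 with ω
  rw [Real.exp_add, ENNReal.ofReal_mul (Real.exp_pos _).le]

/-- Jensen's inequality for exponential moments of sub-convex combinations. -/
lemma expMom_sum_le [IsProbabilityMeasure μ] {ι : Type*} (s : Finset ι) (w : ι → ℝ)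
    (f : ι → Ω → ℝ) (hw : ∀ i ∈ s, 0 ≤ w i) (hw1 : ∑ i ∈ s, w i ≤ 1)
    (hf : ∀ i ∈ s, Measurable (f i)) {B : ENNReal} (hB : 1 ≤ B)
    (h : ∀ i ∈ s, expMom μ (f i) ≤ B) :
    expMom μ (fun ω => ∑ i ∈ s, w i * f i ω) ≤ B := by
  have key : ∀ ω, Real.exp (∑ i ∈ s, w i * f i ω)
      ≤ ∑ i ∈ s, w i * Real.exp (f i ω) + (1 - ∑ i ∈ s, w i) := by
    intro ω
    -- The missing weight `1 - ∑ w` is placed at the point `0`, where `exp` equals `1`; this is why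
    -- `1 ≤ B` is required.
    have := convexOn_exp.map_sum_le (t := Finset.insertNone s)
      (w := fun o => o.elim (1 - ∑ i ∈ s, w i) w) (p := fun o => o.elim 0 (fun i => f i ω))
      (by
        intro o ho
        cases o with
        | none => simpa using hw1
        | some i => exact hw i (by simpa using ho))
      (by simp [Finset.sum_insertNone]) (by simp)
    simp only [Finset.sum_insertNone, smul_eq_mul, Option.elim, mul_zero, zero_add,
      Real.exp_zero, mul_one] at this
    linarith
  have h0 : 0 ≤ 1 - ∑ i ∈ s, w i := by linarith
  calc expMom μ (fun ω => ∑ i ∈ s, w i * f i ω)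
      ≤ ∫⁻ ω, (∑ i ∈ s, ENNReal.ofReal (w i) * ENNReal.ofReal (Real.exp (f i ω))
          + ENNReal.ofReal (1 - ∑ i ∈ s, w i)) ∂μ := by
        refine lintegral_mono fun ω => (ENNReal.ofReal_le_ofReal (key ω)).trans ?_
        rw [ENNReal.ofReal_add (Finset.sum_nonneg fun i hi =>
          mul_nonneg (hw i hi) (Real.exp_pos _).le) h0,
          ENNReal.ofReal_sum_of_nonneg fun i hi => mul_nonneg (hw i hi) (Real.exp_pos _).le]
        refine add_le_add_left (Finset.sum_le_sum fun i hi => ?_) _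
        rw [ENNReal.ofReal_mul (hw i hi)]
    _ = ∑ i ∈ s, ENNReal.ofReal (w i) * expMom μ (f i)
          + ENNReal.ofReal (1 - ∑ i ∈ s, w i) := by
        rw [lintegral_add_right _ measurable_const, lintegral_finsetSum]
        · simp only [lintegral_const, measure_univ, mul_one]
          congr 1
          refine Finset.sum_congr rfl fun i hi => ?_
          rw [lintegral_const_mul' _ _ ENNReal.ofReal_ne_top]
          rfl
        · intro i hi
          exact (((hf i hi).exp).ennreal_ofReal).const_mul _
    _ ≤ ∑ i ∈ s, ENNReal.ofReal (w i) * B + ENNReal.ofReal (1 - ∑ i ∈ s, w i) * B := by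
        refine add_le_add (Finset.sum_le_sum fun i hi => by gcongr; exact h i hi) ?_
        exact le_mul_of_one_le_right' hB
    _ = B := by
        rw [← Finset.sum_mul, ← add_mul, ← ENNReal.ofReal_sum_of_nonneg hw,
          ← ENNReal.ofReal_add (Finset.sum_nonneg hw) h0]
        simp

/-- Exponential Markov inequality. -/
lemma measure_le_expMom {f : Ω → ℝ} (hf : Measurable f) (x : ℝ) :
    μ {ω | x ≤ f ω} ≤ ENNReal.ofReal (Real.exp (-x)) * expMom μ f := by
  have h := mul_meas_ge_le_lintegral₀ (μ := μ)
    (f := fun ω => ENNReal.ofReal (Real.exp (f ω))) hf.exp.ennreal_ofReal.aemeasurable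
    (ENNReal.ofReal (Real.exp x))
  have hs : {ω | x ≤ f ω}
      = {ω | ENNReal.ofReal (Real.exp x) ≤ ENNReal.ofReal (Real.exp (f ω))} := by
    ext ω
    simp [ENNReal.ofReal_le_ofReal_iff (Real.exp_pos _).le]
  rw [hs]
  calc μ {ω | ENNReal.ofReal (Real.exp x) ≤ ENNReal.ofReal (Real.exp (f ω))}
      = ENNReal.ofReal (Real.exp (-x)) * (ENNReal.ofReal (Real.exp x)
          * μ {ω | ENNReal.ofReal (Real.exp x) ≤ ENNReal.ofReal (Real.exp (f ω))}) := by
        rw [← mul_assoc, ← ENNReal.ofReal_mul (Real.exp_pos _).le, ← Real.exp_add]; simp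
    _ ≤ _ := by gcongr; exact h

/-- Gaussian tails give an exponential moment of the square. -/
lemma expMom_sq_le_of_tail [IsProbabilityMeasure μ] {W : Ω → ℝ} (hW : Measurable W) {k : ℝ}
    (hk : 0 < k)
    (h : ∀ t : ℝ, 0 < t → μ {ω | t ≤ |W ω|} ≤ ENNReal.ofReal (2 * Real.exp (-t ^ 2 / k ^ 2))) :
    expMom μ (fun ω => W ω ^ 2 / (2 * k ^ 2)) ≤ 3 := by
  set g : ℝ → ℝ := fun t => t / k ^ 2 * Real.exp (t ^ 2 / (2 * k ^ 2)) with hg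
  have hgc : Continuous g := by fun_prop
  have hG : ∀ y : ℝ, ∫ t in (0 : ℝ)..y, g t = Real.exp (y ^ 2 / (2 * k ^ 2)) - 1 := by
    intro y
    have hd : ∀ x ∈ Set.uIcc 0 y,
        HasDerivAt (fun t : ℝ => Real.exp (t ^ 2 / (2 * k ^ 2))) (g x) x := by
      intro x _
      have h1 : HasDerivAt (fun t : ℝ => t ^ 2 / (2 * k ^ 2)) (2 * x / (2 * k ^ 2)) x := by
        simpa using (hasDerivAt_pow 2 x).div_const (2 * k ^ 2)
      refine h1.exp.congr_deriv ?_
      simp only [hg]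
      field_simp
    rw [intervalIntegral.integral_eq_sub_of_hasDerivAt hd (hgc.intervalIntegrable _ _)]
    simp
  -- Layer cake with `g` the derivative of `exp (t² / (2k²))`: the tail bound turns `E exp (W² /
  -- (2k²)) - 1` into the integral of `(2 / k²) t exp (-t² / (2k²))`, which is `2`.
  have hlc := lintegral_comp_eq_lintegral_meas_le_mul (f := fun ω => |W ω|) (g := g) μ
    (ae_of_all _ fun ω => abs_nonneg _) hW.abs.aemeasurable
    (fun t _ => hgc.intervalIntegrable _ _)
    ((ae_restrict_iff' measurableSet_Ioi).2 (ae_of_all _ fun t ht => by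
      have : (0 : ℝ) < t := ht
      simp only [hg]; positivity))
  simp only [hG, sq_abs] at hlc
  have hb : 0 < (2 * k ^ 2)⁻¹ := by positivity
  have hInt := (integrable_mul_exp_neg_mul_sq hb).const_mul (2 / k ^ 2)
  have hval : ∫ t in Set.Ioi (0 : ℝ), 2 / k ^ 2 * (t * Real.exp (-(2 * k ^ 2)⁻¹ * t ^ 2)) = 2 := by
    have hd : ∀ x ∈ Set.Ioi (0 : ℝ), HasDerivAt
        (fun t : ℝ => -2 * Real.exp (-(2 * k ^ 2)⁻¹ * t ^ 2))
        (2 / k ^ 2 * (x * Real.exp (-(2 * k ^ 2)⁻¹ * x ^ 2))) x := by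
      intro x _
      have h1 : HasDerivAt (fun t : ℝ => -(2 * k ^ 2)⁻¹ * t ^ 2) (-(2 * k ^ 2)⁻¹ * (2 * x)) x := by
        refine ((hasDerivAt_pow 2 x).const_mul (-(2 * k ^ 2)⁻¹)).congr_deriv ?_
        norm_num
      refine (h1.exp.const_mul (-2)).congr_deriv ?_
      field_simp
    have ht : Tendsto (fun t : ℝ => -2 * Real.exp (-(2 * k ^ 2)⁻¹ * t ^ 2)) atTop (𝓝 0) := by
      have : Tendsto (fun t : ℝ => (2 * k ^ 2)⁻¹ * t ^ 2) atTop atTop :=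
        (tendsto_pow_atTop two_ne_zero).const_mul_atTop hb
      have := (Real.tendsto_exp_neg_atTop_nhds_zero.comp this).const_mul (-2)
      simpa [Function.comp_def] using this
    rw [integral_Ioi_of_hasDerivAt_of_tendsto (by fun_prop) hd hInt.integrableOn ht]
    simp
  have h2 : ∫⁻ t in Set.Ioi (0 : ℝ), μ {a | t ≤ |W a|} * ENNReal.ofReal (g t) ≤ 2 := by
    calc _ ≤ ∫⁻ t in Set.Ioi (0 : ℝ),
          ENNReal.ofReal (2 / k ^ 2 * (t * Real.exp (-(2 * k ^ 2)⁻¹ * t ^ 2))) := by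
          refine setLIntegral_mono' measurableSet_Ioi fun t ht => ?_
          have ht : (0 : ℝ) < t := ht
          refine (mul_le_mul_left (h t ht) _).trans ?_
          rw [← ENNReal.ofReal_mul (by positivity)]
          refine ENNReal.ofReal_le_ofReal (le_of_eq ?_)
          simp only [hg]
          have : Real.exp (-(2 * k ^ 2)⁻¹ * t ^ 2)
              = Real.exp (-t ^ 2 / k ^ 2) * Real.exp (t ^ 2 / (2 * k ^ 2)) := by
            rw [← Real.exp_add]; congr 1; field_simp; ring
          rw [this]; ring
      _ = ENNReal.ofReal 2 := by
          refine Eq.trans ?_ (congrArg ENNReal.ofReal hval)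
          rw [ofReal_integral_eq_lintegral_ofReal hInt.integrableOn]
          exact (ae_restrict_iff' measurableSet_Ioi).2 (ae_of_all _ fun t ht => by
            have : (0 : ℝ) < t := ht
            simp only [Pi.zero_apply]; positivity)
      _ = 2 := by simp
  have h3 : expMom μ (fun ω => W ω ^ 2 / (2 * k ^ 2))
      = ∫⁻ ω, (ENNReal.ofReal (Real.exp (W ω ^ 2 / (2 * k ^ 2)) - 1) + 1) ∂μ := by
    refine lintegral_congr fun ω => ?_
    have : 1 ≤ Real.exp (W ω ^ 2 / (2 * k ^ 2)) := Real.one_le_exp (by positivity)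
    rw [← ENNReal.ofReal_one, ← ENNReal.ofReal_add (by linarith) zero_le_one]
    simp
  rw [h3, lintegral_add_right _ measurable_const, hlc]
  simp only [lintegral_const, measure_univ, mul_one]
  calc _ ≤ (2 : ENNReal) + 1 := by gcongr
    _ = 3 := by norm_num

/-- Young's inequality `s |W| ≤ s² k² / 2 + W² / (2k²)` reduces the claim to the exponential moment
of the square. -/
lemma expMom_abs_le {W : Ω → ℝ} {k : ℝ} (hk : 0 < k)
    (h : expMom μ (fun ω => W ω ^ 2 / (2 * k ^ 2)) ≤ 3) (s : ℝ) :
    expMom μ (fun ω => s * |W ω|) ≤ ENNReal.ofReal (3 * Real.exp (s ^ 2 * k ^ 2 / 2)) := by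
  calc expMom μ (fun ω => s * |W ω|)
      ≤ expMom μ (fun ω => s ^ 2 * k ^ 2 / 2 + W ω ^ 2 / (2 * k ^ 2)) := by
        refine expMom_mono fun ω => ?_
        have h1 : s ^ 2 * k ^ 2 / 2 + W ω ^ 2 / (2 * k ^ 2) - s * |W ω|
            = (s * k - |W ω| / k) ^ 2 / 2 := by
          rw [← sq_abs (W ω)]; field_simp; ring
        nlinarith [sq_nonneg (s * k - |W ω| / k)]
    _ ≤ ENNReal.ofReal (Real.exp (s ^ 2 * k ^ 2 / 2)) * 3 := by
        rw [expMom_const_add]; gcongr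
    _ = _ := by
        rw [mul_comm (3 : ℝ), ENNReal.ofReal_mul (Real.exp_pos _).le]; simp

/-- Interpolation between `E exp 0 = 1` and `E exp (W² / (2 * k ^ 2)) ≤ 3`. -/
lemma expMom_mul_sq_le [IsProbabilityMeasure μ] {W : Ω → ℝ} {k : ℝ}
    (hk : 0 < k) (h : expMom μ (fun ω => W ω ^ 2 / (2 * k ^ 2)) ≤ 3) {l : ℝ} (hl : 0 ≤ l)
    (hl1 : l * (2 * k ^ 2) ≤ 1) :
    expMom μ (fun ω => l * W ω ^ 2) ≤ ENNReal.ofReal (Real.exp (4 * k ^ 2 * l)) := by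
  set p := l * (2 * k ^ 2) with hp
  have hp0 : 0 ≤ p := by positivity
  have key : ∀ ω, Real.exp (l * W ω ^ 2) ≤ p * Real.exp (W ω ^ 2 / (2 * k ^ 2)) + (1 - p) := by
    intro ω
    have := convexOn_exp.2 (Set.mem_univ (W ω ^ 2 / (2 * k ^ 2))) (Set.mem_univ 0) hp0
      (by linarith : 0 ≤ 1 - p) (by ring)
    simp only [smul_eq_mul, mul_zero, add_zero, Real.exp_zero, mul_one] at this
    refine le_trans (le_of_eq ?_) this
    congr 1; rw [hp]; field_simp
  calc expMom μ (fun ω => l * W ω ^ 2)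
      ≤ ∫⁻ ω, (ENNReal.ofReal p * ENNReal.ofReal (Real.exp (W ω ^ 2 / (2 * k ^ 2)))
          + ENNReal.ofReal (1 - p)) ∂μ := by
        refine lintegral_mono fun ω => (ENNReal.ofReal_le_ofReal (key ω)).trans (le_of_eq ?_)
        rw [ENNReal.ofReal_add (by positivity) (by linarith), ENNReal.ofReal_mul hp0]
    _ = ENNReal.ofReal p * expMom μ (fun ω => W ω ^ 2 / (2 * k ^ 2))
          + ENNReal.ofReal (1 - p) := by
        rw [lintegral_add_right _ measurable_const,
          lintegral_const_mul' _ _ ENNReal.ofReal_ne_top]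
        simp [expMom]
    _ ≤ ENNReal.ofReal p * ENNReal.ofReal 3 + ENNReal.ofReal (1 - p) := by
        gcongr; simpa using h
    _ = ENNReal.ofReal (2 * p + 1) := by
        rw [← ENNReal.ofReal_mul hp0, ← ENNReal.ofReal_add (by positivity) (by linarith)]
        congr 1; ring
    _ ≤ _ := by
        refine ENNReal.ofReal_le_ofReal ((Real.add_one_le_exp (2 * p)).trans (le_of_eq ?_))
        congr 1; rw [hp]; ring

lemma integrable_exp_of_expMom {f : Ω → ℝ} (hf : Measurable f) {B : ENNReal} (hB : B ≠ ⊤)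
    (h : expMom μ f ≤ B) : Integrable (fun ω => Real.exp (f ω)) μ := by
  refine ⟨hf.exp.aestronglyMeasurable, ?_⟩
  rw [hasFiniteIntegral_iff_ofReal (ae_of_all _ fun ω => (Real.exp_pos _).le)]
  exact h.trans_lt hB.lt_top

lemma integral_exp_le_of_expMom {f : Ω → ℝ} (hf : Measurable f) {B : ℝ} (hB : 0 ≤ B)
    (h : expMom μ f ≤ ENNReal.ofReal B) : ∫ ω, Real.exp (f ω) ∂μ ≤ B := by
  rw [integral_eq_lintegral_of_nonneg_ae (ae_of_all _ fun ω => (Real.exp_pos _).le)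
    hf.exp.aestronglyMeasurable]
  exact ENNReal.toReal_le_of_le_ofReal hB h

lemma expMom_le_of_integral {f : Ω → ℝ} (hf : Integrable (fun ω => Real.exp (f ω)) μ) {B : ℝ}
    (h : ∫ ω, Real.exp (f ω) ∂μ ≤ B) : expMom μ f ≤ ENNReal.ofReal B := by
  rw [expMom, ← ofReal_integral_eq_lintegral_ofReal hf (ae_of_all _ fun ω => (Real.exp_pos _).le)]
  exact ENNReal.ofReal_le_ofReal h

/-- From `x ≤ exp x - 1` at `x = W² / (2k²)`. -/
lemma integrable_sq_of_expMom [IsProbabilityMeasure μ] {W : Ω → ℝ} (hW : Measurable W) {k : ℝ}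
    (hk : 0 < k) (h : expMom μ (fun ω => W ω ^ 2 / (2 * k ^ 2)) ≤ 3) :
    Integrable (fun ω => W ω ^ 2) μ ∧ ∫ ω, W ω ^ 2 ∂μ ≤ 4 * k ^ 2 := by
  have hm : Measurable (fun ω => W ω ^ 2 / (2 * k ^ 2)) := by fun_prop
  have hi := integrable_exp_of_expMom hm (by simp) h
  have h3 := integral_exp_le_of_expMom (B := 3) hm (by norm_num) (by simpa using h)
  have hle : ∀ ω, W ω ^ 2 ≤ 2 * k ^ 2 * (Real.exp (W ω ^ 2 / (2 * k ^ 2)) - 1) := by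
    intro ω
    have := Real.add_one_le_exp (W ω ^ 2 / (2 * k ^ 2))
    calc W ω ^ 2 = 2 * k ^ 2 * (W ω ^ 2 / (2 * k ^ 2)) := by field_simp
      _ ≤ _ := by gcongr; linarith
  have hi2 : Integrable (fun ω => 2 * k ^ 2 * (Real.exp (W ω ^ 2 / (2 * k ^ 2)) - 1)) μ :=
    (hi.sub (integrable_const 1)).const_mul _
  have hs : Integrable (fun ω => W ω ^ 2) μ :=
    hi2.mono' (hW.pow_const 2).aestronglyMeasurable (ae_of_all _ fun ω => by
      rw [Real.norm_of_nonneg (sq_nonneg _)]; exact hle ω)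
  refine ⟨hs, (integral_mono hs hi2 hle).trans ?_⟩
  rw [integral_const_mul, integral_sub hi (integrable_const 1)]
  simp only [integral_const, probReal_univ, smul_eq_mul, mul_one]
  nlinarith [sq_nonneg k]

/-- The remainder after two Taylor terms. The linear term is kept exact so that it vanishes in
expectation for a centred variable. -/
lemma exp_le_add_sq_mul_exp_abs (x : ℝ) : Real.exp x ≤ 1 + x + x ^ 2 * Real.exp |x| := by
  have h := Complex.norm_exp_sub_sum_le_norm_mul_exp (x : ℂ) 2
  have h2 : Complex.exp x - ∑ m ∈ Finset.range 2, (x : ℂ) ^ m / (m.factorial : ℂ)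
      = ((Real.exp x - (1 + x) : ℝ) : ℂ) := by
    simp [Finset.sum_range_succ]
  rw [h2, Complex.norm_real, Complex.norm_real, Real.norm_eq_abs, Real.norm_eq_abs, sq_abs] at h
  linarith [le_abs_self (Real.exp x - (1 + x))]

/-- Bernstein-type exponential moment of a centred square. -/
lemma expMom_centered_sq_le [IsProbabilityMeasure μ] {W : Ω → ℝ} (hW : Measurable W) {k : ℝ}
    (hk : 0 < k) (h : expMom μ (fun ω => W ω ^ 2 / (2 * k ^ 2)) ≤ 3) {l : ℝ}
    (hl : |l| * (8 * k ^ 2) ≤ 1) :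
    expMom μ (fun ω => l * (W ω ^ 2 - ∫ ω', W ω' ^ 2 ∂μ))
      ≤ ENNReal.ofReal (Real.exp (1200 * k ^ 4 * l ^ 2)) := by
  obtain ⟨hs, hs4⟩ := integrable_sq_of_expMom hW hk h
  set e := ∫ ω', W ω' ^ 2 ∂μ with he
  have he0 : 0 ≤ e := integral_nonneg fun ω => sq_nonneg _
  have hm : Measurable (fun ω => W ω ^ 2 / (2 * k ^ 2)) := by fun_prop
  have hi := integrable_exp_of_expMom hm (by simp) h
  have h3 := integral_exp_le_of_expMom (B := 3) hm (by norm_num) (by simpa using h)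
  have hexp1 : Real.exp 1 ≤ 3 := Real.exp_one_lt_d9.le.trans (by norm_num)
  have key : ∀ ω, Real.exp (l * (W ω ^ 2 - e)) ≤ 1 + l * (W ω ^ 2 - e)
      + 384 * k ^ 4 * l ^ 2 * Real.exp (W ω ^ 2 / (2 * k ^ 2)) := by
    intro ω
    refine (exp_le_add_sq_mul_exp_abs _).trans (add_le_add le_rfl ?_)
    -- The restriction on `l` makes the exponent at most `y`, and `e ≤ 4k²` gives `2y ≤ 1 + W² /
    -- (2k²)`. So `y² ≤ 2 exp y` and the exponential are absorbed together by the one available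
    -- moment. Constants: `64 · 2 · 3 = 384`, and `384 · 3 ≤ 1200`.
    set y := |W ω ^ 2 - e| / (8 * k ^ 2) with hy
    have hy0 : 0 ≤ y := by positivity
    have h1 : |l * (W ω ^ 2 - e)| ≤ y := by
      rw [abs_mul, hy, le_div_iff₀ (by positivity)]
      calc _ = (|l| * (8 * k ^ 2)) * |W ω ^ 2 - e| := by ring
        _ ≤ 1 * |W ω ^ 2 - e| := by gcongr
        _ = _ := one_mul _
    have h2 : (l * (W ω ^ 2 - e)) ^ 2 = 64 * k ^ 4 * l ^ 2 * y ^ 2 := by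
      rw [hy, div_pow, sq_abs]; field_simp; ring
    have h4 : y ^ 2 ≤ 2 * Real.exp y := by
      have := Real.quadratic_le_exp_of_nonneg hy0
      nlinarith
    have h5 : 2 * y ≤ 1 + W ω ^ 2 / (2 * k ^ 2) := by
      have : |W ω ^ 2 - e| ≤ W ω ^ 2 + 4 * k ^ 2 := by
        rw [abs_le]; constructor <;> nlinarith [sq_nonneg (W ω), sq_nonneg k]
      have h6 : y ≤ (W ω ^ 2 + 4 * k ^ 2) / (8 * k ^ 2) := by rw [hy]; gcongr
      have h7 : (W ω ^ 2 + 4 * k ^ 2) / (8 * k ^ 2) = (1 + (W ω ^ 2 / (2 * k ^ 2)) / 2) / 2 := by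
        field_simp; ring
      have h8 : 0 ≤ W ω ^ 2 / (2 * k ^ 2) := by positivity
      linarith
    calc (l * (W ω ^ 2 - e)) ^ 2 * Real.exp |l * (W ω ^ 2 - e)|
        ≤ (64 * k ^ 4 * l ^ 2 * (2 * Real.exp y)) * Real.exp y := by
          rw [h2]; gcongr
      _ = 128 * k ^ 4 * l ^ 2 * Real.exp (2 * y) := by rw [two_mul y, Real.exp_add]; ring
      _ ≤ 128 * k ^ 4 * l ^ 2 * Real.exp (1 + W ω ^ 2 / (2 * k ^ 2)) := by gcongr
      _ = 128 * k ^ 4 * l ^ 2 * Real.exp 1 * Real.exp (W ω ^ 2 / (2 * k ^ 2)) := by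
          rw [Real.exp_add]; ring
      _ ≤ 128 * k ^ 4 * l ^ 2 * 3 * Real.exp (W ω ^ 2 / (2 * k ^ 2)) := by gcongr
      _ = _ := by ring
  have hi1 : Integrable (fun ω => l * (W ω ^ 2 - e)) μ :=
    (hs.sub (integrable_const e)).const_mul _
  have hi2 : Integrable (fun ω => 1 + l * (W ω ^ 2 - e)) μ := (integrable_const 1).add hi1
  have hi3 : Integrable (fun ω => 384 * k ^ 4 * l ^ 2 * Real.exp (W ω ^ 2 / (2 * k ^ 2))) μ :=
    hi.const_mul _
  have hi4 : Integrable (fun ω => Real.exp (l * (W ω ^ 2 - e))) μ :=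
    (hi2.add hi3).mono' (by fun_prop) (ae_of_all _ fun ω => by
      rw [Real.norm_of_nonneg (Real.exp_pos _).le]; exact key ω)
  refine expMom_le_of_integral hi4 ((integral_mono hi4 (hi2.add hi3) key).trans ?_)
  have hz : ∫ ω, l * (W ω ^ 2 - e) ∂μ = 0 := by
    rw [integral_const_mul, integral_sub hs (integrable_const e)]
    simp [he]
  have hsum : ∫ ω, (1 + l * (W ω ^ 2 - e)
      + 384 * k ^ 4 * l ^ 2 * Real.exp (W ω ^ 2 / (2 * k ^ 2))) ∂μ
      = 1 + 384 * k ^ 4 * l ^ 2 * ∫ ω, Real.exp (W ω ^ 2 / (2 * k ^ 2)) ∂μ := by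
    rw [integral_add hi2 hi3, integral_add (integrable_const 1) hi1, hz, integral_const_mul]
    simp
  refine le_trans (le_of_eq hsum) ?_
  have h9 : 384 * k ^ 4 * l ^ 2 * ∫ ω, Real.exp (W ω ^ 2 / (2 * k ^ 2)) ∂μ
      ≤ 384 * k ^ 4 * l ^ 2 * 3 := by gcongr
  have := Real.add_one_le_exp (1200 * k ^ 4 * l ^ 2)
  nlinarith [mul_nonneg (pow_nonneg hk.le 4) (sq_nonneg l)]

end ExpMoments

/-! ### Independence: freezing one variable, products of adapted factors. -/

section Independence

variable {Ω : Type*} [MeasurableSpace Ω] {μ : Measure Ω} [IsProbabilityMeasure μ]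

/-- Tonelli for the joint law, which is a product; the outer integral fixes the value of `W`. It
plays the role of a conditional expectation. -/
lemma lintegral_comp_of_indepFun {α β : Type*} [MeasurableSpace α] [MeasurableSpace β]
    {X : Ω → α} {W : Ω → β} (hX : Measurable X) (hW : Measurable W) (h : IndepFun X W μ)
    {g : α × β → ENNReal} (hg : Measurable g) :
    ∫⁻ ω, g (X ω, W ω) ∂μ = ∫⁻ ω, ∫⁻ ω', g (X ω', W ω) ∂μ ∂μ := by
  have h1 := h.symm.map_prod_eq_prod_map_map hW.aemeasurable hX.aemeasurable
  have hg' : Measurable (fun p : β × α => g (p.2, p.1)) := hg.comp measurable_swap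
  calc ∫⁻ ω, g (X ω, W ω) ∂μ
      = ∫⁻ p, g (p.2, p.1) ∂(μ.map (fun ω => (W ω, X ω))) :=
        (lintegral_map hg' (hW.prodMk hX)).symm
    _ = ∫⁻ w, ∫⁻ x, g (x, w) ∂(μ.map X) ∂(μ.map W) := by
        rw [h1, lintegral_prod _ hg'.aemeasurable]
    _ = ∫⁻ ω, ∫⁻ x, g (x, W ω) ∂(μ.map X) ∂μ := by
        have : SFinite (μ.map X) := inferInstance
        rw [lintegral_map (f := fun w => ∫⁻ x, g (x, w) ∂(μ.map X)) _ hW]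
        exact Measurable.lintegral_prod_right' hg'
    _ = _ := by
        refine lintegral_congr fun ω => ?_
        exact lintegral_map (hg.comp (measurable_id.prodMk measurable_const)) hX

/-- A product whose factors have conditional expectation at most `C` has expectation at most
`C ^ n`. -/
lemma lintegral_prod_range_le (n : ℕ) (X z : ℕ → Ω → ℝ) (g : ℕ → ℝ → ℝ → ENNReal)
    (hg : ∀ k, Measurable (Function.uncurry (g k)))
    (hX : ∀ k < n, Measurable (X k)) (hz : ∀ k < n, Measurable (z k))
    (hind : ∀ k < n, IndepFun (X k)
      (fun ω => (∏ l ∈ Finset.range k, g l (X l ω) (z l ω), z k ω)) μ)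
    {C : ENNReal} (hC : ∀ k < n, ∀ w, ∫⁻ ω, g k (X k ω) w ∂μ ≤ C) :
    ∫⁻ ω, ∏ k ∈ Finset.range n, g k (X k ω) (z k ω) ∂μ ≤ C ^ n := by
  induction n with
  | zero => simp
  | succ n ih =>
    have ih' := ih (fun k hk => hX k (by omega)) (fun k hk => hz k (by omega))
      (fun k hk => hind k (by omega)) (fun k hk => hC k (by omega))
    have hmp : Measurable (fun ω => ∏ l ∈ Finset.range n, g l (X l ω) (z l ω)) := by
      refine Finset.measurable_prod _ fun l hl => ?_
      have hl : l < n := Finset.mem_range.1 hl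
      exact (hg l).comp ((hX l (by omega)).prodMk (hz l (by omega)))
    simp_rw [Finset.prod_range_succ]
    have hG : Measurable (fun p : ℝ × (ENNReal × ℝ) => p.2.1 * g n p.1 p.2.2) :=
      (measurable_snd.fst).mul ((hg n).comp (measurable_fst.prodMk measurable_snd.snd))
    -- With the earlier factors and `z n` frozen, only `X n` is integrated in the last factor, which
    -- costs `C`.
    have := lintegral_comp_of_indepFun (hX n (by omega)) (hmp.prodMk (hz n (by omega)))
      (hind n (by omega)) hG
    simp only at this
    rw [this]
    calc _ ≤ ∫⁻ ω, (∏ l ∈ Finset.range n, g l (X l ω) (z l ω)) * C ∂μ := by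
          refine lintegral_mono fun ω => ?_
          dsimp only
          rw [lintegral_const_mul]
          · gcongr; exact hC n (by omega) _
          · exact (hg n).comp ((hX n (by omega)).prodMk measurable_const)
      _ = (∫⁻ ω, (∏ l ∈ Finset.range n, g l (X l ω) (z l ω)) ∂μ) * C :=
          lintegral_mul_const _ hmp
      _ ≤ C ^ (n + 1) := by rw [pow_succ]; gcongr

end Independence

/-- Chernoff tails of `X` and `-X` fed into `expMom_sq_le_of_tail`. -/
lemma hasSubgaussianMGF_expMom_sq {Ω : Type*} [MeasurableSpace Ω] {μ : Measure Ω}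
    [IsProbabilityMeasure μ] {X : Ω → ℝ} (hX : Measurable X) {v : NNReal}
    (h : HasSubgaussianMGF X v μ) {k : ℝ} (hk : 0 < k) (hv : 2 * (v : ℝ) ≤ k ^ 2) :
    expMom μ (fun ω => X ω ^ 2 / (2 * k ^ 2)) ≤ 3 := by
  refine expMom_sq_le_of_tail hX hk fun t ht => ?_
  have tail : ∀ Y : Ω → ℝ, HasSubgaussianMGF Y v μ →
      μ {ω | t ≤ Y ω} ≤ ENNReal.ofReal (Real.exp (-t ^ 2 / k ^ 2)) := by
    intro Y hY
    have hv0 : (0 : ℝ) ≤ v := v.2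
    -- The Chernoff exponent divides by `v`; for `v = 0` the variable vanishes almost surely.
    rcases hv0.eq_or_lt with h0 | h0
    · have hv' : v = 0 := by ext; exact h0.symm
      subst hv'
      have hae := hY.ae_eq_zero_of_hasSubgaussianMGF_zero
      have : μ {ω | t ≤ Y ω} = 0 := by
        refine measure_mono_null (fun ω (hω : t ≤ Y ω) => ?_) (ae_iff.1 hae)
        simp only [Pi.zero_apply, Set.mem_ofPred_eq]
        linarith
      rw [this]; exact zero_le
    · have h1 := hY.measure_ge_le ht.le
      rw [← ENNReal.ofReal_toReal (measure_ne_top μ _)]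
      refine ENNReal.ofReal_le_ofReal (h1.trans (Real.exp_le_exp.2 ?_))
      rw [neg_div, neg_div, neg_le_neg_iff]
      gcongr
  calc μ {ω | t ≤ |X ω|} ≤ μ ({ω | t ≤ X ω} ∪ {ω | t ≤ (-X) ω}) := by
        refine measure_mono fun ω hω => ?_
        simpa [le_abs] using hω
    _ ≤ ENNReal.ofReal (Real.exp (-t ^ 2 / k ^ 2)) + ENNReal.ofReal (Real.exp (-t ^ 2 / k ^ 2)) :=
        (measure_union_le _ _).trans (add_le_add (tail X h) (tail (-X) h.neg))
    _ = _ := by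
        rw [← ENNReal.ofReal_add (Real.exp_pos _).le (Real.exp_pos _).le, two_mul]

end

section

/-! ### Energy of geometrically decaying linear filters of independent noise. -/

section LinearProcess

variable {Ω : Type*} [mΩ : MeasurableSpace Ω] {μ : Measure Ω} [IsProbabilityMeasure μ]

/-- Exponential moments of sums adapted to a family of `σ`-algebras `m k` independent of `X k`. -/
lemma expMom_sum_range_le (n : ℕ) (X z : ℕ → Ω → ℝ) (h : ℕ → ℝ → ℝ → ℝ)
    (hh : ∀ k, Measurable (Function.uncurry (h k))) (m : ℕ → MeasurableSpace Ω)
    (hm : ∀ k < n, m k ≤ mΩ)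
    (hX : ∀ k < n, Measurable (X k)) (hXm : ∀ k < n, ∀ l < k, Measurable[m k] (X l))
    (hz : ∀ k < n, ∀ l ≤ k, Measurable[m k] (z l))
    (hind : ∀ k < n, Indep (MeasurableSpace.comap (X k) inferInstance) (m k) μ)
    {B : ℝ} (hB : ∀ k < n, ∀ w, expMom μ (fun ω => h k (X k ω) w) ≤ ENNReal.ofReal (Real.exp B)) :
    expMom μ (fun ω => ∑ k ∈ Finset.range n, h k (X k ω) (z k ω))
      ≤ ENNReal.ofReal (Real.exp (n * B)) := by
  set g : ℕ → ℝ → ℝ → ENNReal := fun k x w => ENNReal.ofReal (Real.exp (h k x w)) with hg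
  have hgm : ∀ k, Measurable (Function.uncurry (g k)) := fun k => (hh k).exp.ennreal_ofReal
  have hprod : ∀ (k : ℕ) (ω : Ω), ENNReal.ofReal (Real.exp (∑ l ∈ Finset.range k,
      h l (X l ω) (z l ω))) = ∏ l ∈ Finset.range k, g l (X l ω) (z l ω) := by
    intro k ω
    rw [Real.exp_sum, ENNReal.ofReal_prod_of_nonneg fun i _ => (Real.exp_pos _).le]
  have := lintegral_prod_range_le (μ := μ) n X z g hgm hX
    (fun k hk => (hz k hk k le_rfl).mono (hm k hk) le_rfl) ?_
    (C := ENNReal.ofReal (Real.exp B)) hB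
  · unfold expMom
    simp_rw [hprod]
    refine this.trans (le_of_eq ?_)
    rw [← ENNReal.ofReal_pow (Real.exp_pos _).le, ← Real.exp_nat_mul]
  · intro k hk
    have hmeas : Measurable[m k]
        (fun ω => (∏ l ∈ Finset.range k, g l (X l ω) (z l ω), z k ω)) := by
      refine Measurable.prodMk ?_ (hz k hk k le_rfl)
      refine Finset.measurable_prod _ fun l hl => ?_
      have hl : l < k := Finset.mem_range.1 hl
      exact (hgm l).comp ((hXm k hk l hl).prodMk (hz k hk l hl.le))
    rw [IndepFun_iff_Indep]
    exact indep_of_indep_of_le_right (hind k hk) hmeas.comap_le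

variable {ι : Type*} [Fintype ι]

/-- The `σ`-algebra of the noise before time `s`. -/
@[reducible] def noisePast (eps : ι → ℕ → Ω → ℝ) (s : ℕ) : MeasurableSpace Ω :=
  ⨆ q ∈ {q : ι × ℕ | q.2 < s}, MeasurableSpace.comap (eps q.1 q.2) inferInstance

/-- Linear form `∑_a c_a ε_{a,s}` of the noise at time `s`. -/
def noiseForm (eps : ι → ℕ → Ω → ℝ) (c : ι → ℝ) (s : ℕ) (ω : Ω) : ℝ := ∑ a, c a * eps a s ω

lemma measurable_noiseForm {eps : ι → ℕ → Ω → ℝ} (hm : ∀ a s, Measurable (eps a s))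
    (c : ι → ℝ) (s : ℕ) : Measurable (noiseForm eps c s) :=
  Finset.measurable_sum _ fun a _ => (hm a s).const_mul _

lemma noisePast_le {eps : ι → ℕ → Ω → ℝ} (hm : ∀ a s, Measurable (eps a s)) (s : ℕ) :
    noisePast eps s ≤ mΩ :=
  iSup₂_le fun q _ => (hm q.1 q.2).comap_le

lemma measurable_noiseForm_noisePast (eps : ι → ℕ → Ω → ℝ) (c : ι → ℝ) {s t : ℕ} (h : s < t) :
    Measurable[noisePast eps t] (noiseForm eps c s) := by
  refine Finset.measurable_sum _ fun a _ => Measurable.const_mul ?_ _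
  refine Measurable.of_comap_le ?_
  exact le_iSup₂_of_le (f := fun (q : ι × ℕ) (_ : q ∈ {q : ι × ℕ | q.2 < t}) =>
    MeasurableSpace.comap (eps q.1 q.2) inferInstance) (a, s) h le_rfl

/-- The two sides are generated by disjoint blocks of one independent family. -/
lemma indep_noiseForm_noisePast {eps : ι → ℕ → Ω → ℝ} (hm : ∀ a s, Measurable (eps a s))
    (hi : iIndepFun (fun q : ι × ℕ => eps q.1 q.2) μ) (c : ι → ℝ) (s : ℕ) :
    Indep (MeasurableSpace.comap (noiseForm eps c s) inferInstance) (noisePast eps s) μ := by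
  have hd : Disjoint {q : ι × ℕ | q.2 = s} {q : ι × ℕ | q.2 < s} := by
    rw [Set.disjoint_left]
    intro q hq hq'
    have h1 : q.2 = s := hq
    have h2 : q.2 < s := hq'
    omega
  have h := indep_iSup_of_disjoint (μ := μ)
    (m := fun q : ι × ℕ => MeasurableSpace.comap (eps q.1 q.2) inferInstance)
    (fun q => (hm q.1 q.2).comap_le) hi hd
  refine indep_of_indep_of_le_left h ?_
  refine Measurable.comap_le ?_
  refine Finset.measurable_sum _ fun a _ => Measurable.const_mul ?_ _
  refine Measurable.of_comap_le ?_
  exact le_iSup₂_of_le (f := fun (q : ι × ℕ) (_ : q ∈ {q : ι × ℕ | q.2 = s}) =>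
    MeasurableSpace.comap (eps q.1 q.2) inferInstance) (a, s) rfl le_rfl

/-- The proxy of the sum is `v ∑ c²`, and the `ℓ²` norm is at most the `ℓ¹` norm. The bound is thus
free of the number of cells. -/
lemma hasSubgaussianMGF_noiseForm {eps : ι → ℕ → Ω → ℝ}
    (hi : iIndepFun (fun q : ι × ℕ => eps q.1 q.2) μ)
    {v : NNReal} (hv : ∀ a s, HasSubgaussianMGF (eps a s) v μ) {c : ι → ℝ} {L : ℝ}
    (hc : ∑ a, |c a| ≤ L) (s : ℕ) :
    HasSubgaussianMGF (noiseForm eps c s) (Real.toNNReal (L ^ 2) * v) μ := by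
  have hi1 : iIndepFun (fun a : ι => eps a s) μ :=
    hi.precomp (g := fun a : ι => (a, s)) (fun a b h => by simpa using h)
  have hi2 : iIndepFun (fun (a : ι) ω => c a * eps a s ω) μ :=
    hi1.comp (fun a x => c a * x) (fun a => measurable_const_mul _)
  have h1 := HasSubgaussianMGF.sum_of_iIndepFun hi2 (s := Finset.univ)
    (fun a _ => (hv a s).const_mul (c a))
  refine ⟨h1.integrable_exp_mul, fun t => (h1.mgf_le t).trans (Real.exp_le_exp.2 ?_)⟩
  have hL : 0 ≤ L := (Finset.sum_nonneg fun a _ => abs_nonneg _).trans hc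
  have h2 : ∑ a, c a ^ 2 ≤ L ^ 2 := by
    calc ∑ a, c a ^ 2 = ∑ a, |c a| ^ 2 := by simp
      _ ≤ (∑ a, |c a|) ^ 2 := Finset.sum_sq_le_sq_sum_of_nonneg fun a _ => abs_nonneg _
      _ ≤ L ^ 2 := by
        have : 0 ≤ ∑ a, |c a| := Finset.sum_nonneg fun a _ => abs_nonneg _
        gcongr
  have hv0 : (0 : ℝ) ≤ v := v.2
  push_cast
  rw [Real.coe_toNNReal _ (sq_nonneg L)]
  have h3 : ∑ a, c a ^ 2 * (v : ℝ) ≤ L ^ 2 * v := by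
    rw [← Finset.sum_mul]; gcongr
  change (∑ a, c a ^ 2 * (v : ℝ)) * t ^ 2 / 2 ≤ _
  gcongr

/-- Standing facts on the noise. -/
structure IsNoise (μ : Measure Ω) (eps : ι → ℕ → Ω → ℝ) (v : NNReal) : Prop where
  meas : ∀ a s, Measurable (eps a s)
  indep : iIndepFun (fun q : ι × ℕ => eps q.1 q.2) μ
  subG : ∀ a s, HasSubgaussianMGF (eps a s) v μ
  mean : ∀ a s, ∫ ω, eps a s ω ∂μ = 0

variable {eps : ι → ℕ → Ω → ℝ} {v : NNReal}

lemma IsNoise.sq_noiseForm (hn : IsNoise μ eps v) {L k : ℝ} (hk : 0 < k)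
    (hkv : 2 * (L ^ 2 * v) ≤ k ^ 2) {c : ι → ℝ} (hc : ∑ a, |c a| ≤ L) (s : ℕ) :
    expMom μ (fun ω => noiseForm eps c s ω ^ 2 / (2 * k ^ 2)) ≤ 3 := by
  refine hasSubgaussianMGF_expMom_sq (measurable_noiseForm hn.meas c s)
    (hasSubgaussianMGF_noiseForm hn.indep hn.subG hc s) hk ?_
  push_cast
  rwa [Real.coe_toNNReal _ (sq_nonneg L)]

lemma IsNoise.mean_noiseForm (hn : IsNoise μ eps v) (c : ι → ℝ) (s : ℕ) :
    ∫ ω, noiseForm eps c s ω ∂μ = 0 := by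
  unfold noiseForm
  rw [integral_finsetSum _ fun a _ => ((hn.subG a s).integrable).const_mul _]
  simp [integral_const_mul, hn.mean]

lemma IsNoise.expMom_sum_sq (hn : IsNoise μ eps v) {L k : ℝ} (hk : 0 < k)
    (hkv : 2 * (L ^ 2 * v) ≤ k ^ 2) {c : ι → ℝ} (hc : ∑ a, |c a| ≤ L) (n s : ℕ) {l : ℝ}
    (hl : 0 ≤ l) (hl1 : l * (2 * k ^ 2) ≤ 1) :
    expMom μ (fun ω => ∑ j ∈ Finset.range n, l * noiseForm eps c (j + s) ω ^ 2)
      ≤ ENNReal.ofReal (Real.exp (n * (4 * k ^ 2 * l))) := by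
  refine expMom_sum_range_le n (fun j => noiseForm eps c (j + s)) (fun _ _ => 0)
    (fun _ x _ => l * x ^ 2) (fun _ => by simp only [Function.uncurry_def]; fun_prop)
    (fun j => noisePast eps (j + s))
    (fun j _ => noisePast_le hn.meas _) (fun j _ => measurable_noiseForm hn.meas c _)
    (fun j _ i hi => measurable_noiseForm_noisePast eps c (by omega))
    (fun _ _ _ _ => measurable_const)
    (fun j _ => indep_noiseForm_noisePast hn.meas hn.indep c _) fun j _ _ => ?_
  exact expMom_mul_sq_le hk (hn.sq_noiseForm hk hkv hc _) hl hl1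

lemma IsNoise.expMom_sum_centered_sq (hn : IsNoise μ eps v) {L k : ℝ} (hk : 0 < k)
    (hkv : 2 * (L ^ 2 * v) ≤ k ^ 2) {c : ι → ℝ} (hc : ∑ a, |c a| ≤ L) (n s : ℕ) {l : ℝ}
    (hl : |l| * (8 * k ^ 2) ≤ 1) :
    expMom μ (fun ω => ∑ j ∈ Finset.range n, l * (noiseForm eps c (j + s) ω ^ 2
        - ∫ ω', noiseForm eps c (j + s) ω' ^ 2 ∂μ))
      ≤ ENNReal.ofReal (Real.exp (n * (1200 * k ^ 4 * l ^ 2))) := by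
  set e : ℕ → ℝ := fun j => ∫ ω', noiseForm eps c (j + s) ω' ^ 2 ∂μ
  refine expMom_sum_range_le n (fun j => noiseForm eps c (j + s)) (fun _ _ => 0)
    (fun j x _ => l * (x ^ 2 - e j)) (fun _ => by simp only [Function.uncurry_def]; fun_prop)
    (fun j => noisePast eps (j + s))
    (fun j _ => noisePast_le hn.meas _) (fun j _ => measurable_noiseForm hn.meas c _)
    (fun j _ i hi => measurable_noiseForm_noisePast eps c (by omega))
    (fun _ _ _ _ => measurable_const)
    (fun j _ => indep_noiseForm_noisePast hn.meas hn.indep c _) fun j _ _ => ?_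
  exact expMom_centered_sq_le (measurable_noiseForm hn.meas c _) hk (hn.sq_noiseForm hk hkv hc _) hl

lemma IsNoise.indepFun_noiseForm (hn : IsNoise μ eps v) (c c' : ι → ℝ) {s t : ℕ} (h : s < t) :
    IndepFun (noiseForm eps c t) (noiseForm eps c' s) μ := by
  rw [IndepFun_iff_Indep]
  exact indep_of_indep_of_le_right (indep_noiseForm_noisePast hn.meas hn.indep c t)
    (measurable_noiseForm_noisePast eps c' h).comap_le

lemma IsNoise.memLp_noiseForm (hn : IsNoise μ eps v) (c : ι → ℝ) (s : ℕ) :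
    MemLp (noiseForm eps c s) 2 μ :=
  (hasSubgaussianMGF_noiseForm hn.indep hn.subG (le_refl (∑ a, |c a|)) s).memLp 2

/-- The later factor is independent of the past, which contains the earlier factor `w`, so its
conditional exponential moment costs at most `exp (k² l² w²)`. The exponent is written as half of
the sum compensated by `k² l² w²`, whose exponential moment is at most `1`, plus half of the
compensator, a sum of squares. Jensen joins the halves. -/
lemma IsNoise.expMom_sum_cross (hn : IsNoise μ eps v) {L k : ℝ} (hk : 0 < k)
    (hkv : 2 * (L ^ 2 * v) ≤ k ^ 2) {c c' : ι → ℝ} (hc : ∑ a, |c a| ≤ L)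
    (hc' : ∑ a, |c' a| ≤ L) (n s : ℕ) {d : ℕ} (hd : 0 < d) {l : ℝ} (hl : |l| * (8 * k ^ 2) ≤ 1) :
    expMom μ (fun ω => ∑ j ∈ Finset.range n,
        l * (noiseForm eps c (j + s + d) ω * noiseForm eps c' (j + s) ω))
      ≤ ENNReal.ofReal (Real.exp (n * (1200 * k ^ 4 * l ^ 2))) := by
  have hmf := fun c s => measurable_noiseForm (c := c) (s := s) hn.meas
  set F : Fin 2 → Ω → ℝ := ![fun ω => ∑ j ∈ Finset.range n,
      (2 * l * (noiseForm eps c' (j + s) ω * noiseForm eps c (j + s + d) ω)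
        - k ^ 2 * l ^ 2 * noiseForm eps c' (j + s) ω ^ 2),
    fun ω => ∑ j ∈ Finset.range n, k ^ 2 * l ^ 2 * noiseForm eps c' (j + s) ω ^ 2] with hF
  have hFs : (fun ω => ∑ j ∈ Finset.range n,
        l * (noiseForm eps c (j + s + d) ω * noiseForm eps c' (j + s) ω))
      = fun ω => ∑ i ∈ (Finset.univ : Finset (Fin 2)), (1 / 2 : ℝ) * F i ω := by
    ext ω
    simp only [hF, Fin.sum_univ_two, Matrix.cons_val_zero, Matrix.cons_val_one]
    rw [← mul_add, ← Finset.sum_add_distrib, Finset.mul_sum]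
    exact Finset.sum_congr rfl fun j _ => by ring
  rw [hFs]
  have hkl : k ^ 2 * l ^ 2 * (2 * k ^ 2) ≤ 1 := by
    have h1 : (|l| * (8 * k ^ 2)) ^ 2 ≤ 1 := pow_le_one₀ (by positivity) hl
    rw [mul_pow, sq_abs] at h1
    nlinarith [mul_nonneg (sq_nonneg l) (pow_nonneg hk.le 4)]
  have hpos : 0 ≤ k ^ 4 * l ^ 2 := by positivity
  refine expMom_sum_le _ _ F (fun _ _ => by norm_num) (by norm_num) ?_ ?_ ?_
  · intro i _
    fin_cases i
    · change Measurable (fun ω => ∑ j ∈ Finset.range n,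
        (2 * l * (noiseForm eps c' (j + s) ω * noiseForm eps c (j + s + d) ω)
          - k ^ 2 * l ^ 2 * noiseForm eps c' (j + s) ω ^ 2))
      fun_prop
    · change Measurable
        (fun ω => ∑ j ∈ Finset.range n, k ^ 2 * l ^ 2 * noiseForm eps c' (j + s) ω ^ 2)
      fun_prop
  · rw [← ENNReal.ofReal_one]
    exact ENNReal.ofReal_le_ofReal (Real.one_le_exp (by positivity))
  · intro i _
    fin_cases i
    · simp only [hF, Fin.zero_eta, Matrix.cons_val_zero]
      have := expMom_sum_range_le (μ := μ) n (fun j => noiseForm eps c (j + s + d))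
        (fun j => noiseForm eps c' (j + s))
        (fun _ x w => 2 * l * (w * x) - k ^ 2 * l ^ 2 * w ^ 2)
        (fun _ => by simp only [Function.uncurry_def]; fun_prop)
        (fun j => noisePast eps (j + s + d))
        (fun j _ => noisePast_le hn.meas _) (fun j _ => hmf _ _)
        (fun j _ i hi => measurable_noiseForm_noisePast eps c (by omega))
        (fun j _ i hi => measurable_noiseForm_noisePast eps c' (by omega))
        (fun j _ => indep_noiseForm_noisePast hn.meas hn.indep c _) (B := 0) ?_
      · refine this.trans (ENNReal.ofReal_le_ofReal (Real.exp_le_exp.2 ?_))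
        rw [mul_zero]; positivity
      · intro j _ w
        have hs := hasSubgaussianMGF_noiseForm hn.indep hn.subG hc (j + s + d)
        have hL : 0 ≤ L := (Finset.sum_nonneg fun a _ => abs_nonneg _).trans hc
        have h1 := hs.mgf_le (2 * l * w)
        have h2 := hs.integrable_exp_mul (2 * l * w)
        have h3 := expMom_le_of_integral h2 h1
        have h4 : (fun ω => 2 * l * (w * noiseForm eps c (j + s + d) ω) - k ^ 2 * l ^ 2 * w ^ 2)
            = fun ω => -(k ^ 2 * l ^ 2 * w ^ 2)
              + 2 * l * w * noiseForm eps c (j + s + d) ω := by ext ω; ring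
        rw [h4, expMom_const_add]
        refine (mul_le_mul_right h3 _).trans ?_
        rw [← ENNReal.ofReal_mul (Real.exp_pos _).le, ← Real.exp_add]
        refine ENNReal.ofReal_le_ofReal (Real.exp_le_exp.2 ?_)
        push_cast
        rw [Real.coe_toNNReal _ (sq_nonneg L)]
        have : 2 * (L ^ 2 * v) * (l ^ 2 * w ^ 2) ≤ k ^ 2 * (l ^ 2 * w ^ 2) := by gcongr
        nlinarith
    · simp only [hF, Fin.mk_one, Matrix.cons_val_one]
      refine (hn.expMom_sum_sq hk hkv hc' n s (by positivity) hkl).trans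
        (ENNReal.ofReal_le_ofReal (Real.exp_le_exp.2 ?_))
      exact mul_le_mul_of_nonneg_left (by nlinarith) (Nat.cast_nonneg _)

/-- Lag pair sums of the normalised linear forms. -/
def lagPair (eps : ι → ℕ → Ω → ℝ) (c : ℕ → ι → ℝ) (T τ τ' : ℕ) (ω : Ω) : ℝ :=
  ∑ k ∈ Finset.range T, if τ < k ∧ τ' < k then
    noiseForm eps (c τ) (k - τ) ω * noiseForm eps (c τ') (k - τ') ω else 0

lemma lagPair_comm (eps : ι → ℕ → Ω → ℝ) (c : ℕ → ι → ℝ) (T τ τ' : ℕ) :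
    lagPair eps c T τ τ' = lagPair eps c T τ' τ := by
  ext ω
  refine Finset.sum_congr rfl fun k _ => ?_
  simp only [and_comm, mul_comm]

/-- Substitute `k = τ' + 1 + j`: both noise times are then positive, at the constant distance `τ' -
τ`. -/
lemma lagPair_eq (eps : ι → ℕ → Ω → ℝ) (c : ℕ → ι → ℝ) (T : ℕ) {τ τ' : ℕ} (h : τ ≤ τ') (ω : Ω) :
    lagPair eps c T τ τ' ω = ∑ j ∈ Finset.range (T - (τ' + 1)),
      noiseForm eps (c τ) (j + 1 + (τ' - τ)) ω * noiseForm eps (c τ') (j + 1) ω := by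
  unfold lagPair
  rw [← Finset.sum_filter]
  have : (Finset.range T).filter (fun k => τ < k ∧ τ' < k) = Finset.Ico (τ' + 1) T := by
    ext k; simp only [Finset.mem_filter, Finset.mem_range, Finset.mem_Ico]; omega
  rw [this, Finset.sum_Ico_eq_sum_range]
  refine Finset.sum_congr rfl fun j _ => ?_
  congr 2 <;> omega

lemma IsNoise.integrable_lagPair (hn : IsNoise μ eps v) (c : ℕ → ι → ℝ) (T τ τ' : ℕ) :
    Integrable (lagPair eps c T τ τ') μ := by
  refine integrable_finsetSum _ fun k _ => ?_
  split_ifs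
  · exact (hn.memLp_noiseForm _ _).integrable_mul (hn.memLp_noiseForm _ _)
  · exact integrable_zero _ _ _

/-- Equal lags give centred squares. Different lags give products of noise at different times, which
are already centred. -/
lemma IsNoise.expMom_lagPair (hn : IsNoise μ eps v) {L k : ℝ} (hk : 0 < k)
    (hkv : 2 * (L ^ 2 * v) ≤ k ^ 2) {c : ℕ → ι → ℝ} (hc : ∀ τ, ∑ a, |c τ a| ≤ L) (T τ τ' : ℕ)
    {l : ℝ} (hl : |l| * (8 * k ^ 2) ≤ 1) :
    expMom μ (fun ω => l * (lagPair eps c T τ τ' ω - ∫ ω', lagPair eps c T τ τ' ω' ∂μ))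
      ≤ ENNReal.ofReal (Real.exp (T * (1200 * k ^ 4 * l ^ 2))) := by
  wlog h : τ ≤ τ' generalizing τ τ'
  · rw [lagPair_comm]; exact this τ' τ (by omega)
  have hT : ((T - (τ' + 1) : ℕ) : ℝ) ≤ T := by exact_mod_cast Nat.sub_le _ _
  have hmono : ENNReal.ofReal (Real.exp ((T - (τ' + 1) : ℕ) * (1200 * k ^ 4 * l ^ 2)))
      ≤ ENNReal.ofReal (Real.exp (T * (1200 * k ^ 4 * l ^ 2))) := by
    refine ENNReal.ofReal_le_ofReal (Real.exp_le_exp.2 ?_)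
    gcongr
  refine le_trans ?_ hmono
  simp_rw [lagPair_eq eps c T h]
  have hI : ∀ j, Integrable (fun ω =>
      noiseForm eps (c τ) (j + 1 + (τ' - τ)) ω * noiseForm eps (c τ') (j + 1) ω) μ :=
    fun j => (hn.memLp_noiseForm _ _).integrable_mul (hn.memLp_noiseForm _ _)
  rw [integral_finsetSum _ fun j _ => hI j]
  simp_rw [← Finset.sum_sub_distrib, Finset.mul_sum]
  rcases h.eq_or_lt with rfl | h'
  · simp only [Nat.sub_self, Nat.add_zero, ← pow_two]
    exact hn.expMom_sum_centered_sq hk hkv (hc τ) _ 1 hl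
  · have h0 : ∀ j, ∫ ω, noiseForm eps (c τ) (j + 1 + (τ' - τ)) ω * noiseForm eps (c τ') (j + 1) ω ∂μ
        = 0 := by
      intro j
      rw [(hn.indepFun_noiseForm (c τ) (c τ') (by omega)).integral_fun_mul_eq_mul_integral
        (measurable_noiseForm hn.meas _ _).aestronglyMeasurable
        (measurable_noiseForm hn.meas _ _).aestronglyMeasurable, hn.mean_noiseForm, zero_mul]
    simp_rw [h0, sub_zero]
    exact hn.expMom_sum_cross hk hkv (hc τ) (hc τ') _ 1 (by omega) hl

/-- The causal linear filter `∑_{τ<k} ∑_a c_{τ,a} ε_{a,k-τ}` of the noise at times `1, …, k`. -/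
def noiseFilter (eps : ι → ℕ → Ω → ℝ) (c : ℕ → ι → ℝ) (k : ℕ) (ω : Ω) : ℝ :=
  ∑ τ ∈ Finset.range k, noiseForm eps (c τ) (k - τ) ω

/-- Expanding the square and summing over time first leaves one lag pair sum per pair of lags, with
an explicit geometric weight. -/
lemma sum_noiseFilter_sq (eps : ι → ℕ → Ω → ℝ) (c c' : ℕ → ι → ℝ) (κ : ℝ)
    (hcc : ∀ τ a, c' τ a = κ ^ τ * c τ a) (T : ℕ) (ω : Ω) :
    ∑ k ∈ Finset.range T, noiseFilter eps c' k ω ^ 2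
      = ∑ p ∈ Finset.range T ×ˢ Finset.range T, κ ^ p.1 * κ ^ p.2 * lagPair eps c T p.1 p.2 ω := by
  have h1 : ∀ τ s, noiseForm eps (c' τ) s ω = κ ^ τ * noiseForm eps (c τ) s ω := by
    intro τ s
    simp only [noiseForm, hcc, Finset.mul_sum, mul_assoc]
  have h2 : ∀ k ∈ Finset.range T, noiseFilter eps c' k ω
      = ∑ τ ∈ Finset.range T, if τ < k then κ ^ τ * noiseForm eps (c τ) (k - τ) ω else 0 := by
    intro k hk
    rw [← Finset.sum_filter]
    have : (Finset.range T).filter (fun τ => τ < k) = Finset.range k := by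
      have := Finset.mem_range.1 hk
      ext τ; simp only [Finset.mem_filter, Finset.mem_range]; omega
    rw [this]
    exact Finset.sum_congr rfl fun τ _ => h1 _ _
  rw [Finset.sum_congr rfl fun k hk => by rw [h2 k hk, sq, Finset.sum_mul_sum]]
  rw [Finset.sum_product, Finset.sum_comm]
  refine Finset.sum_congr rfl fun τ _ => ?_
  rw [Finset.sum_comm]
  refine Finset.sum_congr rfl fun τ' _ => ?_
  unfold lagPair
  rw [Finset.mul_sum]
  refine Finset.sum_congr rfl fun k _ => ?_
  by_cases h : τ < k <;> by_cases h' : τ' < k <;> simp [h, h']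
  ring

/-- Exponential moment of the centred energy of a geometrically decaying filter of the noise. -/
lemma IsNoise.expMom_energy (hn : IsNoise μ eps v) {L k κ : ℝ} (hk : 0 < k)
    (hkv : 2 * (L ^ 2 * v) ≤ k ^ 2) (hκ : 0 < κ) (hκ1 : κ < 1) {c : ℕ → ι → ℝ}
    (hc : ∀ τ, ∑ a, |c τ a| ≤ L * κ ^ τ) (T : ℕ) {l : ℝ} (hl : |l| * (8 * k ^ 2) ≤ (1 - κ) ^ 2) :
    expMom μ (fun ω => l * (∑ k ∈ Finset.range T, noiseFilter eps c k ω ^ 2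
        - ∫ ω', ∑ k ∈ Finset.range T, noiseFilter eps c k ω' ^ 2 ∂μ))
      ≤ ENNReal.ofReal (Real.exp (T * (1200 * k ^ 4 * (l / (1 - κ) ^ 2) ^ 2))) := by
  set c₀ : ℕ → ι → ℝ := fun τ a => c τ a / κ ^ τ with hc₀
  have hc₀L : ∀ τ, ∑ a, |c₀ τ a| ≤ L := by
    intro τ
    simp only [hc₀, abs_div, abs_of_pos (pow_pos hκ τ)]
    rw [← Finset.sum_div, div_le_iff₀ (pow_pos hκ τ)]
    exact hc τ
  have hcc : ∀ τ a, c τ a = κ ^ τ * c₀ τ a := by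
    intro τ a
    simp only [hc₀]; field_simp
  have h1κ : 0 < (1 - κ) ^ 2 := by have : 0 < 1 - κ := by linarith
                                   positivity
  simp_rw [sum_noiseFilter_sq eps c₀ c κ hcc T]
  rw [integral_finsetSum _ fun p _ => (hn.integrable_lagPair c₀ T p.1 p.2).const_mul _]
  have heq : (fun ω => l * (∑ p ∈ Finset.range T ×ˢ Finset.range T,
        κ ^ p.1 * κ ^ p.2 * lagPair eps c₀ T p.1 p.2 ω
        - ∑ p ∈ Finset.range T ×ˢ Finset.range T,
          ∫ ω', κ ^ p.1 * κ ^ p.2 * lagPair eps c₀ T p.1 p.2 ω' ∂μ))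
      = fun ω => ∑ p ∈ Finset.range T ×ˢ Finset.range T, ((1 - κ) ^ 2 * (κ ^ p.1 * κ ^ p.2))
        * (l / (1 - κ) ^ 2 * (lagPair eps c₀ T p.1 p.2 ω
            - ∫ ω', lagPair eps c₀ T p.1 p.2 ω' ∂μ)) := by
    ext ω
    rw [← Finset.sum_sub_distrib, Finset.mul_sum]
    refine Finset.sum_congr rfl fun p _ => ?_
    rw [integral_const_mul]
    have hne : 1 - κ ≠ 0 := by linarith
    field_simp
  rw [heq]
  -- Weights `(1 - κ)² κ^τ κ^τ'` sum to at most `1`, so Jensen replaces the double sum by a single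
  -- lag pair. No independence between pairs is needed.
  refine expMom_sum_le _ _ _ (fun p _ => by positivity) ?_ ?_ ?_ fun p _ => ?_
  · rw [← Finset.mul_sum, Finset.sum_product, ← Finset.sum_mul_sum, ← pow_two, ← mul_pow]
    have hg : (1 - κ) * ∑ i ∈ Finset.range T, κ ^ i = 1 - κ ^ T := by
      rw [mul_comm]; exact geom_sum_mul_neg κ T
    rw [hg]
    have : κ ^ T ≤ 1 := pow_le_one₀ hκ.le hκ1.le
    have : 0 ≤ κ ^ T := by positivity
    exact pow_le_one₀ (by linarith) (by linarith)
  · intro p _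
    refine Measurable.const_mul (Measurable.sub_const ?_ _) _
    refine Finset.measurable_sum _ fun k _ => ?_
    split_ifs
    · exact (measurable_noiseForm hn.meas _ _).mul (measurable_noiseForm hn.meas _ _)
    · exact measurable_const
  · rw [← ENNReal.ofReal_one]
    exact ENNReal.ofReal_le_ofReal (Real.one_le_exp (by positivity))
  · refine hn.expMom_lagPair hk hkv hc₀L T _ _ ?_
    rw [abs_div, abs_of_pos h1κ, div_mul_eq_mul_div, div_le_one h1κ]
    exact hl

lemma measurable_noiseFilter (hm : ∀ a s, Measurable (eps a s)) (c : ℕ → ι → ℝ) (k : ℕ) :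
    Measurable (noiseFilter eps c k) :=
  Finset.measurable_sum _ fun _ _ => measurable_noiseForm hm _ _

lemma IsNoise.memLp_noiseFilter (hn : IsNoise μ eps v) (c : ℕ → ι → ℝ) (k : ℕ) :
    MemLp (noiseFilter eps c k) 2 μ :=
  memLp_finsetSum _ fun _ _ => hn.memLp_noiseForm _ _

/-- Chernoff's bound with `l` so small that the quadratic term `C l²` is at most half of the gain `l
x`. The constant is chosen before the probability space, hence is uniform over panels. -/
lemma exists_energy_tail {L κ : ℝ} (v : NNReal) (hκ : 0 < κ) (hκ1 : κ < 1) {x : ℝ} (hx : 0 < x) :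
    ∃ b : ℝ, 0 < b ∧ ∀ {Ω ι : Type*} [MeasurableSpace Ω] {μ : Measure Ω} [IsProbabilityMeasure μ]
      [Fintype ι] {eps : ι → ℕ → Ω → ℝ}, IsNoise μ eps v → ∀ c : ℕ → ι → ℝ,
      (∀ τ, ∑ a, |c τ a| ≤ L * κ ^ τ) → ∀ T : ℕ,
      μ {ω | x * T ≤ |∑ k ∈ Finset.range T, noiseFilter eps c k ω ^ 2
        - ∫ ω', ∑ k ∈ Finset.range T, noiseFilter eps c k ω' ^ 2 ∂μ|}
        ≤ ENNReal.ofReal (2 * Real.exp (-(b * T))) := by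
  have hκ0 : 0 < 1 - κ := by linarith
  set k : ℝ := √(2 * (L ^ 2 * v)) + 1 with hkdef
  have hk : 0 < k := by positivity
  have hkv : 2 * (L ^ 2 * v) ≤ k ^ 2 := by
    have h0 : 0 ≤ 2 * (L ^ 2 * (v : ℝ)) := by positivity
    nlinarith [Real.sq_sqrt h0, Real.sqrt_nonneg (2 * (L ^ 2 * (v : ℝ)))]
  set C : ℝ := 1200 * k ^ 4 / (1 - κ) ^ 4 with hC
  have hC0 : 0 < C := by positivity
  set l : ℝ := min ((1 - κ) ^ 2 / (8 * k ^ 2)) (x / (2 * C)) with hl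
  have hl0 : 0 < l := lt_min (by positivity) (by positivity)
  have hl1 : l * (8 * k ^ 2) ≤ (1 - κ) ^ 2 := by
    rw [← le_div_iff₀ (by positivity)]; exact min_le_left _ _
  have hl2 : C * l ≤ x / 2 := by
    have : l ≤ x / (2 * C) := min_le_right _ _
    rw [le_div_iff₀ (by positivity)] at this
    linarith
  refine ⟨l * x / 2, by positivity, ?_⟩
  intro Ω ι _ μ _ _ eps hn c hc T
  set Y : Ω → ℝ := fun ω => ∑ k ∈ Finset.range T, noiseFilter eps c k ω ^ 2
        - ∫ ω', ∑ k ∈ Finset.range T, noiseFilter eps c k ω' ^ 2 ∂μ with hY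
  have hYm : Measurable Y := (Finset.measurable_sum _ fun k _ =>
    (measurable_noiseFilter hn.meas c k).pow_const 2).sub_const _
  have hexp : ∀ r : ℝ, |r| = l →
      μ {ω | l * (x * T) ≤ r * Y ω} ≤ ENNReal.ofReal (Real.exp (-(l * x / 2 * T))) := by
    intro r hr
    have h1 := hn.expMom_energy hk hkv hκ hκ1 hc T (l := r) (by rw [hr]; exact hl1)
    refine (measure_le_expMom (hYm.const_mul r) _).trans ?_
    refine (mul_le_mul_right h1 _).trans ?_
    rw [← ENNReal.ofReal_mul (Real.exp_pos _).le, ← Real.exp_add]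
    refine ENNReal.ofReal_le_ofReal (Real.exp_le_exp.2 ?_)
    have h2 : 1200 * k ^ 4 * (r / (1 - κ) ^ 2) ^ 2 = C * l * l := by
      rw [hC, ← hr, div_pow, ← sq_abs r]; field_simp
    rw [h2]
    have h3 : C * l * l * T ≤ x / 2 * l * T := by gcongr
    nlinarith
  have hsub : {ω | x * T ≤ |Y ω|} ⊆ {ω | l * (x * T) ≤ l * Y ω} ∪ {ω | l * (x * T) ≤ -l * Y ω} := by
    intro ω hω
    have hω : x * T ≤ |Y ω| := hω
    rcases le_abs.1 hω with h | h
    · left; exact mul_le_mul_of_nonneg_left h hl0.le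
    · right
      have := mul_le_mul_of_nonneg_left h hl0.le
      change l * (x * T) ≤ -l * Y ω
      linarith
  calc μ {ω | x * T ≤ |Y ω|} ≤ _ := (measure_mono hsub).trans (measure_union_le _ _)
    _ ≤ ENNReal.ofReal (Real.exp (-(l * x / 2 * T)))
          + ENNReal.ofReal (Real.exp (-(l * x / 2 * T))) :=
        add_le_add (hexp l (abs_of_pos hl0)) (hexp (-l) (by rw [abs_neg, abs_of_pos hl0]))
    _ = _ := by rw [← ENNReal.ofReal_add (Real.exp_pos _).le (Real.exp_pos _).le, two_mul]

end LinearProcess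

end

section

/-! ### Consequences of convex concentration for linear maps. -/

section Concentration

variable {Ω : Type*} [MeasurableSpace Ω] {μ : Measure Ω} [IsProbabilityMeasure μ]
  {q I : Type} [Fintype q] [Fintype I] {K : ℝ} {V : Ω → EuclideanSpace ℝ q}

lemma ConvexConcentration.scaled (h : ConvexConcentration μ K V)
    {φ : EuclideanSpace ℝ q → ℝ} (hφ : ConvexOn ℝ Set.univ φ) {r : ℝ} (hr : 0 < r)
    (hl : ∀ v w, |φ v - φ w| ≤ r * ‖v - w‖) :
    Integrable (fun ω => φ (V ω)) μ ∧ ∀ t : ℝ, 0 < t →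
      μ {ω | t ≤ |φ (V ω) - ∫ ω', φ (V ω') ∂μ|}
        ≤ ENNReal.ofReal (2 * Real.exp (-t ^ 2 / (K * r) ^ 2)) := by
  have hc : ConvexOn ℝ Set.univ (fun v => r⁻¹ * φ v) := hφ.smul (inv_nonneg.2 hr.le)
  have hL : LipschitzWith 1 (fun v => r⁻¹ * φ v) := by
    refine LipschitzWith.of_dist_le_mul fun v w => ?_
    rw [Real.dist_eq, ← mul_sub, abs_mul, abs_of_pos (inv_pos.2 hr), dist_eq_norm,
      NNReal.coe_one, one_mul, inv_mul_le_iff₀ hr]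
    exact hl v w
  obtain ⟨hi, ht⟩ := h _ hc hL
  have hi' : Integrable (fun ω => φ (V ω)) μ := by
    have := hi.const_mul r
    refine this.congr (ae_of_all _ fun ω => ?_)
    simp only
    field_simp
  refine ⟨hi', fun t ht0 => ?_⟩
  have h1 := ht (t / r) (by positivity)
  have hset : {ω | t / r ≤ |r⁻¹ * φ (V ω) - ∫ ω', r⁻¹ * φ (V ω') ∂μ|}
      = {ω | t ≤ |φ (V ω) - ∫ ω', φ (V ω') ∂μ|} := by
    ext ω
    simp only [Set.mem_ofPred_eq]
    rw [integral_const_mul, ← mul_sub, abs_mul, abs_of_pos (inv_pos.2 hr), div_eq_inv_mul,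
      mul_le_mul_iff_right₀ (inv_pos.2 hr)]
  rw [hset] at h1
  rw [← ENNReal.ofReal_toReal (measure_ne_top μ _)]
  refine ENNReal.ofReal_le_ofReal (h1.trans (le_of_eq ?_))
  congr 2
  rw [div_pow, mul_pow]; field_simp

lemma ConvexConcentration.integrable_coord (h : ConvexConcentration μ K V) (a : q) :
    Integrable (fun ω => V ω a) μ := by
  refine (h.scaled (φ := fun v => v a) ?_ one_pos fun v w => ?_).1
  · exact ((EuclideanSpace.proj (𝕜 := ℝ) a).toLinearMap).convexOn convex_univ
  · rw [one_mul]; simpa using PiLp.norm_apply_le (v - w) a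

/-- A linear form is convex, has mean zero here, and `r` bounds its Lipschitz constant. -/
lemma ConvexConcentration.linear (h : ConvexConcentration μ K V)
    (hV : ∀ a, ∫ ω, V ω a ∂μ = 0) (u : q → ℝ) {r : ℝ} (hr : 0 < r)
    (hu : ∀ v : EuclideanSpace ℝ q, |∑ a, u a * v a| ≤ r * ‖v‖) :
    ∀ t : ℝ, 0 < t → μ {ω | t ≤ |∑ a, u a * V ω a|}
        ≤ ENNReal.ofReal (2 * Real.exp (-t ^ 2 / (K * r) ^ 2)) := by
  have hc : ConvexOn ℝ Set.univ (fun v : EuclideanSpace ℝ q => ∑ a, u a * v a) := by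
    set f : EuclideanSpace ℝ q →ₗ[ℝ] ℝ :=
      (∑ a, u a • (EuclideanSpace.proj (𝕜 := ℝ) a : EuclideanSpace ℝ q →L[ℝ] ℝ)).toLinearMap with hf
    have hfe : (fun v : EuclideanSpace ℝ q => ∑ a, u a * v a) = f := by
      ext v; simp [hf]
    rw [hfe]
    exact f.convexOn convex_univ
  have hs := (h.scaled hc hr fun v w => by
    have := hu (v - w)
    simpa [mul_sub, Finset.sum_sub_distrib] using this).2
  have h0 : ∫ ω, ∑ a, u a * V ω a ∂μ = 0 := by
    rw [integral_finsetSum _ fun a _ => (h.integrable_coord a).const_mul _]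
    simp [integral_const_mul, hV]
  simpa only [h0, sub_zero] using hs

/-- Square root of the sum of squares. -/
def l2 (x : I → ℝ) : ℝ := √(∑ k, x k ^ 2)

lemma l2_eq_norm (x : I → ℝ) : l2 x = ‖WithLp.toLp 2 x‖ := by
  simp [l2, EuclideanSpace.norm_eq]

lemma l2_sq (x : I → ℝ) : l2 x ^ 2 = ∑ k, x k ^ 2 :=
  Real.sq_sqrt (Finset.sum_nonneg fun _ _ => sq_nonneg _)

lemma abs_sum_mul_le_l2 (x y : I → ℝ) : |∑ k, x k * y k| ≤ l2 x * l2 y := by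
  rw [← Real.sqrt_sq_eq_abs, l2, l2, ← Real.sqrt_mul (Finset.sum_nonneg fun _ _ => sq_nonneg _)]
  exact Real.sqrt_le_sqrt (Finset.sum_mul_sq_le_sq_mul_sq _ _ _)

variable (A : (q → ℝ) →ₗ[ℝ] (I → ℝ)) {L : ℝ}

/-- A norm composed with a linear map is convex and `L`-Lipschitz. Concentrating the norm avoids
concentrating a quadratic form. -/
lemma ConvexConcentration.l2_map (h : ConvexConcentration μ K V) (hL : 0 < L)
    (hA : ∀ v, l2 (A v) ≤ L * l2 v) :
    Integrable (fun ω => l2 (A (V ω))) μ ∧ ∀ t : ℝ, 0 < t →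
      μ {ω | t ≤ |l2 (A (V ω)) - ∫ ω', l2 (A (V ω')) ∂μ|}
        ≤ ENNReal.ofReal (2 * Real.exp (-t ^ 2 / (K * L) ^ 2)) := by
  set A' : EuclideanSpace ℝ q →ₗ[ℝ] EuclideanSpace ℝ I :=
    (WithLp.linearEquiv 2 ℝ (I → ℝ)).symm.toLinearMap ∘ₗ A
      ∘ₗ (WithLp.linearEquiv 2 ℝ (q → ℝ)).toLinearMap with hA'
  have hn : ∀ v : EuclideanSpace ℝ q, l2 (A v) = ‖A' v‖ := fun v => by
    rw [l2_eq_norm]; rfl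
  refine h.scaled (φ := fun v => l2 (A v)) ?_ hL fun v w => ?_
  · simp_rw [hn]
    exact (convexOn_norm convex_univ).comp_linearMap A'
  · rw [hn, hn]
    refine (abs_norm_sub_norm_le _ _).trans ?_
    rw [← map_sub, ← hn]
    refine (hA _).trans (le_of_eq ?_)
    rw [l2_eq_norm]

lemma measurable_map_apply (hVm : Measurable V) (k : I) : Measurable (fun ω => A (V ω) k) := by
  have h1 : Measurable (fun v : q → ℝ => A v k) :=
    ((LinearMap.proj k ∘ₗ A).continuous_of_finiteDimensional).measurable
  exact h1.comp ((WithLp.measurable_ofLp 2 (q → ℝ)).comp hVm)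

/-- Concentration of the norm of a linear image around its root mean square. -/
lemma ConvexConcentration.l2_map_sqrt (h : ConvexConcentration μ K V) (hVm : Measurable V)
    (hK : 0 < K) (hL : 0 < L) (hA : ∀ v, l2 (A v) ≤ L * l2 v) :
    Integrable (fun ω => l2 (A (V ω)) ^ 2) μ ∧ ∀ t : ℝ, 0 < t →
      μ {ω | t ≤ |l2 (A (V ω)) - √(∫ ω', l2 (A (V ω')) ^ 2 ∂μ)|}
        ≤ ENNReal.ofReal (60 * Real.exp (-t ^ 2 / (4 * (K * L) ^ 2))) := by
  obtain ⟨hi, htail⟩ := h.l2_map A hL hA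
  have hKL : 0 < K * L := by positivity
  set m := ∫ ω', l2 (A (V ω')) ∂μ with hm
  have hm0 : 0 ≤ m := integral_nonneg fun ω => Real.sqrt_nonneg _
  have hWm : Measurable (fun ω => l2 (A (V ω))) := by
    unfold l2
    exact (Finset.measurable_sum _ fun k _ =>
      (measurable_map_apply A hVm k).pow_const 2).sqrt
  have h3 := expMom_sq_le_of_tail (hWm.sub_const m) hKL htail
  obtain ⟨hs, hs4⟩ := integrable_sq_of_expMom (hWm.sub_const m) hKL h3
  have hsq : (fun ω => l2 (A (V ω)) ^ 2)
      = fun ω => (l2 (A (V ω)) - m) ^ 2 + (2 * m * l2 (A (V ω)) - m ^ 2) := by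
    ext ω; ring
  have hi2 : Integrable (fun ω => 2 * m * l2 (A (V ω)) - m ^ 2) μ :=
    (hi.const_mul _).sub (integrable_const _)
  have hInt : Integrable (fun ω => l2 (A (V ω)) ^ 2) μ := by
    rw [hsq]; exact hs.add hi2
  refine ⟨hInt, fun t ht => ?_⟩
  set e := ∫ ω', l2 (A (V ω')) ^ 2 ∂μ with he
  have hev : e = ∫ ω, (l2 (A (V ω)) - m) ^ 2 ∂μ + m ^ 2 := by
    rw [he, hsq, integral_add hs hi2, integral_sub (hi.const_mul _) (integrable_const _),
      integral_const_mul, ← hm]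
    simp; ring
  have hvar0 : 0 ≤ ∫ ω, (l2 (A (V ω)) - m) ^ 2 ∂μ := integral_nonneg fun ω => sq_nonneg _
  have hme : m ≤ √e := Real.le_sqrt_of_sq_le (by linarith)
  have hem : √e ≤ m + 2 * (K * L) := by
    refine Real.sqrt_le_iff.2 ⟨by positivity, ?_⟩
    nlinarith
  -- The variance is at most `4 (K L)²`, so the root mean square is within `2 K L` of the mean. For
  -- `t ≥ 4 K L` that shift costs half of `t`; for smaller `t` the bound exceeds `1`, since `60 ≥
  -- exp 4`.
  by_cases hbig : 4 * (K * L) ≤ t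
  · have hsub : {ω | t ≤ |l2 (A (V ω)) - √e|} ⊆ {ω | t / 2 ≤ |l2 (A (V ω)) - m|} := by
      intro ω hω
      have hω : t ≤ |l2 (A (V ω)) - √e| := hω
      have h1 : |l2 (A (V ω)) - √e| ≤ |l2 (A (V ω)) - m| + |m - √e| := abs_sub_le _ _ _
      have h2 : |m - √e| ≤ 2 * (K * L) := by rw [abs_le]; constructor <;> linarith
      change t / 2 ≤ _
      linarith
    refine (measure_mono hsub).trans ((htail (t / 2) (by positivity)).trans ?_)
    refine ENNReal.ofReal_le_ofReal ?_
    have : -(t / 2) ^ 2 / (K * L) ^ 2 = -t ^ 2 / (4 * (K * L) ^ 2) := by field_simp; ring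
    rw [this]
    have := Real.exp_pos (-t ^ 2 / (4 * (K * L) ^ 2))
    linarith
  · push Not at hbig
    refine prob_le_one.trans ?_
    rw [← ENNReal.ofReal_one]
    refine ENNReal.ofReal_le_ofReal ?_
    have h1 : -4 ≤ -t ^ 2 / (4 * (K * L) ^ 2) := by
      rw [le_div_iff₀ (by positivity)]
      nlinarith
    have h2 : Real.exp 4 * Real.exp (-t ^ 2 / (4 * (K * L) ^ 2)) ≥ 1 := by
      rw [← Real.exp_add]; exact Real.one_le_exp (by linarith)
    have h4 : Real.exp 4 ≤ 60 := by
      have : Real.exp 4 = Real.exp 1 ^ 4 := by rw [← Real.exp_nat_mul]; norm_num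
      rw [this]
      have h5 := Real.exp_one_lt_d9
      have h6 := Real.exp_pos 1
      calc Real.exp 1 ^ 4 ≤ 2.7183 ^ 4 := by gcongr; linarith
        _ ≤ 60 := by norm_num
    nlinarith [Real.exp_pos (-t ^ 2 / (4 * (K * L) ^ 2))]

/-- Cross terms between a concentrated vector and an independent one. -/
lemma ConvexConcentration.cross (h : ConvexConcentration μ K V) (hVm : Measurable V)
    (hV : ∀ a, ∫ ω, V ω a ∂μ = 0) (hL : 0 < L) (hA : ∀ v, l2 (A v) ≤ L * l2 v)
    {E : Ω → I → ℝ} (hE : Measurable E) (hind : IndepFun (fun ω => (V ω).ofLp) E μ) {x B : ℝ}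
    (hx : 0 < x) (hB : 0 < B) :
    μ {ω | x ≤ |∑ k, A (V ω) k * E ω k| ∧ ∑ k, E ω k ^ 2 ≤ B}
      ≤ ENNReal.ofReal (2 * Real.exp (-x ^ 2 / (K ^ 2 * L ^ 2 * B))) := by
  classical
  have hAk : ∀ k, Measurable (fun v : q → ℝ => A v k) := fun k =>
    ((LinearMap.proj k ∘ₗ A).continuous_of_finiteDimensional).measurable
  set S : Set ((q → ℝ) × (I → ℝ)) :=
    {p | x ≤ |∑ k, A p.1 k * p.2 k| ∧ ∑ k, p.2 k ^ 2 ≤ B} with hS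
  have hSm : MeasurableSet S := by
    have h1 : Measurable (fun p : (q → ℝ) × (I → ℝ) => |∑ k, A p.1 k * p.2 k|) :=
      continuous_abs.measurable.comp (Finset.measurable_sum _ fun k _ =>
        ((hAk k).comp measurable_fst).mul ((measurable_pi_apply k).comp measurable_snd))
    have h2 : Measurable (fun p : (q → ℝ) × (I → ℝ) => ∑ k, p.2 k ^ 2) := by fun_prop
    exact (measurableSet_le measurable_const h1).inter (measurableSet_le h2 measurable_const)
  have hVm' : Measurable (fun ω => (V ω).ofLp) := (WithLp.measurable_ofLp 2 (q → ℝ)).comp hVm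
  have hset : ∀ Z : Ω → (q → ℝ) × (I → ℝ), Measurable Z →
      ∫⁻ ω, S.indicator 1 (Z ω) ∂μ = μ (Z ⁻¹' S) := by
    intro Z hZ
    rw [← lintegral_indicator_one (hZ hSm)]
    rfl
  have h1 := lintegral_comp_of_indepFun hVm' hE hind (g := S.indicator 1)
    (measurable_one.indicator hSm)
  rw [hset _ (hVm'.prodMk hE)] at h1
  refine (le_of_eq (show _ = μ ((fun ω => ((V ω).ofLp, E ω)) ⁻¹' S) from rfl)).trans ?_
  rw [h1]
  calc _ ≤ ∫⁻ _, ENNReal.ofReal (2 * Real.exp (-x ^ 2 / (K ^ 2 * L ^ 2 * B))) ∂μ := by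
        refine lintegral_mono fun ω => ?_
        rw [hset (fun ω' => ((V ω').ofLp, E ω)) (hVm'.prodMk measurable_const)]
        -- With `E` frozen, either its energy exceeds `B` and the event is empty, or the sum is a
        -- linear form in `V` with Lipschitz constant `L √B`.
        by_cases hEB : ∑ k, E ω k ^ 2 ≤ B
        swap
        · have : (fun ω' => ((V ω').ofLp, E ω)) ⁻¹' S = ∅ := by
            ext ω'; simp [hS, hEB]
          rw [this]; simp
        set u : q → ℝ := fun a => ∑ k, A (Pi.single a 1) k * E ω k with hu
        have hAu : ∀ v : EuclideanSpace ℝ q, ∑ k, A v k * E ω k = ∑ a, u a * v a := by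
          intro v
          have hv : (v.ofLp : q → ℝ) = ∑ a, v a • (Pi.single a 1 : q → ℝ) := by
            ext b; simp [Finset.sum_apply, Pi.single_apply]
          simp only [hu]
          have hAv : ∀ k, A v k = ∑ a, v a * A (Pi.single a 1) k := by
            intro k
            conv_lhs => rw [hv]
            simp only [map_sum, map_smul, Finset.sum_apply, Pi.smul_apply, smul_eq_mul]
          simp only [hAv, Finset.sum_mul]
          rw [Finset.sum_comm]
          refine Finset.sum_congr rfl fun a _ => Finset.sum_congr rfl fun k _ => ?_
          ring
        have hlin := h.linear hV u (r := L * √B) (by positivity) (fun v => by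
          rw [← hAu]
          refine (abs_sum_mul_le_l2 _ _).trans ?_
          have h2 : l2 (E ω) ≤ √B := Real.sqrt_le_sqrt hEB
          have h3 : l2 (A v) ≤ L * ‖v‖ := by
            refine (hA _).trans (le_of_eq ?_); rw [l2_eq_norm]
          calc l2 (A v) * l2 (E ω) ≤ (L * ‖v‖) * √B :=
                mul_le_mul h3 h2 (Real.sqrt_nonneg _) (by positivity)
            _ = _ := by ring) x hx
        refine (measure_mono fun ω' hω' => ?_).trans (hlin.trans (le_of_eq ?_))
        · have := hω'.1
          rw [hAu] at this
          exact this
        · congr 4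
          rw [mul_pow, mul_pow, Real.sq_sqrt hB.le]; ring
    _ = _ := by simp

end Concentration

end

section

/-! ### Iterating a contracting vector autoregression. -/

section Unrolling

variable {ι : Type*} [Fintype ι] [DecidableEq ι]

/-- The linear form `l` pulled back along `n` steps of the matrix `B`. -/
def pullback (B : Matrix ι ι ℝ) (l : ι → ℝ) (n : ℕ) : ι → ℝ := Matrix.vecMul l (B ^ n)

lemma pullback_zero (B : Matrix ι ι ℝ) (l : ι → ℝ) : pullback B l 0 = l := by simp [pullback]

lemma pullback_succ (B : Matrix ι ι ℝ) (l : ι → ℝ) (n : ℕ) (b : ι) :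
    pullback B l (n + 1) b = ∑ a, pullback B l n a * B a b := by
  unfold pullback
  rw [pow_succ, ← Matrix.vecMul_vecMul]
  rfl

/-- Row sums of `|B|` are at most `κ`, so every step contracts the `ℓ¹` norm of a linear form by
`κ`, in any dimension. -/
lemma sum_abs_pullback_le {B : Matrix ι ι ℝ} {κ : ℝ} (hκ : 0 ≤ κ) (hB : ∀ a, ∑ b, |B a b| ≤ κ)
    (l : ι → ℝ) (n : ℕ) : ∑ b, |pullback B l n b| ≤ (∑ a, |l a|) * κ ^ n := by
  induction n with
  | zero => simp [pullback_zero]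
  | succ n ih =>
    calc ∑ b, |pullback B l (n + 1) b| ≤ ∑ b, ∑ a, |pullback B l n a| * |B a b| := by
          refine Finset.sum_le_sum fun b _ => ?_
          rw [pullback_succ]
          refine (Finset.abs_sum_le_sum_abs _ _).trans (le_of_eq ?_)
          simp_rw [abs_mul]
      _ = ∑ a, |pullback B l n a| * ∑ b, |B a b| := by
          rw [Finset.sum_comm]; simp_rw [Finset.mul_sum]
      _ ≤ ∑ a, |pullback B l n a| * κ := by gcongr; exact hB _
      _ = (∑ a, |pullback B l n a|) * κ := by rw [Finset.sum_mul]
      _ ≤ ((∑ a, |l a|) * κ ^ n) * κ := by gcongr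
      _ = _ := by rw [pow_succ]; ring

/-- The induction peels off the first step, from `s` to `s + 1`; this is why `s` is generalised. -/
lemma sum_mul_unroll {B : Matrix ι ι ℝ} {y w : ℤ → ι → ℝ}
    (h : ∀ t a, y t a = ∑ b, B a b * y (t - 1) b + w t a) (l : ι → ℝ) (s : ℤ) (n : ℕ) :
    ∑ a, l a * y (s + n) a = ∑ a, pullback B l n a * y s a
      + ∑ τ ∈ Finset.range n, ∑ a, pullback B l τ a * w (s + (n : ℤ) - τ) a := by
  induction n generalizing s with
  | zero => simp [pullback_zero]
  | succ n ih =>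
    have h1 := ih (s + 1)
    have e1 : s + 1 + (n : ℤ) = s + ((n + 1 : ℕ) : ℤ) := by push_cast; ring
    rw [e1] at h1
    rw [h1, Finset.sum_range_succ]
    have e2 : s + ((n + 1 : ℕ) : ℤ) - n = s + 1 := by push_cast; ring
    have h2 : ∑ a, pullback B l n a * y (s + 1) a
        = ∑ a, pullback B l (n + 1) a * y s a + ∑ a, pullback B l n a * w (s + 1) a := by
      have : ∀ a, pullback B l n a * y (s + 1) a
          = ∑ b, pullback B l n a * (B a b * y s b) + pullback B l n a * w (s + 1) a := by
        intro a
        rw [h (s + 1) a, mul_add, Finset.mul_sum, add_sub_cancel_right]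
      rw [Finset.sum_congr rfl fun a _ => this a, Finset.sum_add_distrib, Finset.sum_comm]
      congr 1
      refine Finset.sum_congr rfl fun b _ => ?_
      rw [pullback_succ, Finset.sum_mul]
      exact Finset.sum_congr rfl fun a _ => by ring
    rw [h2, e2]
    ring

end Unrolling

/-! ### Finite nets of directions. -/

section Net

/-- A `1`-separated subset of the ball of radius `2` has at most `5^d` points, so one of maximal
cardinality exists. A point far from all of it could be added. -/
lemma exists_separated_net (d : Type) [Fintype d] :
    ∃ s : Finset (EuclideanSpace ℝ d), s.card ≤ 5 ^ Fintype.card d ∧ (∀ c ∈ s, ‖c‖ ≤ 2) ∧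
      ∀ x, ‖x‖ ≤ 2 → ∃ c ∈ s, ‖x - c‖ ≤ 1 := by
  classical
  set P : Finset (EuclideanSpace ℝ d) → Prop := fun s => (∀ c ∈ s, ‖c‖ ≤ 2) ∧
    ∀ c ∈ s, ∀ e ∈ s, c ≠ e → 1 ≤ ‖c - e‖ with hP
  have hcard : ∀ s, P s → s.card ≤ 5 ^ Fintype.card d := by
    intro s hs
    have := Besicovitch.card_le_of_separated s hs.1 hs.2
    rwa [finrank_euclideanSpace] at this
  have hne : {n | ∃ s, P s ∧ s.card = n}.Nonempty := ⟨0, ∅, by simp [hP], rfl⟩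
  have hbd : BddAbove {n | ∃ s, P s ∧ s.card = n} :=
    ⟨5 ^ Fintype.card d, by rintro n ⟨s, hs, rfl⟩; exact hcard s hs⟩
  obtain ⟨s, hs, hsc⟩ := Nat.sSup_mem hne hbd
  refine ⟨s, hcard s hs, hs.1, fun x hx => ?_⟩
  by_contra! hcon
  have hxs : x ∉ s := fun hxs => by
    have := hcon x hxs
    simp at this
    linarith
  have hPi : P (insert x s) := by
    refine ⟨?_, ?_⟩
    · intro c hc
      rcases Finset.mem_insert.1 hc with rfl | hc
      · exact hx
      · exact hs.1 c hc
    · intro c hc e he hce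
      rcases Finset.mem_insert.1 hc with hc' | hc' <;>
        rcases Finset.mem_insert.1 he with he' | he'
      · exact absurd (hc'.trans he'.symm) hce
      · rw [hc']; exact (hcon e he').le
      · rw [he', norm_sub_rev]; exact (hcon c hc').le
      · exact hs.2 c hc' e he' hce
  have := le_csSup hbd ⟨insert x s, hPi, rfl⟩
  rw [Finset.card_insert_of_notMem hxs, ← hsc] at this
  omega

/-- A finite subset of the unit ball that determines linear forms up to a factor `2`. -/
lemma exists_norming_net (d : Type) [Fintype d] :
    ∃ S : Finset (d → ℝ), S.card ≤ 5 ^ Fintype.card d ∧ (∀ x ∈ S, l2 x ≤ 1) ∧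
      ∀ (f : (d → ℝ) →ₗ[ℝ] ℝ) (b : ℝ), (∀ x ∈ S, |f x| ≤ b) → ∀ u, |f u| ≤ 2 * b * l2 u := by
  classical
  obtain ⟨s, hsc, hs2, hs⟩ := exists_separated_net d
  refine ⟨s.image fun c => (2 : ℝ)⁻¹ • c.ofLp, Finset.card_image_le.trans hsc, ?_, ?_⟩
  · intro x hx
    obtain ⟨c, hc, rfl⟩ := Finset.mem_image.1 hx
    rw [l2_eq_norm, WithLp.toLp_smul, norm_smul]
    have := hs2 c hc
    simp only [norm_inv, Real.norm_ofNat, WithLp.toLp_ofLp]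
    linarith
  · intro f b hb u
    set F : EuclideanSpace ℝ d →L[ℝ] ℝ :=
      LinearMap.toContinuousLinearMap (f ∘ₗ (WithLp.linearEquiv 2 ℝ (d → ℝ)).toLinearMap) with hF
    have hFa : ∀ v : EuclideanSpace ℝ d, F v = f v.ofLp := fun v => rfl
    -- The halved net is `1/2`-dense in the unit ball, hence `‖F‖ ≤ b + ‖F‖ / 2`, which gives the
    -- factor `2`.
    have hball : ∀ x : EuclideanSpace ℝ d, ‖x‖ ≤ 1 → |F x| ≤ b + ‖F‖ * 2⁻¹ := by
      intro x hx
      obtain ⟨c, hc, hxc⟩ := hs ((2 : ℝ) • x) (by rw [norm_smul]; simp; linarith)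
      have h1 : ‖x - (2 : ℝ)⁻¹ • c‖ ≤ 2⁻¹ := by
        have : x - (2 : ℝ)⁻¹ • c = (2 : ℝ)⁻¹ • ((2 : ℝ) • x - c) := by
          rw [smul_sub, smul_smul]; simp
        rw [this, norm_smul]
        simp only [norm_inv, Real.norm_ofNat]
        linarith
      have h2 : |F ((2 : ℝ)⁻¹ • c)| ≤ b := hb _ (Finset.mem_image.2 ⟨c, hc, rfl⟩)
      have h3 : F x = F ((2 : ℝ)⁻¹ • c) + F (x - (2 : ℝ)⁻¹ • c) := by rw [← map_add]; simp
      rw [h3]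
      refine (abs_add_le _ _).trans (add_le_add h2 ?_)
      exact (F.le_opNorm _).trans (by gcongr)
    have hpos : 0 ≤ b + ‖F‖ * 2⁻¹ := (abs_nonneg _).trans (hball 0 (by simp))
    have hop : ‖F‖ ≤ b + ‖F‖ * 2⁻¹ :=
      ContinuousLinearMap.opNorm_le_of_unit_norm hpos fun x hx => hball x hx.le
    have h4 := F.le_opNorm (WithLp.toLp 2 u)
    rw [← l2_eq_norm] at h4
    refine (show |f u| ≤ _ from h4).trans ?_
    have : 0 ≤ l2 u := Real.sqrt_nonneg _
    gcongr
    linarith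

end Net

/-! ### Quadratic forms and extreme eigenvalues. -/

section Spectral

/-- Shifting moves the spectrum: `M - λ_min` and `λ_max - M` have nonnegative spectrum, hence are
positive semidefinite. -/
lemma quadratic_form_bounds {d : Type} [Fintype d] [DecidableEq d] {M : Matrix d d ℝ}
    (hM : M.IsHermitian) (u : d → ℝ) :
    lambdaMin M * ∑ a, u a ^ 2 ≤ ∑ a, ∑ b, u a * M a b * u b ∧
      ∑ a, ∑ b, u a * M a b * u b ≤ lambdaMax M * ∑ a, u a ^ 2 := by
  have hfin : (spectrum ℝ M).Finite := by
    rw [hM.spectrum_real_eq_range_eigenvalues]; exact Set.finite_range _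
  have hq : ∑ a, ∑ b, u a * M a b * u b = u ⬝ᵥ (M.mulVec u) := by
    simp only [dotProduct, Matrix.mulVec, Finset.mul_sum, mul_assoc]
  have hn : ∑ a, u a ^ 2 = u ⬝ᵥ u := by simp only [dotProduct, sq]
  have key : ∀ (N : Matrix d d ℝ), N.IsHermitian → (∀ x ∈ spectrum ℝ N, 0 ≤ x) →
      0 ≤ u ⬝ᵥ (N.mulVec u) := by
    intro N hN hx
    have hps : N.PosSemidef := by
      rw [hN.posSemidef_iff_eigenvalues_nonneg]
      intro i
      refine hx _ ?_
      rw [hN.spectrum_real_eq_range_eigenvalues]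
      exact ⟨i, rfl⟩
    simpa using hps.dotProduct_mulVec_nonneg u
  have hc : ∀ c : ℝ, (algebraMap ℝ (Matrix d d ℝ) c).IsHermitian := by
    intro c
    rw [Algebra.algebraMap_eq_smul_one]
    ext a b
    simp [Matrix.one_apply, eq_comm]
  have hmv : ∀ c : ℝ, u ⬝ᵥ ((algebraMap ℝ (Matrix d d ℝ) c).mulVec u) = c * (u ⬝ᵥ u) := by
    intro c
    rw [Algebra.algebraMap_eq_smul_one, Matrix.smul_mulVec, Matrix.one_mulVec, dotProduct_smul,
      smul_eq_mul]
  rw [hq, hn]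
  constructor
  · have := key (M - algebraMap ℝ _ (lambdaMin M)) (hM.sub (hc _)) ?_
    · rw [Matrix.sub_mulVec, dotProduct_sub, hmv] at this
      linarith
    · intro x hx
      rw [← spectrum.sub_singleton_eq] at hx
      obtain ⟨y, hy, z, rfl, rfl⟩ := hx
      have : lambdaMin M ≤ y := csInf_le hfin.bddBelow hy
      linarith
  · have := key (algebraMap ℝ _ (lambdaMax M) - M) ((hc _).sub hM) ?_
    · rw [Matrix.sub_mulVec, dotProduct_sub, hmv] at this
      linarith
    · intro x hx
      rw [← spectrum.singleton_sub_eq] at hx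
      obtain ⟨z, rfl, y, hy, rfl⟩ := hx
      have : y ≤ lambdaMax M := le_csSup hfin.bddAbove hy
      linarith

end Spectral

end

section

/-! ### The panel in vector form; moments of regressors and responses. -/

namespace Panel

variable {Ω : Type*} {N1 N2 p1 p2 G0 H0 G H : ℕ}

section Deterministic

variable (M : Panel Ω N1 N2 p1 p2 G0 H0)

/-- Coefficients of `Y_{t-1}` in `𝒳_ijtᵀ u`. -/
def lagForm (i : Fin N1) (j : Fin N2) (u : RegIdx p1 p2 → ℝ) (b : Fin N1 × Fin N2) : ℝ :=
  (if b.2 = j then u (.inl (.inl ())) * M.W1 i b.1 else 0)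
    + (if b.1 = i then u (.inr (.inl (.inl ()))) * M.W2 b.2 j else 0)
    + (if b = (i, j) then u (.inr (.inr ())) else 0)

/-- Contribution of the covariates to `𝒳_ijtᵀ u`. -/
def covForm (i : Fin N1) (j : Fin N2) (u : RegIdx p1 p2 → ℝ) (t : ℤ) (ω : Ω) : ℝ :=
  ∑ a, M.X i t ω a * u (.inl (.inr a)) + ∑ a, M.Z j t ω a * u (.inr (.inl (.inr a)))

/-- The linear form `𝒳_ijtᵀ u`. -/
def regForm (i : Fin N1) (j : Fin N2) (u : RegIdx p1 p2 → ℝ) (t : ℤ) (ω : Ω) : ℝ :=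
  ∑ a, M.reg i j t ω a * u a

/-- The true coefficient vector `Θ⁰_ij`. -/
def coef0 (i : Fin N1) (j : Fin N2) : RegIdx p1 p2 → ℝ := M.par.coef (M.g0 i) (M.h0 j)

lemma regForm_eq (i : Fin N1) (j : Fin N2) (u : RegIdx p1 p2 → ℝ) (t : ℤ) (ω : Ω) :
    M.regForm i j u t ω
      = ∑ b, M.lagForm i j u b * M.Y b.1 b.2 (t - 1) ω + M.covForm i j u t ω := by
  have h1 : ∑ b : Fin N1 × Fin N2, M.lagForm i j u b * M.Y b.1 b.2 (t - 1) ω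
      = (∑ k, M.W1 i k * M.Y k j (t - 1) ω) * u (.inl (.inl ()))
        + (∑ k, M.Y i k (t - 1) ω * M.W2 k j) * u (.inr (.inl (.inl ())))
        + M.Y i j (t - 1) ω * u (.inr (.inr ())) := by
    simp only [lagForm, add_mul, Finset.sum_add_distrib, ite_mul, zero_mul]
    congr 1
    · congr 1
      · rw [Fintype.sum_prod_type]
        simp only [Finset.sum_ite_eq', Finset.mem_univ, if_true, Finset.sum_mul]
        exact Finset.sum_congr rfl fun k _ => by ring
      · rw [Fintype.sum_prod_type_right]
        simp only [Finset.sum_ite_eq', Finset.mem_univ, if_true, Finset.sum_mul]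
        exact Finset.sum_congr rfl fun k _ => by ring
    · simp only [Finset.sum_ite_eq', Finset.mem_univ, if_true]
      ring
  rw [h1]
  unfold regForm covForm reg
  simp only [Fintype.sum_sum_type, Sum.elim_inl, Sum.elim_inr, Finset.univ_unique,
    Finset.sum_singleton]
  simp only [show ∀ x : Unit, x = () from fun _ => rfl]
  ring

/-- A normalised row sums to `1`, or to `0` for an isolated node because of `0 / 0 = 0`. -/
lemma abs_W1_sum_le (hA : ∀ i k, M.A1 i k = 0 ∨ M.A1 i k = 1) (i : Fin N1) :
    ∑ k, |M.W1 i k| ≤ 1 := by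
  have h0 : ∀ k, 0 ≤ M.A1 i k := fun k => by rcases hA i k with h | h <;> norm_num [h]
  have hs : 0 ≤ ∑ l, M.A1 i l := Finset.sum_nonneg fun k _ => h0 k
  have : ∀ k, |M.W1 i k| = M.A1 i k / ∑ l, M.A1 i l := fun k =>
    abs_of_nonneg (div_nonneg (h0 k) hs)
  simp_rw [this, ← Finset.sum_div]
  exact div_self_le_one _

lemma abs_W2_sum_le (hA : ∀ k j, M.A2 k j = 0 ∨ M.A2 k j = 1) (j : Fin N2) :
    ∑ k, |M.W2 k j| ≤ 1 := by
  have h0 : ∀ k, 0 ≤ M.A2 k j := fun k => by rcases hA k j with h | h <;> norm_num [h]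
  have hs : 0 ≤ ∑ l, M.A2 l j := Finset.sum_nonneg fun k _ => h0 k
  have : ∀ k, |M.W2 k j| = M.A2 k j / ∑ l, M.A2 l j := fun k =>
    abs_of_nonneg (div_nonneg (h0 k) hs)
  simp_rw [this, ← Finset.sum_div]
  exact div_self_le_one _

/-- Each network average has absolute weights of total at most `1`. At the true coefficients the
bound is at most `κ` by stability; at a unit vector `u` it is at most `3`. -/
lemma sum_abs_lagForm_le (hA1 : ∀ i k, M.A1 i k = 0 ∨ M.A1 i k = 1)
    (hA2 : ∀ k j, M.A2 k j = 0 ∨ M.A2 k j = 1) (i : Fin N1) (j : Fin N2)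
    (u : RegIdx p1 p2 → ℝ) :
    ∑ b, |M.lagForm i j u b|
      ≤ |u (.inl (.inl ()))| + |u (.inr (.inl (.inl ())))| + |u (.inr (.inr ()))| := by
  have h1 : ∀ b, |M.lagForm i j u b|
      ≤ (if b.2 = j then |u (.inl (.inl ()))| * |M.W1 i b.1| else 0)
        + (if b.1 = i then |u (.inr (.inl (.inl ())))| * |M.W2 b.2 j| else 0)
        + (if b = (i, j) then |u (.inr (.inr ()))| else 0) := by
    intro b
    unfold lagForm
    refine (abs_add_three _ _ _).trans (le_of_eq ?_)
    congr 1
    · congr 1 <;> split_ifs <;> simp [abs_mul]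
    · split_ifs <;> simp
  refine (Finset.sum_le_sum fun b _ => h1 b).trans ?_
  simp only [Finset.sum_add_distrib]
  refine add_le_add (add_le_add ?_ ?_) ?_
  · rw [Fintype.sum_prod_type]
    simp only [Finset.sum_ite_eq', Finset.mem_univ, if_true]
    rw [← Finset.mul_sum]
    exact mul_le_of_le_one_right (abs_nonneg _) (M.abs_W1_sum_le hA1 i)
  · rw [Fintype.sum_prod_type_right]
    simp only [Finset.sum_ite_eq', Finset.mem_univ, if_true]
    rw [← Finset.mul_sum]
    exact mul_le_of_le_one_right (abs_nonneg _) (M.abs_W2_sum_le hA2 j)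
  · simp

/-- The transition matrix of the vectorised autoregression. -/
def transition : Matrix (Fin N1 × Fin N2) (Fin N1 × Fin N2) ℝ :=
  fun a b => M.lagForm a.1 a.2 (M.coef0 a.1 a.2) b

end Deterministic

section Moments

variable [MeasurableSpace Ω] {μ : Measure Ω} [IsProbabilityMeasure μ]
  {M : Panel Ω N1 N2 p1 p2 G0 H0} {T : ℕ} {R τlo τhi σ K c κ cgap cpi : ℝ}

lemma IsModel.measurable_X_apply (hm : M.IsModel μ) (i : Fin N1) (t : ℤ) (a : Fin p1) :
    Measurable (fun ω => M.X i t ω a) := (measurable_pi_apply a).comp (hm.measurable_X i t)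

lemma IsModel.measurable_Z_apply (hm : M.IsModel μ) (j : Fin N2) (t : ℤ) (a : Fin p2) :
    Measurable (fun ω => M.Z j t ω a) := (measurable_pi_apply a).comp (hm.measurable_Z j t)

lemma IsModel.Y_eq (hm : M.IsModel μ) (i : Fin N1) (j : Fin N2) (t : ℤ) (ω : Ω) :
    M.Y i j t ω = M.regForm i j (M.coef0 i j) t ω + M.eps i j t ω := by
  rw [hm.equation]
  unfold regForm coef0 reg Params.coef Params.row Params.col
  simp only [Fintype.sum_sum_type, Sum.elim_inl, Sum.elim_inr, Finset.univ_unique,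
    Finset.sum_singleton]
  ring

lemma IsModel.transition_sum_le (hm : M.IsModel μ)
    (ha : ∀ g h, |M.par.lam g| + |M.par.gam h| + |M.par.alpha g h| ≤ κ)
    (a : Fin N1 × Fin N2) : ∑ b, |M.transition a b| ≤ κ :=
  (M.sum_abs_lagForm_le hm.adj1 hm.adj2 a.1 a.2 _).trans (ha (M.g0 a.1) (M.h0 a.2))

/-- Innovation of the vectorised autoregression. -/
def innov (M : Panel Ω N1 N2 p1 p2 G0 H0) (t : ℤ) (ω : Ω) (a : Fin N1 × Fin N2) : ℝ :=
  M.covForm a.1 a.2 (M.coef0 a.1 a.2) t ω + M.eps a.1 a.2 t ω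

lemma IsModel.vec_eq (hm : M.IsModel μ) (ω : Ω) (t : ℤ) (a : Fin N1 × Fin N2) :
    M.Y a.1 a.2 t ω
      = ∑ b, M.transition a b * M.Y b.1 b.2 (t - 1) ω + M.innov t ω a := by
  rw [hm.Y_eq, regForm_eq, innov, add_assoc]
  rfl

lemma IsModel.measurable_projected (hm : M.IsModel μ) (s : ℤ)
    (η1 : Fin 2 → Fin N1 → Fin p1 → ℝ) (η2 : Fin 2 → Fin N2 → Fin p2 → ℝ) :
    Measurable (M.projected T s η1 η2) := by
  refine (WithLp.measurable_toLp 2 _).comp (measurable_pi_lambda _ ?_)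
  rintro ⟨l, b, i | j⟩
  · exact Finset.measurable_sum _ fun a _ => (hm.measurable_X_apply i _ a).mul_const _
  · exact Finset.measurable_sum _ fun a _ => (hm.measurable_Z_apply j _ a).mul_const _

lemma IsModel.measurable_covForm (hm : M.IsModel μ) (i : Fin N1) (j : Fin N2)
    (u : RegIdx p1 p2 → ℝ) (t : ℤ) : Measurable (M.covForm i j u t) :=
  (Finset.measurable_sum _ fun a _ => (hm.measurable_X_apply i _ a).mul_const _).add
    (Finset.measurable_sum _ fun a _ => (hm.measurable_Z_apply j _ a).mul_const _)

lemma IsModel.measurable_regForm (hm : M.IsModel μ) (i : Fin N1) (j : Fin N2)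
    (u : RegIdx p1 p2 → ℝ) (t : ℤ) : Measurable (M.regForm i j u t) := by
  have : M.regForm i j u t = fun ω => ∑ b, M.lagForm i j u b * M.Y b.1 b.2 (t - 1) ω
      + M.covForm i j u t ω := by ext ω; exact M.regForm_eq i j u t ω
  rw [this]
  exact (Finset.measurable_sum _ fun b _ => (hm.measurable_Y _ _ _).const_mul _).add
    (hm.measurable_covForm i j u t)

/-- The direction `c e_a` has norm `c`, so it is admissible in the concentration assumption;
division by `c` recovers the coordinate. -/
lemma Assumptions.integrable_X (ha : M.Assumptions μ T R τlo τhi σ K c κ cgap cpi) (hc : 0 < c)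
    (i : Fin N1) (t : ℤ) (a : Fin p1) : Integrable (fun ω => M.X i t ω a) μ := by
  have h := ha.concentration t (fun _ _ a' => if a' = a then c else 0) 0
    (fun b i => by simp [Finset.sum_ite_eq', ite_pow]) (fun b j => by simp; positivity)
  have h1 := (h.integrable_coord ((0 : Fin (T + 1)), (0 : Fin 2), Sum.inl i)).mul_const c⁻¹
  refine h1.congr (ae_of_all _ fun ω => ?_)
  simp [projected, hc.ne']

lemma Assumptions.integrable_Z (ha : M.Assumptions μ T R τlo τhi σ K c κ cgap cpi) (hc : 0 < c)
    (j : Fin N2) (t : ℤ) (a : Fin p2) : Integrable (fun ω => M.Z j t ω a) μ := by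
  have h := ha.concentration t 0 (fun _ _ a' => if a' = a then c else 0)
    (fun b i => by simp; positivity) (fun b j => by simp [Finset.sum_ite_eq', ite_pow])
  have h1 := (h.integrable_coord ((0 : Fin (T + 1)), (0 : Fin 2), Sum.inr j)).mul_const c⁻¹
  refine h1.congr (ae_of_all _ fun ω => ?_)
  simp [projected, hc.ne']

lemma Assumptions.integral_projected (ha : M.Assumptions μ T R τlo τhi σ K c κ cgap cpi)
    (hc : 0 < c) (s : ℤ) (η1 : Fin 2 → Fin N1 → Fin p1 → ℝ) (η2 : Fin 2 → Fin N2 → Fin p2 → ℝ)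
    (q : Fin (T + 1) × Fin 2 × (Fin N1 ⊕ Fin N2)) :
    ∫ ω, M.projected T s η1 η2 ω q ∂μ = 0 := by
  obtain ⟨l, b, i | j⟩ := q
  · simp only [projected]
    rw [integral_finsetSum _ fun a _ => (ha.integrable_X hc i _ a).mul_const _]
    simp [integral_mul_const, ha.X_mean]
  · simp only [projected]
    rw [integral_finsetSum _ fun a _ => (ha.integrable_Z hc j _ a).mul_const _]
    simp [integral_mul_const, ha.Z_mean]

lemma abs_coord_le_norm {q : Type} [Fintype q] [DecidableEq q] (a : q) (v : EuclideanSpace ℝ q) :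
    |∑ b, (if b = a then (1 : ℝ) else 0) * v b| ≤ 1 * ‖v‖ := by
  rw [one_mul]
  simpa using PiLp.norm_apply_le v a

/-- The direction is rescaled by `c / r` to be admissible, whence the scale `K r / c`. It depends on
the norm of `u`, not on `p1`. -/
lemma Assumptions.sq_X (ha : M.Assumptions μ T R τlo τhi σ K c κ cgap cpi) (hm : M.IsModel μ)
    (hc : 0 < c) (hK : 0 < K) (i : Fin N1) (t : ℤ) {u : Fin p1 → ℝ} {r : ℝ} (hr : 0 < r)
    (hu : ∑ a, u a ^ 2 ≤ r ^ 2) :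
    expMom μ (fun ω => (∑ a, M.X i t ω a * u a) ^ 2 / (2 * (K * r / c) ^ 2)) ≤ 3 := by
  have h := ha.concentration t (fun _ _ a => c / r * u a) 0
    (fun b i => by
      simp_rw [mul_pow]
      rw [← Finset.mul_sum, div_pow, div_mul_eq_mul_div, div_le_iff₀ (by positivity)]
      gcongr) (fun b j => by simp; positivity)
  have h1 := h.linear (ha.integral_projected hc t _ _)
    (fun b => if b = ((0 : Fin (T + 1)), (0 : Fin 2), Sum.inl i) then (1 : ℝ) else 0) one_pos
    (fun v => abs_coord_le_norm _ v)
  simp only [ite_mul, one_mul, zero_mul, Finset.sum_ite_eq', Finset.mem_univ, if_true, projected,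
    Fin.val_zero, Nat.cast_zero, add_zero, mul_one] at h1
  have h2 := expMom_sq_le_of_tail
    (Finset.measurable_sum _ fun a _ => (hm.measurable_X_apply i t a).mul_const _) hK h1
  refine le_trans (le_of_eq ?_) h2
  congr 1
  ext ω
  have : ∑ a, M.X i t ω a * (c / r * u a) = c / r * ∑ a, M.X i t ω a * u a := by
    rw [Finset.mul_sum]; exact Finset.sum_congr rfl fun a _ => by ring
  rw [this]
  field_simp

lemma Assumptions.sq_Z (ha : M.Assumptions μ T R τlo τhi σ K c κ cgap cpi) (hm : M.IsModel μ)
    (hc : 0 < c) (hK : 0 < K) (j : Fin N2) (t : ℤ) {u : Fin p2 → ℝ} {r : ℝ} (hr : 0 < r)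
    (hu : ∑ a, u a ^ 2 ≤ r ^ 2) :
    expMom μ (fun ω => (∑ a, M.Z j t ω a * u a) ^ 2 / (2 * (K * r / c) ^ 2)) ≤ 3 := by
  have h := ha.concentration t 0 (fun _ _ a => c / r * u a)
    (fun b i => by simp; positivity) (fun b j => by
      simp_rw [mul_pow]
      rw [← Finset.mul_sum, div_pow, div_mul_eq_mul_div, div_le_iff₀ (by positivity)]
      gcongr)
  have h1 := h.linear (ha.integral_projected hc t _ _)
    (fun b => if b = ((0 : Fin (T + 1)), (0 : Fin 2), Sum.inr j) then (1 : ℝ) else 0) one_pos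
    (fun v => abs_coord_le_norm _ v)
  simp only [ite_mul, one_mul, zero_mul, Finset.sum_ite_eq', Finset.mem_univ, if_true, projected,
    Fin.val_zero, Nat.cast_zero, add_zero, mul_one] at h1
  have h2 := expMom_sq_le_of_tail
    (Finset.measurable_sum _ fun a _ => (hm.measurable_Z_apply j t a).mul_const _) hK h1
  refine le_trans (le_of_eq ?_) h2
  congr 1
  ext ω
  have : ∑ a, M.Z j t ω a * (c / r * u a) = c / r * ∑ a, M.Z j t ω a * u a := by
    rw [Finset.mul_sum]; exact Finset.sum_congr rfl fun a _ => by ring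
  rw [this]
  field_simp

lemma Assumptions.memLp_X (ha : M.Assumptions μ T R τlo τhi σ K c κ cgap cpi) (hm : M.IsModel μ)
    (hc : 0 < c) (hK : 0 < K) (i : Fin N1) (t : ℤ) (a : Fin p1) :
    MemLp (fun ω => M.X i t ω a) 2 μ := by
  have h := ha.sq_X hm hc hK i t (u := Pi.single a 1) one_pos (by simp [Pi.single_apply, ite_pow])
  have h1 := (integrable_sq_of_expMom
    (Finset.measurable_sum _ fun a _ => (hm.measurable_X_apply i t a).mul_const _)
    (by positivity) h).1
  simp only [Pi.single_apply, mul_ite, mul_one, mul_zero, Finset.sum_ite_eq', Finset.mem_univ,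
    if_true] at h1
  exact (memLp_two_iff_integrable_sq (hm.measurable_X_apply i t a).aestronglyMeasurable).2 h1

lemma Assumptions.memLp_Z (ha : M.Assumptions μ T R τlo τhi σ K c κ cgap cpi) (hm : M.IsModel μ)
    (hc : 0 < c) (hK : 0 < K) (j : Fin N2) (t : ℤ) (a : Fin p2) :
    MemLp (fun ω => M.Z j t ω a) 2 μ := by
  have h := ha.sq_Z hm hc hK j t (u := Pi.single a 1) one_pos (by simp [Pi.single_apply, ite_pow])
  have h1 := (integrable_sq_of_expMom
    (Finset.measurable_sum _ fun a _ => (hm.measurable_Z_apply j t a).mul_const _)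
    (by positivity) h).1
  simp only [Pi.single_apply, mul_ite, mul_one, mul_zero, Finset.sum_ite_eq', Finset.mem_univ,
    if_true] at h1
  exact (memLp_two_iff_integrable_sq (hm.measurable_Z_apply j t a).aestronglyMeasurable).2 h1

lemma Assumptions.memLp_reg (ha : M.Assumptions μ T R τlo τhi σ K c κ cgap cpi) (hm : M.IsModel μ)
    (hc : 0 < c) (hK : 0 < K) (i : Fin N1) (j : Fin N2) (t : ℤ) (a : RegIdx p1 p2) :
    MemLp (fun ω => M.reg i j t ω a) 2 μ := by
  rcases a with (_ | a) | ((_ | a) | _)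
  · change MemLp (fun ω => ∑ k, M.W1 i k * M.Y k j (t - 1) ω) 2 μ
    exact memLp_finsetSum _ fun k _ => (hm.memLp_Y k j (t - 1)).const_mul _
  · exact ha.memLp_X hm hc hK i t a
  · change MemLp (fun ω => ∑ k, M.Y i k (t - 1) ω * M.W2 k j) 2 μ
    exact memLp_finsetSum _ fun k _ => (hm.memLp_Y i k (t - 1)).mul_const _
  · exact ha.memLp_Z hm hc hK j t a
  · exact hm.memLp_Y i j (t - 1)

lemma Assumptions.memLp_regForm (ha : M.Assumptions μ T R τlo τhi σ K c κ cgap cpi)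
    (hm : M.IsModel μ) (hc : 0 < c) (hK : 0 < K) (i : Fin N1) (j : Fin N2)
    (u : RegIdx p1 p2 → ℝ) (t : ℤ) : MemLp (M.regForm i j u t) 2 μ :=
  memLp_finsetSum _ fun a _ => (ha.memLp_reg hm hc hK i j t a).mul_const _

/-- The quadratic form `uᵀ Σ_ij u`. -/
def quad (M : Panel Ω N1 N2 p1 p2 G0 H0) (μ : Measure Ω) (i : Fin N1) (j : Fin N2)
    (u : RegIdx p1 p2 → ℝ) : ℝ := ∫ ω, M.regForm i j u 0 ω ^ 2 ∂μ

lemma Assumptions.integral_regForm_mul (ha : M.Assumptions μ T R τlo τhi σ K c κ cgap cpi)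
    (hm : M.IsModel μ) (hc : 0 < c) (hK : 0 < K) (i : Fin N1) (j : Fin N2)
    (u v : RegIdx p1 p2 → ℝ) (t : ℤ) :
    ∫ ω, M.regForm i j u t ω * M.regForm i j v t ω ∂μ
      = ∑ a, ∑ b, u a * M.secondMoment μ i j t a b * v b := by
  have hi : ∀ a b, Integrable (fun ω => M.reg i j t ω a * M.reg i j t ω b) μ := fun a b =>
    (ha.memLp_reg hm hc hK i j t a).integrable_mul (ha.memLp_reg hm hc hK i j t b)
  have h1 : (fun ω => M.regForm i j u t ω * M.regForm i j v t ω)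
      = fun ω => ∑ a, ∑ b, u a * v b * (M.reg i j t ω a * M.reg i j t ω b) := by
    ext ω
    simp only [regForm, Finset.sum_mul_sum]
    exact Finset.sum_congr rfl fun a _ => Finset.sum_congr rfl fun b _ => by ring
  rw [h1, integral_finsetSum _ fun a _ => integrable_finsetSum _ fun b _ => (hi a b).const_mul _]
  refine Finset.sum_congr rfl fun a _ => ?_
  rw [integral_finsetSum _ fun b _ => (hi a b).const_mul _]
  refine Finset.sum_congr rfl fun b _ => ?_
  rw [integral_const_mul, secondMoment]
  ring

lemma Assumptions.integral_regForm_sq (ha : M.Assumptions μ T R τlo τhi σ K c κ cgap cpi)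
    (hm : M.IsModel μ) (hc : 0 < c) (hK : 0 < K) (i : Fin N1) (j : Fin N2)
    (u : RegIdx p1 p2 → ℝ) (t : ℤ) :
    ∫ ω, M.regForm i j u t ω ^ 2 ∂μ = M.quad μ i j u := by
  unfold quad
  simp only [pow_two]
  rw [ha.integral_regForm_mul hm hc hK, ha.integral_regForm_mul hm hc hK, hm.stationary i j t]

lemma Assumptions.quad_bounds (ha : M.Assumptions μ T R τlo τhi σ K c κ cgap cpi)
    (hm : M.IsModel μ) (hc : 0 < c) (hK : 0 < K) (i : Fin N1) (j : Fin N2)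
    (u : RegIdx p1 p2 → ℝ) :
    M.tauMin μ * ∑ a, u a ^ 2 ≤ M.quad μ i j u ∧ M.quad μ i j u ≤ M.tauMax μ * ∑ a, u a ^ 2 := by
  have hH : (M.secondMoment μ i j 0).IsHermitian := by
    ext a b
    simp [secondMoment, Matrix.conjTranspose_apply, mul_comm]
  obtain ⟨h1, h2⟩ := quadratic_form_bounds hH u
  have h3 : M.quad μ i j u = ∑ a, ∑ b, u a * M.secondMoment μ i j 0 a b * u b := by
    unfold quad
    simp only [pow_two]
    exact ha.integral_regForm_mul hm hc hK i j u u 0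
  have hu : 0 ≤ ∑ a, u a ^ 2 := Finset.sum_nonneg fun _ _ => sq_nonneg _
  have hmin : M.tauMin μ ≤ lambdaMin (M.secondMoment μ i j 0) :=
    (ciInf_le (Set.finite_range _).bddBelow i).trans (ciInf_le (Set.finite_range _).bddBelow j)
  have hmax : lambdaMax (M.secondMoment μ i j 0) ≤ M.tauMax μ :=
    (le_ciSup (f := fun j => lambdaMax (M.secondMoment μ i j 0))
      (Set.finite_range _).bddAbove j).trans
      (le_ciSup (f := fun i => ⨆ j, lambdaMax (M.secondMoment μ i j 0))
        (Set.finite_range _).bddAbove i)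
  rw [h3]
  exact ⟨(mul_le_mul_of_nonneg_right hmin hu).trans h1,
    h2.trans (mul_le_mul_of_nonneg_right hmax hu)⟩

/-- The response at time `t` is the own-lag coordinate of the regressor at `t + 1`, so its second
moment is `uᵀΣu` for a unit vector `u`. -/
lemma Assumptions.integral_Y_sq_le (ha : M.Assumptions μ T R τlo τhi σ K c κ cgap cpi)
    (hm : M.IsModel μ) (hc : 0 < c) (hK : 0 < K) (i : Fin N1) (j : Fin N2) (t : ℤ) :
    ∫ ω, M.Y i j t ω ^ 2 ∂μ ≤ τhi := by
  set u : RegIdx p1 p2 → ℝ := fun a => if a = .inr (.inr ()) then 1 else 0 with hu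
  have h1 : ∀ ω, M.regForm i j u (t + 1) ω = M.Y i j t ω := by
    intro ω
    simp [regForm, hu, reg]
  have h2 := (ha.integral_regForm_sq hm hc hK i j u (t + 1)).trans_le
    (ha.quad_bounds hm hc hK i j u).2
  simp_rw [h1] at h2
  have h3 : ∑ a, u a ^ 2 = 1 := by simp only [hu, ite_pow]; simp
  rw [h3, mul_one] at h2
  exact h2.trans ha.tauMax_le

end Moments

end Panel

end

section

/-! ### The filtration of the past and the martingale tail of the noise. -/

namespace Panel

variable {Ω : Type*} {N1 N2 p1 p2 G0 H0 G H : ℕ}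
variable [mΩ : MeasurableSpace Ω] {μ : Measure Ω} [IsProbabilityMeasure μ]
  {M : Panel Ω N1 N2 p1 p2 G0 H0} {T : ℕ} {R τlo τhi σ K c κ cgap cpi : ℝ}

/-- Responses before time `t` and covariates up to time `t`. -/
def past (M : Panel Ω N1 N2 p1 p2 G0 H0) (t : ℤ) (ω : Ω) :
    (Set.Iic (t - 1) → Fin N1 → Fin N2 → ℝ) × (Set.Iic t → Fin N1 → Fin p1 → ℝ)
      × (Set.Iic t → Fin N2 → Fin p2 → ℝ) :=
  ((fun (s : Set.Iic (t - 1)) k l => M.Y k l s ω),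
      (fun (s : Set.Iic t) k => M.X k s ω), (fun (s : Set.Iic t) l => M.Z l s ω))

/-- The `σ`-algebra generated by `past`. -/
@[reducible] def pastAlg (M : Panel Ω N1 N2 p1 p2 G0 H0) (t : ℤ) : MeasurableSpace Ω :=
  MeasurableSpace.comap (M.past t) inferInstance

lemma IsModel.pastAlg_le (hm : M.IsModel μ) (t : ℤ) : M.pastAlg t ≤ mΩ := by
  refine Measurable.comap_le (Measurable.prodMk ?_ (Measurable.prodMk ?_ ?_))
  · exact measurable_pi_lambda _ fun s => measurable_pi_lambda _ fun k =>
      measurable_pi_lambda _ fun l => hm.measurable_Y k l s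
  · exact measurable_pi_lambda _ fun s => measurable_pi_lambda _ fun k => hm.measurable_X k s
  · exact measurable_pi_lambda _ fun s => measurable_pi_lambda _ fun k => hm.measurable_Z k s

lemma measurable_Y_pastAlg (M : Panel Ω N1 N2 p1 p2 G0 H0) (i : Fin N1) (j : Fin N2) {s t : ℤ}
    (h : s ≤ t - 1) : Measurable[M.pastAlg t] (M.Y i j s) := by
  have h1 : Measurable (fun p : (Set.Iic (t - 1) → Fin N1 → Fin N2 → ℝ)
      × (Set.Iic t → Fin N1 → Fin p1 → ℝ) × (Set.Iic t → Fin N2 → Fin p2 → ℝ) =>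
      p.1 ⟨s, h⟩ i j) := by fun_prop
  exact h1.comp (comap_measurable (M.past t))

lemma measurable_X_pastAlg (M : Panel Ω N1 N2 p1 p2 G0 H0) (i : Fin N1) (a : Fin p1) {s t : ℤ}
    (h : s ≤ t) : Measurable[M.pastAlg t] (fun ω => M.X i s ω a) := by
  have h1 : Measurable (fun p : (Set.Iic (t - 1) → Fin N1 → Fin N2 → ℝ)
      × (Set.Iic t → Fin N1 → Fin p1 → ℝ) × (Set.Iic t → Fin N2 → Fin p2 → ℝ) =>
      p.2.1 ⟨s, h⟩ i a) := by fun_prop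
  exact h1.comp (comap_measurable (M.past t))

lemma measurable_Z_pastAlg (M : Panel Ω N1 N2 p1 p2 G0 H0) (j : Fin N2) (a : Fin p2) {s t : ℤ}
    (h : s ≤ t) : Measurable[M.pastAlg t] (fun ω => M.Z j s ω a) := by
  have h1 : Measurable (fun p : (Set.Iic (t - 1) → Fin N1 → Fin N2 → ℝ)
      × (Set.Iic t → Fin N1 → Fin p1 → ℝ) × (Set.Iic t → Fin N2 → Fin p2 → ℝ) =>
      p.2.2 ⟨s, h⟩ j a) := by fun_prop
  exact h1.comp (comap_measurable (M.past t))

lemma measurable_regForm_pastAlg (M : Panel Ω N1 N2 p1 p2 G0 H0) (i : Fin N1) (j : Fin N2)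
    (u : RegIdx p1 p2 → ℝ) {s t : ℤ} (h : s ≤ t) :
    Measurable[M.pastAlg t] (M.regForm i j u s) := by
  have : M.regForm i j u s = fun ω => ∑ b, M.lagForm i j u b * M.Y b.1 b.2 (s - 1) ω
      + (∑ a, M.X i s ω a * u (.inl (.inr a)) + ∑ a, M.Z j s ω a * u (.inr (.inl (.inr a)))) := by
    ext ω; exact M.regForm_eq i j u s ω
  rw [this]
  refine Measurable.add (Finset.measurable_sum _ fun b _ => ?_) (Measurable.add
    (Finset.measurable_sum _ fun a _ => ?_) (Finset.measurable_sum _ fun a _ => ?_))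
  · exact (M.measurable_Y_pastAlg b.1 b.2 (by omega)).const_mul _
  · exact (M.measurable_X_pastAlg i a h).mul_const _
  · exact (M.measurable_Z_pastAlg j a h).mul_const _

/-- Earlier noise is `Y - 𝒳ᵀΘ⁰`, a function of observed past quantities. Hence the products of noise
and regressors are adapted. -/
lemma IsModel.measurable_eps_pastAlg (hm : M.IsModel μ) (i : Fin N1) (j : Fin N2) {s t : ℤ}
    (h : s < t) : Measurable[M.pastAlg t] (M.eps i j s) := by
  have : M.eps i j s = fun ω => M.Y i j s ω - M.regForm i j (M.coef0 i j) s ω := by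
    ext ω; rw [hm.Y_eq]; ring
  rw [this]
  exact (M.measurable_Y_pastAlg i j (by omega)).sub (M.measurable_regForm_pastAlg i j _ h.le)

lemma Assumptions.indep_past (ha : M.Assumptions μ T R τlo τhi σ K c κ cgap cpi)
    (i : Fin N1) (j : Fin N2) (t : ℤ) :
    Indep (MeasurableSpace.comap (M.eps i j t) inferInstance) (M.pastAlg t) μ :=
  (IndepFun_iff_Indep _ _ _).1 (ha.eps_past i j t)

lemma Assumptions.indepFun_regForm (ha : M.Assumptions μ T R τlo τhi σ K c κ cgap cpi)
    (i : Fin N1) (j : Fin N2) (u : RegIdx p1 p2 → ℝ) (t : ℤ) :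
    IndepFun (M.eps i j t) (M.regForm i j u t) μ := by
  rw [IndepFun_iff_Indep]
  exact indep_of_indep_of_le_right (ha.indep_past i j t)
    (M.measurable_regForm_pastAlg i j u le_rfl).comap_le

/-- The variance proxy of the noise. -/
def proxy (σ : ℝ) : NNReal := Real.toNNReal (σ ^ 2)

/-- The true coefficients are bounded in Euclidean norm, whatever the dimension. -/
lemma Assumptions.coef0_sq_le (ha : M.Assumptions μ T R τlo τhi σ K c κ cgap cpi)
    (hm : M.IsModel μ) (hc : 0 < c) (hK : 0 < K) (hτlo : 0 < τlo) (i : Fin N1) (j : Fin N2) :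
    ∑ a, M.coef0 i j a ^ 2 ≤ τhi / τlo := by
  have h1 := (ha.quad_bounds hm hc hK i j (M.coef0 i j)).1
  have hr := ha.memLp_regForm hm hc hK i j (M.coef0 i j) 0
  have he : MemLp (M.eps i j 0) 2 μ := (ha.eps_subG i j 0).memLp 2
  have hre : Integrable (fun ω => M.regForm i j (M.coef0 i j) 0 ω * M.eps i j 0 ω) μ :=
    hr.integrable_mul he
  have hre0 : ∫ ω, M.regForm i j (M.coef0 i j) 0 ω * M.eps i j 0 ω ∂μ = 0 := by
    rw [(ha.indepFun_regForm i j (M.coef0 i j) 0).symm.integral_fun_mul_eq_mul_integral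
      hr.1 he.1, ha.eps_mean, mul_zero]
  -- Noise and regressors are uncorrelated, so the signal variance `Θ⁰ᵀΣΘ⁰` is at most `E Y² ≤ τhi`,
  -- while it is at least `τlo ‖Θ⁰‖²`.
  have h2 : ∫ ω, M.Y i j 0 ω ^ 2 ∂μ = M.quad μ i j (M.coef0 i j) + ∫ ω, M.eps i j 0 ω ^ 2 ∂μ := by
    have : (fun ω => M.Y i j 0 ω ^ 2) = fun ω => (M.regForm i j (M.coef0 i j) 0 ω ^ 2
        + 2 * (M.regForm i j (M.coef0 i j) 0 ω * M.eps i j 0 ω)) + M.eps i j 0 ω ^ 2 := by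
      ext ω; rw [hm.Y_eq]; ring
    have hs : Integrable (fun ω => M.regForm i j (M.coef0 i j) 0 ω ^ 2
        + 2 * (M.regForm i j (M.coef0 i j) 0 ω * M.eps i j 0 ω)) μ :=
      hr.integrable_sq.add (hre.const_mul 2)
    rw [this, integral_add hs he.integrable_sq,
      integral_add hr.integrable_sq (hre.const_mul 2), integral_const_mul, hre0]
    simp [quad]
  have h3 := ha.integral_Y_sq_le hm hc hK i j 0
  have h4 : 0 ≤ ∫ ω, M.eps i j 0 ω ^ 2 ∂μ := integral_nonneg fun ω => sq_nonneg _
  have h5 : τlo * ∑ a, M.coef0 i j a ^ 2 ≤ M.tauMin μ * ∑ a, M.coef0 i j a ^ 2 :=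
    mul_le_mul_of_nonneg_right ha.tauMin_ge (Finset.sum_nonneg fun _ _ => sq_nonneg _)
  rw [le_div_iff₀ hτlo]
  linarith

/-- Martingale tail: noise against a regressor direction. -/
lemma Assumptions.noise_tail (ha : M.Assumptions μ T R τlo τhi σ K c κ cgap cpi)
    (hm : M.IsModel μ) (hσ : 0 < σ) (i : Fin N1) (j : Fin N2)
    (u : RegIdx p1 p2 → ℝ) {x B : ℝ} (hx : 0 < x) (hB : 0 < B) :
    μ {ω | x ≤ |∑ k ∈ Finset.range T, M.eps i j ((k : ℤ) + 1) ω * M.regForm i j u ((k : ℤ) + 1) ω|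
        ∧ ∑ k ∈ Finset.range T, M.regForm i j u ((k : ℤ) + 1) ω ^ 2 ≤ B}
      ≤ ENNReal.ofReal (2 * Real.exp (-x ^ 2 / (2 * σ ^ 2 * B))) := by
  set X : ℕ → Ω → ℝ := fun k => M.eps i j ((k : ℤ) + 1) with hX
  set Z : ℕ → Ω → ℝ := fun k => M.regForm i j u ((k : ℤ) + 1) with hZ
  have hXm : ∀ k, Measurable (X k) := fun k => hm.measurable_eps _ _ _
  have hZm : ∀ k, Measurable (Z k) := fun k => hm.measurable_regForm _ _ _ _
  -- The maximiser of `l x - σ² l² B / 2`.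
  set l : ℝ := x / (σ ^ 2 * B) with hl
  have hl0 : 0 < l := by positivity
  -- The compensated exponential is a supermartingale: given the past, the compensator is exactly
  -- the sub-Gaussian bound of the next term.
  have hone : ∀ r : ℝ, r ^ 2 = l ^ 2 → expMom μ (fun ω => ∑ k ∈ Finset.range T,
      (r * (Z k ω * X k ω) - σ ^ 2 * l ^ 2 / 2 * Z k ω ^ 2)) ≤ 1 := by
    intro r hr
    have := expMom_sum_range_le (μ := μ) T X Z
      (fun _ e w => r * (w * e) - σ ^ 2 * l ^ 2 / 2 * w ^ 2)
      (fun _ => by simp only [Function.uncurry_def]; fun_prop)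
      (fun k => M.pastAlg ((k : ℤ) + 1))
      (fun k _ => hm.pastAlg_le _) (fun k _ => hXm k)
      (fun k _ l hl => hm.measurable_eps_pastAlg i j (by omega))
      (fun k _ l hl => M.measurable_regForm_pastAlg i j u (by omega))
      (fun k _ => ha.indep_past i j _) (B := 0) ?_
    · simpa using this
    · intro k _ w
      have hs := ha.eps_subG i j ((k : ℤ) + 1)
      have h3 := expMom_le_of_integral (hs.integrable_exp_mul (r * w)) (hs.mgf_le (r * w))
      have h4 : (fun ω => r * (w * X k ω) - σ ^ 2 * l ^ 2 / 2 * w ^ 2)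
          = fun ω => -(σ ^ 2 * l ^ 2 / 2 * w ^ 2) + r * w * X k ω := by ext ω; ring
      rw [h4, expMom_const_add]
      refine (mul_le_mul_right h3 _).trans ?_
      rw [← ENNReal.ofReal_mul (Real.exp_pos _).le, ← Real.exp_add]
      refine ENNReal.ofReal_le_ofReal (Real.exp_le_exp.2 ?_)
      rw [Real.coe_toNNReal _ (sq_nonneg σ), mul_pow, hr]
      exact le_of_eq (by ring)
  have htail : ∀ r : ℝ, r ^ 2 = l ^ 2 →
      μ {ω | x ^ 2 / (2 * σ ^ 2 * B) ≤ ∑ k ∈ Finset.range T,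
        (r * (Z k ω * X k ω) - σ ^ 2 * l ^ 2 / 2 * Z k ω ^ 2)}
      ≤ ENNReal.ofReal (Real.exp (-x ^ 2 / (2 * σ ^ 2 * B))) := by
    intro r hr
    refine (measure_le_expMom (Finset.measurable_sum _ fun k _ =>
      ((((hZm k).mul (hXm k)).const_mul r).sub (((hZm k).pow_const 2).const_mul _))) _).trans ?_
    rw [neg_div]
    exact mul_le_of_le_one_right' (hone r hr)
  have hsub : {ω | x ≤ |∑ k ∈ Finset.range T, X k ω * Z k ω|
        ∧ ∑ k ∈ Finset.range T, Z k ω ^ 2 ≤ B}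
      ⊆ {ω | x ^ 2 / (2 * σ ^ 2 * B) ≤ ∑ k ∈ Finset.range T,
          (l * (Z k ω * X k ω) - σ ^ 2 * l ^ 2 / 2 * Z k ω ^ 2)}
        ∪ {ω | x ^ 2 / (2 * σ ^ 2 * B) ≤ ∑ k ∈ Finset.range T,
          (-l * (Z k ω * X k ω) - σ ^ 2 * l ^ 2 / 2 * Z k ω ^ 2)} := by
    rintro ω ⟨h1, h2⟩
    have hsum : ∀ r : ℝ, ∑ k ∈ Finset.range T, (r * (Z k ω * X k ω) - σ ^ 2 * l ^ 2 / 2 * Z k ω ^ 2)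
        = r * ∑ k ∈ Finset.range T, X k ω * Z k ω
          - σ ^ 2 * l ^ 2 / 2 * ∑ k ∈ Finset.range T, Z k ω ^ 2 := by
      intro r
      rw [Finset.sum_sub_distrib, Finset.mul_sum, Finset.mul_sum]
      congr 1
      exact Finset.sum_congr rfl fun k _ => by ring
    have h3 : σ ^ 2 * l ^ 2 / 2 * ∑ k ∈ Finset.range T, Z k ω ^ 2 ≤ σ ^ 2 * l ^ 2 / 2 * B := by
      gcongr
    have h4 : x ^ 2 / (2 * σ ^ 2 * B) = l * x - σ ^ 2 * l ^ 2 / 2 * B := by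
      rw [hl]; field_simp; ring
    rcases le_abs.1 h1 with h | h
    · left
      rw [Set.mem_ofPred_eq, hsum, h4]
      have := mul_le_mul_of_nonneg_left h hl0.le
      linarith
    · right
      rw [Set.mem_ofPred_eq, hsum, h4]
      have := mul_le_mul_of_nonneg_left h hl0.le
      linarith
  refine (measure_mono hsub).trans ((measure_union_le _ _).trans ?_)
  refine (add_le_add (htail l rfl) (htail (-l) (by ring))).trans (le_of_eq ?_)
  rw [← ENNReal.ofReal_add (Real.exp_pos _).le (Real.exp_pos _).le, ← two_mul]

/-- The vectorised noise in natural time. -/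
def noise (M : Panel Ω N1 N2 p1 p2 G0 H0) (a : Fin N1 × Fin N2) (s : ℕ) : Ω → ℝ :=
  M.eps a.1 a.2 s

lemma Assumptions.isNoise (ha : M.Assumptions μ T R τlo τhi σ K c κ cgap cpi)
    (hm : M.IsModel μ) : IsNoise μ M.noise (proxy σ) where
  meas a s := hm.measurable_eps _ _ _
  indep := ha.eps_indep.precomp (g := fun q : (Fin N1 × Fin N2) × ℕ => (q.1.1, q.1.2, (q.2 : ℤ)))
    (fun q r h => by
      simp only [Prod.mk.injEq, Nat.cast_inj] at h
      ext <;> simp [h])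
  subG a s := ha.eps_subG _ _ _
  mean a s := ha.eps_mean _ _ _

end Panel

end

section

/-! ### Splitting the regressor into start, covariate and noise parts. -/

section Young

lemma geom_sum_le_inv {κ : ℝ} (hκ : 0 ≤ κ) (hκ1 : κ < 1) (n : ℕ) :
    ∑ i ∈ Finset.range n, κ ^ i ≤ (1 - κ)⁻¹ := by
  have hg := geom_sum_mul_neg κ n
  have h1 : 0 < 1 - κ := by linarith
  rw [← one_div, le_div_iff₀ h1, hg]
  linarith [pow_nonneg hκ n]

/-- Young's inequality for the convolution with a geometric sequence. -/
lemma sum_sq_geom_conv_le {κ : ℝ} (hκ : 0 ≤ κ) (hκ1 : κ < 1) (w : ℕ → ℝ) (T : ℕ) :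
    ∑ k ∈ Finset.range T, (∑ τ ∈ Finset.range k, κ ^ τ * w (k - τ)) ^ 2
      ≤ ((1 - κ)⁻¹) ^ 2 * ∑ s ∈ Finset.range (T + 1), w s ^ 2 := by
  have h1 : 0 < 1 - κ := by linarith
  have hcs : ∀ k, (∑ τ ∈ Finset.range k, κ ^ τ * w (k - τ)) ^ 2
      ≤ (1 - κ)⁻¹ * ∑ τ ∈ Finset.range k, κ ^ τ * w (k - τ) ^ 2 := by
    intro k
    refine (Finset.sum_sq_le_sum_mul_sum_of_sq_le_mul (Finset.range k) (f := fun τ => κ ^ τ)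
      (g := fun τ => κ ^ τ * w (k - τ) ^ 2) (fun i _ => by positivity)
      (fun i _ => by positivity) (fun i _ => le_of_eq (by ring))).trans ?_
    have : 0 ≤ ∑ τ ∈ Finset.range k, κ ^ τ * w (k - τ) ^ 2 :=
      Finset.sum_nonneg fun i _ => by positivity
    gcongr
    exact geom_sum_le_inv hκ hκ1 k
  have hswap : ∑ k ∈ Finset.range T, ∑ τ ∈ Finset.range k, κ ^ τ * w (k - τ) ^ 2
      ≤ ∑ τ ∈ Finset.range T, κ ^ τ * ∑ s ∈ Finset.range (T + 1), w s ^ 2 := by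
    rw [Finset.sum_comm' (t' := Finset.range T) (s' := fun τ => Finset.Ico (τ + 1) T)
      (by intro x y; simp only [Finset.mem_range, Finset.mem_Ico]; omega)]
    refine Finset.sum_le_sum fun τ _ => ?_
    rw [← Finset.mul_sum]
    refine mul_le_mul_of_nonneg_left ?_ (by positivity)
    rw [Finset.sum_Ico_eq_sum_range, Finset.sum_range_succ']
    have : ∀ j, w (τ + 1 + j - τ) = w (j + 1) := fun j => by congr 1; omega
    simp only [this]
    refine le_add_of_le_of_nonneg ?_ (sq_nonneg _)
    exact Finset.sum_le_sum_of_subset_of_nonneg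
      (Finset.range_subset_range.2 (by omega)) fun _ _ _ => sq_nonneg _
  calc _ ≤ ∑ k ∈ Finset.range T, (1 - κ)⁻¹ * ∑ τ ∈ Finset.range k, κ ^ τ * w (k - τ) ^ 2 :=
        Finset.sum_le_sum fun k _ => hcs k
    _ = (1 - κ)⁻¹ * ∑ k ∈ Finset.range T, ∑ τ ∈ Finset.range k, κ ^ τ * w (k - τ) ^ 2 := by
        rw [Finset.mul_sum]
    _ ≤ (1 - κ)⁻¹ * ((1 - κ)⁻¹ * ∑ s ∈ Finset.range (T + 1), w s ^ 2) := by
        refine mul_le_mul_of_nonneg_left (hswap.trans ?_) (by positivity)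
        rw [← Finset.sum_mul]
        refine mul_le_mul_of_nonneg_right (geom_sum_le_inv hκ hκ1 T) ?_
        exact Finset.sum_nonneg fun _ _ => sq_nonneg _
    _ = _ := by ring

end Young

namespace Panel

variable {Ω : Type*} {N1 N2 p1 p2 G0 H0 G H : ℕ}

/-- Lag coefficients of `𝒳_ijtᵀ u` on the innovations. -/
def lagCoef (M : Panel Ω N1 N2 p1 p2 G0 H0) (i : Fin N1) (j : Fin N2) (u : RegIdx p1 p2 → ℝ) :
    ℕ → Fin N1 × Fin N2 → ℝ := pullback M.transition (M.lagForm i j u)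

/-- Contribution of the responses at time `0` to `𝒳_ij(k+1)ᵀ u`. -/
def startPart (M : Panel Ω N1 N2 p1 p2 G0 H0) (i : Fin N1) (j : Fin N2)
    (u : RegIdx p1 p2 → ℝ) (k : ℕ) (ω : Ω) : ℝ :=
  ∑ b, M.lagCoef i j u k b * M.Y b.1 b.2 0 ω

/-- Contribution of the covariates at positive times to `𝒳_ij(k+1)ᵀ u`. -/
def covPart (M : Panel Ω N1 N2 p1 p2 G0 H0) (i : Fin N1) (j : Fin N2)
    (u : RegIdx p1 p2 → ℝ) (k : ℕ) (ω : Ω) : ℝ :=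
  ∑ τ ∈ Finset.range k, ∑ b, M.lagCoef i j u τ b
      * M.covForm b.1 b.2 (M.coef0 b.1 b.2) ((k - τ : ℕ) : ℤ) ω
    + M.covForm i j u ((k : ℤ) + 1) ω

/-- Contribution of the noise at positive times to `𝒳_ij(k+1)ᵀ u`. -/
def noisePart (M : Panel Ω N1 N2 p1 p2 G0 H0) (i : Fin N1) (j : Fin N2)
    (u : RegIdx p1 p2 → ℝ) (k : ℕ) (ω : Ω) : ℝ := noiseFilter M.noise (M.lagCoef i j u) k ω

/-- The covariate part as a linear function of two projections of every covariate vector. -/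
def covMap (M : Panel Ω N1 N2 p1 p2 G0 H0) (T : ℕ) (D : ℝ) (i : Fin N1) (j : Fin N2)
    (u : RegIdx p1 p2 → ℝ) :
    (Fin (T + 1) × Fin 2 × (Fin N1 ⊕ Fin N2) → ℝ) →ₗ[ℝ] (Fin T → ℝ) where
  -- Slot `0` holds the projections on the true coefficients, which enter through past innovations.
  -- Slot `1` holds those on `u`, which enter at time `k + 1` itself. The factor `D` undoes the
  -- scaling that makes the directions admissible.
  toFun v k := D * (∑ τ ∈ Finset.range k, ∑ b, M.lagCoef i j u τ b
      * (v (⟨k - τ, by omega⟩, 0, .inl b.1) + v (⟨k - τ, by omega⟩, 0, .inr b.2))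
    + (v (⟨k + 1, by omega⟩, 1, .inl i) + v (⟨k + 1, by omega⟩, 1, .inr j)))
  map_add' v w := by
    ext k
    simp only [Pi.add_apply]
    rw [← mul_add]
    congr 1
    conv_rhs => rw [add_add_add_comm]
    rw [← Finset.sum_add_distrib]
    congr 1
    · refine Finset.sum_congr rfl fun τ _ => ?_
      rw [← Finset.sum_add_distrib]
      exact Finset.sum_congr rfl fun b _ => by ring
    · ring
  map_smul' r v := by
    ext k
    simp only [Pi.smul_apply, smul_eq_mul, RingHom.id_apply]
    rw [mul_left_comm]
    congr 1
    rw [mul_add, Finset.mul_sum]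
    congr 1
    · refine Finset.sum_congr rfl fun τ _ => ?_
      rw [Finset.mul_sum]
      exact Finset.sum_congr rfl fun b _ => by ring
    · ring

/-- Let `w s` be the norm of the block of `v` at time `s`. Each output is at most `D (6 g k + 2 w (k
+ 1))` with `g` the geometric convolution of `w`, and Young's inequality bounds the energy of `g`.
From `72 + 8 ≤ 100` comes the `10`, and neither `T` nor the panel size enters. -/
lemma l2_covMap_le (M : Panel Ω N1 N2 p1 p2 G0 H0) (T : ℕ) {D : ℝ} (hD : 0 ≤ D) (i : Fin N1)
    (j : Fin N2) (u : RegIdx p1 p2 → ℝ) {κ : ℝ} (hκ : 0 ≤ κ) (hκ1 : κ < 1)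
    (hl : ∀ τ, ∑ b, |M.lagCoef i j u τ b| ≤ 3 * κ ^ τ)
    (v : Fin (T + 1) × Fin 2 × (Fin N1 ⊕ Fin N2) → ℝ) :
    l2 (M.covMap T D i j u v) ≤ 10 * D / (1 - κ) * l2 v := by
  have h1 : 0 < 1 - κ := by linarith
  set w : ℕ → ℝ := fun s => √(∑ q, if (q.1 : ℕ) = s then v q ^ 2 else 0) with hw
  have hw2 : ∀ s, w s ^ 2 = ∑ q, if (q.1 : ℕ) = s then v q ^ 2 else 0 := fun s =>
    Real.sq_sqrt (Finset.sum_nonneg fun q _ => by split_ifs <;> positivity)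
  have hw0 : ∀ s, 0 ≤ w s := fun s => Real.sqrt_nonneg _
  have hvw : ∀ q, |v q| ≤ w q.1 := by
    intro q
    refine Real.abs_le_sqrt ?_
    have := Finset.single_le_sum (f := fun q' => if (q'.1 : ℕ) = q.1 then v q' ^ 2 else 0)
      (fun q' _ => by split_ifs <;> positivity) (Finset.mem_univ q)
    simpa using this
  have hW : ∑ s ∈ Finset.range (T + 1), w s ^ 2 = ∑ q, v q ^ 2 := by
    simp_rw [hw2]
    rw [Finset.sum_comm]
    refine Finset.sum_congr rfl fun q _ => ?_
    rw [Finset.sum_ite_eq]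
    simp [q.1.2]
  set g : ℕ → ℝ := fun k => ∑ τ ∈ Finset.range k, κ ^ τ * w (k - τ) with hg
  have hg0 : ∀ k, 0 ≤ g k := fun k =>
    Finset.sum_nonneg fun τ _ => mul_nonneg (by positivity) (hw0 _)
  have hA : ∀ k : Fin T, |M.covMap T D i j u v k| ≤ D * (6 * g k + 2 * w (k + 1)) := by
    intro k
    simp only [covMap, LinearMap.coe_mk, AddHom.coe_mk]
    rw [abs_mul, abs_of_nonneg hD]
    refine mul_le_mul_of_nonneg_left ((abs_add_le _ _).trans (add_le_add ?_ ?_)) hD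
    · rw [hg, Finset.mul_sum]
      refine (Finset.abs_sum_le_sum_abs _ _).trans (Finset.sum_le_sum fun τ hτ => ?_)
      refine (Finset.abs_sum_le_sum_abs _ _).trans ?_
      calc _ ≤ ∑ b, |M.lagCoef i j u τ b| * (2 * w (k - τ)) := by
            refine Finset.sum_le_sum fun b _ => ?_
            rw [abs_mul]
            refine mul_le_mul_of_nonneg_left ((abs_add_le _ _).trans ?_) (abs_nonneg _)
            rw [two_mul]
            exact add_le_add (hvw _) (hvw _)
        _ = (∑ b, |M.lagCoef i j u τ b|) * (2 * w (k - τ)) := by rw [Finset.sum_mul]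
        _ ≤ (3 * κ ^ τ) * (2 * w (k - τ)) :=
            mul_le_mul_of_nonneg_right (hl τ) (by have := hw0 (k - τ); positivity)
        _ = _ := by ring
    · rw [two_mul]
      exact (abs_add_le _ _).trans (add_le_add (hvw _) (hvw _))
  have hB : 0 ≤ 10 * D / (1 - κ) := by positivity
  rw [l2, l2, ← Real.sqrt_sq hB, ← Real.sqrt_mul (sq_nonneg _)]
  refine Real.sqrt_le_sqrt ?_
  have hsq : ∀ k : Fin T, M.covMap T D i j u v k ^ 2
      ≤ D ^ 2 * (72 * g k ^ 2 + 8 * w (k + 1) ^ 2) := by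
    intro k
    rw [← sq_abs]
    have h2 := hA k
    calc _ ≤ (D * (6 * g k + 2 * w (k + 1))) ^ 2 := by gcongr
      _ = D ^ 2 * (6 * g k + 2 * w (k + 1)) ^ 2 := by ring
      _ ≤ _ := by
        refine mul_le_mul_of_nonneg_left ?_ (sq_nonneg _)
        nlinarith [sq_nonneg (6 * g k - 2 * w (k + 1))]
  have hy := sum_sq_geom_conv_le hκ hκ1 w T
  rw [hW] at hy
  have hw1 : ∑ k ∈ Finset.range T, w (k + 1) ^ 2 ≤ ∑ q, v q ^ 2 := by
    rw [← hW, Finset.sum_range_succ']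
    linarith [sq_nonneg (w 0)]
  have hv0 : 0 ≤ ∑ q, v q ^ 2 := Finset.sum_nonneg fun _ _ => sq_nonneg _
  calc ∑ k : Fin T, M.covMap T D i j u v k ^ 2
      ≤ ∑ k : Fin T, D ^ 2 * (72 * g k ^ 2 + 8 * w (k + 1) ^ 2) :=
        Finset.sum_le_sum fun k _ => hsq k
    _ = D ^ 2 * (72 * ∑ k ∈ Finset.range T, g k ^ 2 + 8 * ∑ k ∈ Finset.range T, w (k + 1) ^ 2) := by
        rw [Fin.sum_univ_eq_sum_range (fun k => D ^ 2 * (72 * g k ^ 2 + 8 * w (k + 1) ^ 2)),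
          ← Finset.mul_sum, Finset.sum_add_distrib, Finset.mul_sum, Finset.mul_sum]
    _ ≤ D ^ 2 * (72 * (((1 - κ)⁻¹) ^ 2 * ∑ q, v q ^ 2) + 8 * ∑ q, v q ^ 2) := by gcongr
    _ ≤ (10 * D / (1 - κ)) ^ 2 * ∑ q, v q ^ 2 := by
        have h5 : 1 ≤ ((1 - κ)⁻¹) ^ 2 := by
          have : 1 ≤ (1 - κ)⁻¹ := (one_le_inv₀ h1).2 (by linarith)
          nlinarith
        have h6 : (10 * D / (1 - κ)) ^ 2 = D ^ 2 * (100 * ((1 - κ)⁻¹) ^ 2) := by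
          rw [div_eq_mul_inv]; ring
        rw [h6, mul_assoc]
        refine mul_le_mul_of_nonneg_left ?_ (sq_nonneg _)
        nlinarith

variable [mΩ : MeasurableSpace Ω] {μ : Measure Ω} [IsProbabilityMeasure μ]
  {M : Panel Ω N1 N2 p1 p2 G0 H0} {T : ℕ} {R τlo τhi σ K c κ cgap cpi : ℝ}

/-- The regressor at time `k + 1` involves responses at time `k`; these are unrolled `k` steps, down
to time `0`. -/
lemma IsModel.regForm_decomp (hm : M.IsModel μ) (i : Fin N1) (j : Fin N2)
    (u : RegIdx p1 p2 → ℝ) (k : ℕ) (ω : Ω) :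
    M.regForm i j u ((k : ℤ) + 1) ω
      = M.startPart i j u k ω + (M.covPart i j u k ω + M.noisePart i j u k ω) := by
  have h := sum_mul_unroll (B := M.transition) (y := fun t a => M.Y a.1 a.2 t ω)
    (w := fun t a => M.innov t ω a) (fun t a => hm.vec_eq ω t a) (M.lagForm i j u) 0 k
  have h2 : ∑ τ ∈ Finset.range k, ∑ a, pullback M.transition (M.lagForm i j u) τ a
        * M.innov (0 + (k : ℤ) - τ) ω a
      = ∑ τ ∈ Finset.range k, ∑ b, M.lagCoef i j u τ b
          * M.covForm b.1 b.2 (M.coef0 b.1 b.2) ((k - τ : ℕ) : ℤ) ω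
        + M.noisePart i j u k ω := by
    unfold noisePart noiseFilter noiseForm
    rw [← Finset.sum_add_distrib]
    refine Finset.sum_congr rfl fun τ hτ => ?_
    rw [← Finset.sum_add_distrib]
    refine Finset.sum_congr rfl fun a _ => ?_
    have : 0 + (k : ℤ) - τ = ((k - τ : ℕ) : ℤ) := by
      have := Finset.mem_range.1 hτ
      omega
    rw [this, ← mul_add]
    rfl
  rw [regForm_eq, add_sub_cancel_right]
  rw [zero_add] at h
  simp only [zero_add] at h2 h
  rw [h, h2]
  unfold startPart covPart lagCoef
  ring

lemma Assumptions.sum_abs_lagCoef_le (ha : M.Assumptions μ T R τlo τhi σ K c κ cgap cpi)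
    (hm : M.IsModel μ) {κ' : ℝ} (hκ : κ ≤ κ') (hκ0 : 0 ≤ κ') (i : Fin N1) (j : Fin N2)
    {u : RegIdx p1 p2 → ℝ} (hu : ∑ a, u a ^ 2 ≤ 1) (τ : ℕ) :
    ∑ b, |M.lagCoef i j u τ b| ≤ 3 * κ' ^ τ := by
  refine (sum_abs_pullback_le hκ0
    (fun a => (hm.transition_sum_le ha.stable a).trans hκ) _ τ).trans ?_
  refine mul_le_mul_of_nonneg_right ((M.sum_abs_lagForm_le hm.adj1 hm.adj2 i j u).trans ?_)
    (by positivity)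
  have h1 : ∀ a, |u a| ≤ 1 := by
    intro a
    rw [← sq_le_one_iff_abs_le_one]
    exact (Finset.single_le_sum (f := fun a => u a ^ 2) (fun a _ => sq_nonneg _)
      (Finset.mem_univ a)).trans hu
  linarith [h1 (.inl (.inl ())), h1 (.inr (.inl (.inl ()))), h1 (.inr (.inr ()))]

lemma sum_regIdx_sq (u : RegIdx p1 p2 → ℝ) :
    ∑ a, u (.inl (.inr a)) ^ 2 ≤ ∑ a, u a ^ 2 ∧
      ∑ a, u (.inr (.inl (.inr a))) ^ 2 ≤ ∑ a, u a ^ 2 := by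
  simp only [Fintype.sum_sum_type, Finset.univ_unique, Finset.sum_singleton]
  have h1 : 0 ≤ ∑ a, u (.inl (.inr a)) ^ 2 := Finset.sum_nonneg fun _ _ => sq_nonneg _
  have h2 : 0 ≤ ∑ a, u (.inr (.inl (.inr a))) ^ 2 := Finset.sum_nonneg fun _ _ => sq_nonneg _
  have h3 := sq_nonneg (u (.inl (.inl default)))
  have h4 := sq_nonneg (u (.inr (.inl (.inl default))))
  have h5 := sq_nonneg (u (.inr (.inr default)))
  constructor <;> linarith

/-- The projection directions that produce the covariate part. -/
def dirX (M : Panel Ω N1 N2 p1 p2 G0 H0) (r : ℝ) (u : RegIdx p1 p2 → ℝ) (b : Fin 2)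
    (i : Fin N1) (a : Fin p1) : ℝ :=
  if b = 0 then r * M.par.zeta (M.g0 i) a else r * u (.inl (.inr a))

/-- The projection directions that produce the covariate part. -/
def dirZ (M : Panel Ω N1 N2 p1 p2 G0 H0) (r : ℝ) (u : RegIdx p1 p2 → ℝ) (b : Fin 2)
    (j : Fin N2) (a : Fin p2) : ℝ :=
  if b = 0 then r * M.par.del (M.h0 j) a else r * u (.inr (.inl (.inr a)))

lemma covPart_eq (M : Panel Ω N1 N2 p1 p2 G0 H0) (T : ℕ) {D : ℝ} (hD : D ≠ 0) (i : Fin N1)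
    (j : Fin N2) (u : RegIdx p1 p2 → ℝ) (k : Fin T) (ω : Ω) :
    M.covPart i j u k ω
      = M.covMap T D i j u (M.projected T 0 (M.dirX D⁻¹ u) (M.dirZ D⁻¹ u) ω) k := by
  have hmulX : ∀ (i : Fin N1) (t : ℤ) (w : Fin p1 → ℝ),
      D * ∑ a, M.X i t ω a * (D⁻¹ * w a) = ∑ a, M.X i t ω a * w a := by
    intro i t w
    rw [Finset.mul_sum]
    exact Finset.sum_congr rfl fun a _ => by field_simp
  have hmulZ : ∀ (j : Fin N2) (t : ℤ) (w : Fin p2 → ℝ),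
      D * ∑ a, M.Z j t ω a * (D⁻¹ * w a) = ∑ a, M.Z j t ω a * w a := by
    intro i t w
    rw [Finset.mul_sum]
    exact Finset.sum_congr rfl fun a _ => by field_simp
  simp only [covMap, LinearMap.coe_mk, AddHom.coe_mk, projected, dirX, dirZ, zero_add, if_true,
    one_ne_zero, if_false]
  rw [mul_add, Finset.mul_sum]
  unfold covPart covForm
  congr 1
  · refine Finset.sum_congr rfl fun τ _ => ?_
    rw [Finset.mul_sum]
    refine Finset.sum_congr rfl fun b _ => ?_
    rw [mul_left_comm]
    congr 1
    rw [mul_add, hmulX, hmulZ]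
    rfl
  · rw [mul_add, hmulX, hmulZ]
    push_cast
    rfl

end Panel

end

section

/-! ### Exponential tails of the responses at time zero and of the start part. -/

lemma expMom_sq_mono {Ω : Type*} [MeasurableSpace Ω] {μ : Measure Ω} {W : Ω → ℝ} {k k' : ℝ}
    (hk : 0 < k) (hkk : k ≤ k') (h : expMom μ (fun ω => W ω ^ 2 / (2 * k ^ 2)) ≤ 3) :
    expMom μ (fun ω => W ω ^ 2 / (2 * k' ^ 2)) ≤ 3 :=
  (expMom_mono fun ω => by gcongr).trans h

namespace Panel

variable {Ω : Type*} {N1 N2 p1 p2 G0 H0 G H : ℕ}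
variable [mΩ : MeasurableSpace Ω] {μ : Measure Ω} [IsProbabilityMeasure μ]
  {M : Panel Ω N1 N2 p1 p2 G0 H0} {T : ℕ} {R τlo τhi σ K c κ cgap cpi : ℝ}

lemma IsModel.measurable_innov (hm : M.IsModel μ) (t : ℤ) (a : Fin N1 × Fin N2) :
    Measurable (fun ω => M.innov t ω a) :=
  (hm.measurable_covForm _ _ _ _).add (hm.measurable_eps _ _ _)

/-- The innovation has three terms, two from covariates and one from noise. Jensen with weights
`1/3` handles their sum without independence. -/
lemma Assumptions.expMom_innov (ha : M.Assumptions μ T R τlo τhi σ K c κ cgap cpi)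
    (hm : M.IsModel μ) (hc : 0 < c) (hK : 0 < K) {S k : ℝ} (hS : 0 < S)
    (hcoef : ∀ i j, ∑ a, M.coef0 i j a ^ 2 ≤ S ^ 2) (hk1 : K * S / c ≤ k)
    (hk2 : 2 * σ ^ 2 ≤ k ^ 2) (t : ℤ) (a : Fin N1 × Fin N2) :
    expMom μ (fun ω => |M.innov t ω a|) ≤ ENNReal.ofReal (3 * Real.exp (9 * k ^ 2 / 2)) := by
  have hk : 0 < k := lt_of_lt_of_le (by positivity) hk1
  set u := M.coef0 a.1 a.2 with hu
  have hu2 := sum_regIdx_sq u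
  set W : Fin 3 → Ω → ℝ := ![fun ω => ∑ b, M.X a.1 t ω b * u (.inl (.inr b)),
    fun ω => ∑ b, M.Z a.2 t ω b * u (.inr (.inl (.inr b))), M.eps a.1 a.2 t] with hW
  have hWm : ∀ b, Measurable (W b) := by
    intro b
    fin_cases b
    · change Measurable (fun ω => ∑ b, M.X a.1 t ω b * u (.inl (.inr b)))
      exact Finset.measurable_sum _ fun b _ => (hm.measurable_X_apply _ _ b).mul_const _
    · change Measurable (fun ω => ∑ b, M.Z a.2 t ω b * u (.inr (.inl (.inr b))))
      exact Finset.measurable_sum _ fun b _ => (hm.measurable_Z_apply _ _ b).mul_const _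
    · exact hm.measurable_eps _ _ _
  have hW3 : ∀ b, expMom μ (fun ω => W b ω ^ 2 / (2 * k ^ 2)) ≤ 3 := by
    intro b
    fin_cases b
    · exact expMom_sq_mono (by positivity) hk1
        (ha.sq_X hm hc hK a.1 t hS (hu2.1.trans (hcoef _ _)))
    · exact expMom_sq_mono (by positivity) hk1
        (ha.sq_Z hm hc hK a.2 t hS (hu2.2.trans (hcoef _ _)))
    · refine hasSubgaussianMGF_expMom_sq (hm.measurable_eps _ _ _) (ha.eps_subG _ _ _) hk ?_
      rwa [Real.coe_toNNReal _ (sq_nonneg σ)]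
  have hle : ∀ ω, |M.innov t ω a| ≤ ∑ b : Fin 3, (1 / 3 : ℝ) * (3 * |W b ω|) := by
    intro ω
    rw [Fin.sum_univ_three]
    have : M.innov t ω a = W 0 ω + W 1 ω + W 2 ω := rfl
    rw [this]
    refine (abs_add_three _ _ _).trans (le_of_eq (by ring))
  refine (expMom_mono hle).trans ?_
  refine expMom_sum_le Finset.univ (fun _ => (1 / 3 : ℝ)) (fun b ω => 3 * |W b ω|)
    (fun _ _ => by norm_num) (by norm_num) (fun b _ => (hWm b).abs.const_mul 3) ?_ fun b _ => ?_
  · rw [← ENNReal.ofReal_one]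
    refine ENNReal.ofReal_le_ofReal ?_
    have : 1 ≤ Real.exp (9 * k ^ 2 / 2) := Real.one_le_exp (by positivity)
    linarith
  · refine (expMom_abs_le hk (hW3 b) 3).trans (le_of_eq ?_)
    norm_num

lemma Assumptions.expMom_sum_innov (ha : M.Assumptions μ T R τlo τhi σ K c κ cgap cpi)
    (hm : M.IsModel μ) (hc : 0 < c) (hK : 0 < K) {S k : ℝ} (hS : 0 < S)
    (hcoef : ∀ i j, ∑ a, M.coef0 i j a ^ 2 ≤ S ^ 2) (hk1 : K * S / c ≤ k)
    (hk2 : 2 * σ ^ 2 ≤ k ^ 2) {α : Type*} (s : Finset α) (w : α → ℝ) (t : α → ℤ)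
    (a : α → Fin N1 × Fin N2) (hw : ∀ p ∈ s, 0 ≤ w p) (hw1 : ∑ p ∈ s, w p ≤ 1) :
    expMom μ (fun ω => ∑ p ∈ s, w p * |M.innov (t p) ω (a p)|)
      ≤ ENNReal.ofReal (3 * Real.exp (9 * k ^ 2 / 2)) := by
  refine expMom_sum_le s w (fun p ω => |M.innov (t p) ω (a p)|) hw hw1
    (fun p _ => (hm.measurable_innov _ _).abs) ?_
    fun p _ => ha.expMom_innov hm hc hK hS hcoef hk1 hk2 _ _
  rw [← ENNReal.ofReal_one]
  refine ENNReal.ofReal_le_ofReal ?_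
  have : 1 ≤ Real.exp (9 * k ^ 2 / 2) := Real.one_le_exp (by positivity)
  linarith

/-- Moving average representation of the responses at time `0`, in absolute values. -/
lemma Assumptions.exists_abs_Y_le (ha : M.Assumptions μ T R τlo τhi σ K c κ cgap cpi)
    (hm : M.IsModel μ) {κ' : ℝ} (hκ : κ ≤ κ') (hκ0 : 0 ≤ κ') :
    ∃ P : Fin N1 × Fin N2 → ℕ → Fin N1 × Fin N2 → ℝ, (∀ b n a, 0 ≤ P b n a) ∧
      (∀ b n, ∑ a, P b n a ≤ κ' ^ n) ∧
      ∀ n ω b, |M.Y b.1 b.2 0 ω| ≤ ∑ a, P b n a * |M.Y a.1 a.2 (-(n : ℤ)) ω|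
        + ∑ τ ∈ Finset.range n, ∑ a, P b τ a * |M.innov (-(τ : ℤ)) ω a| := by
  refine ⟨fun b n a => |pullback M.transition (Pi.single b 1) n a|, fun _ _ _ => abs_nonneg _,
    fun b n => ?_, fun n ω b => ?_⟩
  · have := sum_abs_pullback_le hκ0 (fun a => (hm.transition_sum_le ha.stable a).trans hκ)
      (Pi.single b 1 : Fin N1 × Fin N2 → ℝ) n
    refine this.trans (le_of_eq ?_)
    have h1 : ∑ a, |(Pi.single b 1 : Fin N1 × Fin N2 → ℝ) a| = 1 := by
      rw [Finset.sum_eq_single b] <;> simp +contextual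
    rw [h1, one_mul]
  · have h := sum_mul_unroll (B := M.transition) (y := fun t a => M.Y a.1 a.2 t ω)
      (w := fun t a => M.innov t ω a) (fun t a => hm.vec_eq ω t a)
      (Pi.single b 1 : Fin N1 × Fin N2 → ℝ) (-(n : ℤ)) n
    simp only [neg_add_cancel, Pi.single_apply, ite_mul, one_mul, zero_mul,
      Finset.sum_ite_eq', Finset.mem_univ, if_true, zero_sub] at h
    rw [h]
    refine (abs_add_le _ _).trans (add_le_add ?_ ?_)
    · refine (Finset.abs_sum_le_sum_abs _ _).trans (le_of_eq ?_)
      simp_rw [abs_mul]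
    · refine (Finset.abs_sum_le_sum_abs _ _).trans (Finset.sum_le_sum fun τ _ => ?_)
      refine (Finset.abs_sum_le_sum_abs _ _).trans (le_of_eq ?_)
      simp_rw [abs_mul]

/-- Exponential tail of weighted sums of absolute responses. -/
lemma Assumptions.weighted_Y_tail (ha : M.Assumptions μ T R τlo τhi σ K c κ cgap cpi)
    (hm : M.IsModel μ) (hc : 0 < c) (hK : 0 < K) {S k κ' : ℝ} (hS : 0 < S)
    (hcoef : ∀ i j, ∑ a, M.coef0 i j a ^ 2 ≤ S ^ 2) (hk1 : K * S / c ≤ k)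
    (hk2 : 2 * σ ^ 2 ≤ k ^ 2) (hκ : κ ≤ κ') (hκ0 : 0 ≤ κ') (hκ1 : κ' < 1)
    {v : Fin N1 × Fin N2 → ℝ} (hv : ∀ b, 0 ≤ v b) {V : ℝ} (hV : 0 < V) (hvV : ∑ b, v b ≤ V)
    {x : ℝ} (hx : 0 < x) :
    μ {ω | 2 * x ≤ ∑ b, v b * |M.Y b.1 b.2 0 ω|}
      ≤ ENNReal.ofReal (Real.exp (-((1 - κ') / V * x)) * (3 * Real.exp (9 * k ^ 2 / 2))) := by
  have h1κ : 0 < 1 - κ' := by linarith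
  -- This makes the total weight of all innovations at most `1`, as Jensen requires, for every
  -- truncation `n`.
  set s := (1 - κ') / V with hs
  have hs0 : 0 < s := by positivity
  obtain ⟨P, hP0, hPsum, hPY⟩ := ha.exists_abs_Y_le hm hκ hκ0
  set W1 : ℕ → Ω → ℝ := fun n ω => ∑ b, v b * ∑ a, P b n a * |M.Y a.1 a.2 (-(n : ℤ)) ω| with hW1
  set W2 : ℕ → Ω → ℝ := fun n ω => ∑ p ∈ (Finset.univ : Finset (Fin N1 × Fin N2)) ×ˢ
    (Finset.range n ×ˢ (Finset.univ : Finset (Fin N1 × Fin N2))),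
      (s * (v p.1 * P p.1 p.2.1 p.2.2)) * |M.innov (-(p.2.1 : ℤ)) ω p.2.2| with hW2
  have hbound : ∀ n ω, ∑ b, v b * |M.Y b.1 b.2 0 ω| ≤ W1 n ω + s⁻¹ * W2 n ω := by
    intro n ω
    have hW2e : s⁻¹ * W2 n ω
        = ∑ b, v b * ∑ τ ∈ Finset.range n, ∑ a, P b τ a * |M.innov (-(τ : ℤ)) ω a| := by
      simp only [hW2, Finset.sum_product, Finset.mul_sum]
      refine Finset.sum_congr rfl fun b _ => Finset.sum_congr rfl fun τ _ =>
        Finset.sum_congr rfl fun a _ => ?_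
      field_simp
    rw [hW2e, hW1, ← Finset.sum_add_distrib]
    refine Finset.sum_le_sum fun b _ => ?_
    rw [← mul_add]
    exact mul_le_mul_of_nonneg_left (hPY n ω b) (hv b)
  have hT2 : ∀ n, μ {ω | s * x ≤ W2 n ω}
      ≤ ENNReal.ofReal (Real.exp (-(s * x)) * (3 * Real.exp (9 * k ^ 2 / 2))) := by
    intro n
    refine (measure_le_expMom (Finset.measurable_sum _ fun p _ =>
      ((hm.measurable_innov _ _).abs).const_mul _) _).trans ?_
    rw [ENNReal.ofReal_mul (Real.exp_pos _).le]
    refine mul_le_mul_right ?_ _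
    refine ha.expMom_sum_innov hm hc hK hS hcoef hk1 hk2 _
      (fun p : (Fin N1 × Fin N2) × ℕ × (Fin N1 × Fin N2) => s * (v p.1 * P p.1 p.2.1 p.2.2))
      (fun p => -(p.2.1 : ℤ)) (fun p => p.2.2) ?_ ?_
    · intro p _
      exact mul_nonneg hs0.le (mul_nonneg (hv _) (hP0 _ _ _))
    · simp only [Finset.sum_product]
      calc ∑ b, ∑ τ ∈ Finset.range n, ∑ a, s * (v b * P b τ a)
          = s * ∑ b, v b * ∑ τ ∈ Finset.range n, ∑ a, P b τ a := by
            simp only [Finset.mul_sum]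
        _ ≤ s * ∑ b, v b * (1 - κ')⁻¹ := by
            refine mul_le_mul_of_nonneg_left (Finset.sum_le_sum fun b _ => ?_) hs0.le
            refine mul_le_mul_of_nonneg_left ?_ (hv b)
            exact (Finset.sum_le_sum fun τ _ => hPsum b τ).trans (geom_sum_le_inv hκ0 hκ1 n)
        _ = s * ((∑ b, v b) * (1 - κ')⁻¹) := by rw [Finset.sum_mul]
        _ ≤ s * (V * (1 - κ')⁻¹) := by gcongr
        _ = 1 := by rw [hs]; field_simp
  have hYabs : ∀ (a : Fin N1 × Fin N2) (t : ℤ), Integrable (fun ω => |M.Y a.1 a.2 t ω|) μ :=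
    fun a t => ((hm.memLp_Y a.1 a.2 t).integrable (by norm_num)).abs
  have hYle : ∀ (a : Fin N1 × Fin N2) (t : ℤ), ∫ ω, |M.Y a.1 a.2 t ω| ∂μ ≤ 1 + τhi := by
    intro a t
    have hsq := (hm.memLp_Y a.1 a.2 t).integrable_sq
    calc ∫ ω, |M.Y a.1 a.2 t ω| ∂μ ≤ ∫ ω, (1 + M.Y a.1 a.2 t ω ^ 2) ∂μ := by
          refine integral_mono (hYabs a t) ((integrable_const 1).add hsq) fun ω => ?_
          simp only
          rw [← sq_abs]
          nlinarith [sq_nonneg (|M.Y a.1 a.2 t ω| - 1), abs_nonneg (M.Y a.1 a.2 t ω)]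
      _ = 1 + ∫ ω, M.Y a.1 a.2 t ω ^ 2 ∂μ := by
          rw [integral_add (integrable_const 1) hsq]; simp
      _ ≤ _ := by gcongr; exact ha.integral_Y_sq_le hm hc hK a.1 a.2 t
  -- The remainder at time `-n` needs only Markov's inequality: its mean decays like `κ'^n` by
  -- bounded second moments.
  have hT1 : ∀ n, μ {ω | x ≤ W1 n ω} ≤ ENNReal.ofReal (V * κ' ^ n * (1 + τhi) / x) := by
    intro n
    have hin : ∀ b, Integrable (fun ω => ∑ a, P b n a * |M.Y a.1 a.2 (-(n : ℤ)) ω|) μ :=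
      fun b => integrable_finsetSum _ fun a _ => (hYabs a _).const_mul _
    have hInt : Integrable (W1 n) μ := integrable_finsetSum _ fun b _ => (hin b).const_mul _
    have hnn : 0 ≤ᵐ[μ] W1 n := ae_of_all _ fun ω => Finset.sum_nonneg fun b _ =>
      mul_nonneg (hv b) (Finset.sum_nonneg fun a _ => mul_nonneg (hP0 _ _ _) (abs_nonneg _))
    have hmk := mul_meas_ge_le_integral_of_nonneg hnn hInt x
    have hIW : ∫ ω, W1 n ω ∂μ ≤ V * κ' ^ n * (1 + τhi) := by
      have h01 : 0 ≤ 1 + τhi := by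
        by_cases hne : Nonempty (Fin N1 × Fin N2)
        · obtain ⟨a⟩ := hne
          exact (integral_nonneg fun ω => abs_nonneg _).trans (hYle a 0)
        -- In an empty panel the supremum takes its default value `0`, which still yields `0 ≤ τhi`.
        · have := ha.tauMax_le
          rw [not_nonempty_iff] at hne
          have h0 : M.tauMax μ = 0 := by
            unfold tauMax
            rcases isEmpty_prod.1 hne with h | h
            · exact Real.iSup_of_isEmpty _
            · simp
          linarith
      calc ∫ ω, W1 n ω ∂μ = ∑ b, v b * ∑ a, P b n a * ∫ ω, |M.Y a.1 a.2 (-(n : ℤ)) ω| ∂μ := by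
            rw [hW1, integral_finsetSum _ fun b _ => (hin b).const_mul _]
            refine Finset.sum_congr rfl fun b _ => ?_
            rw [integral_const_mul, integral_finsetSum _ fun a _ => (hYabs a _).const_mul _]
            simp_rw [integral_const_mul]
        _ ≤ ∑ b, v b * (κ' ^ n * (1 + τhi)) := by
            refine Finset.sum_le_sum fun b _ => mul_le_mul_of_nonneg_left ?_ (hv b)
            calc _ ≤ ∑ a, P b n a * (1 + τhi) :=
                  Finset.sum_le_sum fun a _ => mul_le_mul_of_nonneg_left (hYle _ _) (hP0 _ _ _)
              _ = (∑ a, P b n a) * (1 + τhi) := by rw [Finset.sum_mul]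
              _ ≤ _ := by gcongr; exact hPsum b n
        _ = (∑ b, v b) * (κ' ^ n * (1 + τhi)) := by rw [Finset.sum_mul]
        _ ≤ V * (κ' ^ n * (1 + τhi)) := by gcongr
        _ = _ := by ring
    rw [← ENNReal.ofReal_toReal (measure_ne_top μ _)]
    refine ENNReal.ofReal_le_ofReal ?_
    rw [le_div_iff₀ hx, mul_comm]
    exact hmk.trans hIW
  have hall : ∀ n, μ {ω | 2 * x ≤ ∑ b, v b * |M.Y b.1 b.2 0 ω|}
      ≤ ENNReal.ofReal (V * κ' ^ n * (1 + τhi) / x)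
        + ENNReal.ofReal (Real.exp (-(s * x)) * (3 * Real.exp (9 * k ^ 2 / 2))) := by
    intro n
    refine le_trans (measure_mono ?_) ((measure_union_le _ _).trans (add_le_add (hT1 n) (hT2 n)))
    intro ω hω
    have hω : 2 * x ≤ ∑ b, v b * |M.Y b.1 b.2 0 ω| := hω
    by_contra hcon
    simp only [Set.mem_union, Set.mem_ofPred_eq, not_or, not_le] at hcon
    have h3 := hbound n ω
    have h4 : s⁻¹ * W2 n ω < x := by
      rw [inv_mul_lt_iff₀ hs0]; exact hcon.2
    linarith [hcon.1]
  -- The left side does not depend on `n`; letting `n` tend to infinity removes the remainder.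
  have hlim : Tendsto (fun n : ℕ => ENNReal.ofReal (V * κ' ^ n * (1 + τhi) / x)
        + ENNReal.ofReal (Real.exp (-(s * x)) * (3 * Real.exp (9 * k ^ 2 / 2)))) atTop
      (𝓝 (0 + ENNReal.ofReal (Real.exp (-(s * x)) * (3 * Real.exp (9 * k ^ 2 / 2))))) := by
    refine Tendsto.add ?_ tendsto_const_nhds
    rw [← ENNReal.ofReal_zero]
    refine ENNReal.tendsto_ofReal ?_
    have := (((tendsto_pow_atTop_nhds_zero_of_lt_one hκ0 hκ1).const_mul V).mul_const
      (1 + τhi)).div_const x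
    simpa using this
  have := ge_of_tendsto' hlim hall
  rwa [zero_add] at this

/-- Total weight of the responses at time `0` in the start parts. -/
def startWeight (M : Panel Ω N1 N2 p1 p2 G0 H0) (T : ℕ) (i : Fin N1) (j : Fin N2)
    (u : RegIdx p1 p2 → ℝ) (b : Fin N1 × Fin N2) : ℝ :=
  ∑ k ∈ Finset.range T, |M.lagCoef i j u k b|

lemma startWeight_nonneg (M : Panel Ω N1 N2 p1 p2 G0 H0) (T : ℕ) (i : Fin N1) (j : Fin N2)
    (u : RegIdx p1 p2 → ℝ) (b : Fin N1 × Fin N2) : 0 ≤ M.startWeight T i j u b :=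
  Finset.sum_nonneg fun _ _ => abs_nonneg _

lemma sum_startWeight_le (M : Panel Ω N1 N2 p1 p2 G0 H0) (T : ℕ) (i : Fin N1) (j : Fin N2)
    (u : RegIdx p1 p2 → ℝ) {κ : ℝ} (hκ : 0 ≤ κ) (hκ1 : κ < 1)
    (hl : ∀ τ, ∑ b, |M.lagCoef i j u τ b| ≤ 3 * κ ^ τ) :
    ∑ b, M.startWeight T i j u b ≤ 3 / (1 - κ) := by
  unfold startWeight
  rw [Finset.sum_comm]
  refine (Finset.sum_le_sum fun τ _ => hl τ).trans ?_
  rw [← Finset.mul_sum, div_eq_mul_inv]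
  exact mul_le_mul_of_nonneg_left (geom_sum_le_inv hκ hκ1 T) (by norm_num)

/-- A sum of squares is at most the square of the absolute sum. One weighted sum of `|Y_0|` thus
controls all times, with total weight bounded in `T`. -/
lemma sum_startPart_sq_le (M : Panel Ω N1 N2 p1 p2 G0 H0) (T : ℕ) (i : Fin N1) (j : Fin N2)
    (u : RegIdx p1 p2 → ℝ) (ω : Ω) :
    ∑ k ∈ Finset.range T, M.startPart i j u k ω ^ 2
      ≤ (∑ b, M.startWeight T i j u b * |M.Y b.1 b.2 0 ω|) ^ 2 := by
  have h1 : ∑ k ∈ Finset.range T, |M.startPart i j u k ω|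
      ≤ ∑ b, M.startWeight T i j u b * |M.Y b.1 b.2 0 ω| := by
    unfold startWeight startPart
    simp_rw [Finset.sum_mul]
    rw [Finset.sum_comm]
    refine Finset.sum_le_sum fun k _ => (Finset.abs_sum_le_sum_abs _ _).trans (le_of_eq ?_)
    simp_rw [abs_mul]
  calc _ = ∑ k ∈ Finset.range T, |M.startPart i j u k ω| ^ 2 := by simp_rw [sq_abs]
    _ ≤ (∑ k ∈ Finset.range T, |M.startPart i j u k ω|) ^ 2 :=
        Finset.sum_sq_le_sq_sum_of_nonneg fun _ _ => abs_nonneg _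
    _ ≤ _ := by
        have : 0 ≤ ∑ k ∈ Finset.range T, |M.startPart i j u k ω| :=
          Finset.sum_nonneg fun _ _ => abs_nonneg _
        gcongr

/-- Cauchy–Schwarz with weights `v`, then the second moment of the responses. -/
lemma Assumptions.integral_startPart_sq_le (ha : M.Assumptions μ T R τlo τhi σ K c κ cgap cpi)
    (hm : M.IsModel μ) (hc : 0 < c) (hK : 0 < K) (i : Fin N1) (j : Fin N2)
    (u : RegIdx p1 p2 → ℝ) {κ' : ℝ} (hκ : 0 ≤ κ') (hκ1 : κ' < 1)
    (hl : ∀ τ, ∑ b, |M.lagCoef i j u τ b| ≤ 3 * κ' ^ τ) :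
    ∫ ω, ∑ k ∈ Finset.range T, M.startPart i j u k ω ^ 2 ∂μ ≤ (3 / (1 - κ')) ^ 2 * τhi := by
  set v := M.startWeight T i j u with hv
  have hv0 : ∀ b, 0 ≤ v b := M.startWeight_nonneg T i j u
  have hvs : ∑ b, v b ≤ 3 / (1 - κ') := M.sum_startWeight_le T i j u hκ hκ1 hl
  have h1κ : 0 < 1 - κ' := by linarith
  have hτ : 0 ≤ τhi := (integral_nonneg fun ω => sq_nonneg _).trans
    (ha.integral_Y_sq_le hm hc hK i j 0)
  have hle : ∀ ω, ∑ k ∈ Finset.range T, M.startPart i j u k ω ^ 2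
      ≤ (3 / (1 - κ')) * ∑ b, v b * M.Y b.1 b.2 0 ω ^ 2 := by
    intro ω
    refine (M.sum_startPart_sq_le T i j u ω).trans ?_
    refine (Finset.sum_sq_le_sum_mul_sum_of_sq_le_mul Finset.univ (f := v)
      (g := fun b => v b * M.Y b.1 b.2 0 ω ^ 2) (fun b _ => hv0 b)
      (fun b _ => mul_nonneg (hv0 b) (sq_nonneg _))
      (fun b _ => le_of_eq (by rw [mul_pow, sq_abs]; ring))).trans ?_
    exact mul_le_mul_of_nonneg_right hvs
      (Finset.sum_nonneg fun b _ => mul_nonneg (hv0 b) (sq_nonneg _))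
  have hI : ∀ b : Fin N1 × Fin N2, Integrable (fun ω => v b * M.Y b.1 b.2 0 ω ^ 2) μ :=
    fun b => (hm.memLp_Y b.1 b.2 0).integrable_sq.const_mul _
  have hI2 : Integrable (fun ω => (3 / (1 - κ')) * ∑ b, v b * M.Y b.1 b.2 0 ω ^ 2) μ :=
    (integrable_finsetSum _ fun b _ => hI b).const_mul _
  refine (integral_mono_of_nonneg (ae_of_all _ fun ω => Finset.sum_nonneg fun _ _ => sq_nonneg _)
    hI2 (ae_of_all _ hle)).trans ?_
  rw [integral_const_mul, integral_finsetSum _ fun b _ => hI b, sq, mul_assoc]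
  refine mul_le_mul_of_nonneg_left ?_ (by positivity)
  calc ∑ b, ∫ ω, v b * M.Y b.1 b.2 0 ω ^ 2 ∂μ ≤ ∑ b, v b * τhi := by
        refine Finset.sum_le_sum fun b _ => ?_
        rw [integral_const_mul]
        exact mul_le_mul_of_nonneg_left (ha.integral_Y_sq_le hm hc hK _ _ _) (hv0 b)
    _ = (∑ b, v b) * τhi := by rw [Finset.sum_mul]
    _ ≤ _ := by gcongr

end Panel

end

/-! ### Assembling the deviations of the three parts. -/

section

/-- The cross term satisfies `2|rw| ≤ r²/δ + δw²`. Comparing energies this way needs no independence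
between the start part and the rest. -/
lemma abs_add_sq_sub_sq_le {δ : ℝ} (hδ : 0 < δ) (r w : ℝ) :
    |(r + w) ^ 2 - w ^ 2| ≤ (1 + 1 / δ) * r ^ 2 + δ * w ^ 2 := by
  have h1 : 2 * (r * w) ≤ 1 / δ * r ^ 2 + δ * w ^ 2 := by
    have h : 0 ≤ (r - δ * w) ^ 2 / δ := by positivity
    have e : (r - δ * w) ^ 2 / δ = 1 / δ * r ^ 2 + δ * w ^ 2 - 2 * (r * w) := by
      field_simp; ring
    linarith
  have h2 : -(2 * (r * w)) ≤ 1 / δ * r ^ 2 + δ * w ^ 2 := by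
    have h : 0 ≤ (r + δ * w) ^ 2 / δ := by positivity
    have e : (r + δ * w) ^ 2 / δ = 1 / δ * r ^ 2 + δ * w ^ 2 + 2 * (r * w) := by
      field_simp; ring
    linarith
  rw [abs_le]
  constructor <;> nlinarith [sq_nonneg r]

lemma sum_abs_add_sq_sub_sq_le {δ : ℝ} (hδ : 0 < δ) (s : Finset ℕ) (r w : ℕ → ℝ) :
    |∑ k ∈ s, (r k + w k) ^ 2 - ∑ k ∈ s, w k ^ 2|
      ≤ (1 + 1 / δ) * ∑ k ∈ s, r k ^ 2 + δ * ∑ k ∈ s, w k ^ 2 := by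
  rw [← Finset.sum_sub_distrib, Finset.mul_sum, Finset.mul_sum, ← Finset.sum_add_distrib]
  exact (Finset.abs_sum_le_sum_abs _ _).trans
    (Finset.sum_le_sum fun k _ => abs_add_sq_sub_sq_le hδ _ _)

/-- Deviation of the energy of `r + u + e` from the deviations of its parts. -/
lemma energy_deviation_lt {Z W U E X R eZ eU eE ρ T y z δ Q t : ℝ} (hT : 1 ≤ T) (hy : 0 < y)
    (hz : z = y / 4) (hQ : 0 ≤ Q) (hδ : δ = y / (2 * Q + y)) (ht : t = min 1 (z / (2 * √Q + 1)))
    (hW : W = U ^ 2 + 2 * X + E)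
    (hZW : |Z - W| ≤ (1 + 1 / δ) * R + δ * W)
    (hqZ : |eZ - (eU + eE)| ≤ (1 + 1 / δ) * ρ + δ * (eU + eE))
    (heU : 0 ≤ eU) (heE : 0 ≤ eE) (hq : eU + eE ≤ Q * T) (hρ : (1 + 1 / δ) * ρ ≤ y * T)
    (hR : (1 + 1 / δ) * R ≤ y * T) (hU : |U - √eU| < t * √T)
    (hE : |E - eE| < z * T) (hX : |X| < z * T) :
    |Z - eZ| < 8 * y * T := by
  have hTs : √T * √T = T := Real.mul_self_sqrt (by linarith)
  have hT0 : 0 < T := by linarith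
  have hsT : 0 < √T := Real.sqrt_pos.2 hT0
  have hz0 : 0 < z := by rw [hz]; positivity
  have hδ0 : 0 < δ := by rw [hδ]; positivity
  have ht1 : t ≤ 1 := by rw [ht]; exact min_le_left _ _
  have ht2 : t * (2 * √Q + 1) ≤ z := by
    have := min_le_right 1 (z / (2 * √Q + 1))
    rw [← ht, le_div_iff₀ (by positivity)] at this
    exact this
  have ht0 : 0 < t := by rw [ht]; positivity
  have hsU : √eU ≤ √Q * √T := by
    rw [← Real.sqrt_mul hQ]
    exact Real.sqrt_le_sqrt (by linarith)
  -- Factor `U² - eU` through `U - √eU`: a deviation `t √T` of the norm, with `√eU ≤ √(QT)`, costs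
  -- `t (t + 2√Q) T`. The value of `t` makes this at most `z T`.
  have hU2 : |U ^ 2 - eU| ≤ z * T := by
    have e : U ^ 2 - eU = (U - √eU) * (U - √eU + 2 * √eU) := by
      nlinarith [Real.mul_self_sqrt heU]
    rw [e, abs_mul]
    calc |U - √eU| * |U - √eU + 2 * √eU| ≤ (t * √T) * (t * √T + 2 * (√Q * √T)) := by
          refine mul_le_mul hU.le ((abs_add_le _ _).trans ?_) (abs_nonneg _) (by positivity)
          rw [abs_of_nonneg (by positivity : 0 ≤ 2 * √eU)]
          linarith [hU.le]
      _ = t * (2 * √Q + t) * T := by linear_combination (t * (2 * √Q + t)) * hTs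
      _ ≤ t * (2 * √Q + 1) * T := by gcongr
      _ ≤ z * T := by gcongr
  -- Deviations of `U²`, `2X` and `E` cost `z`, `2z` and `z`, and `4z = y`.
  have hWq : |W - (eU + eE)| ≤ y * T := by
    rw [abs_le] at hU2 ⊢
    rw [abs_lt] at hE hX
    rw [hz] at *
    constructor <;> linarith [hU2.1, hU2.2, hE.1, hE.2, hX.1, hX.2]
  -- The choice of `δ`: the terms multiplied by it sum to at most `(2Q + y) T`.
  have hδQ : δ * (2 * Q + y) = y := by rw [hδ]; field_simp
  have hδW : δ * W + δ * (eU + eE) ≤ y * T := by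
    have h1 : W ≤ (Q + y) * T := by linarith [(abs_le.1 hWq).2]
    have h2 : δ * (W + (eU + eE)) ≤ δ * ((2 * Q + y) * T) := by
      refine mul_le_mul_of_nonneg_left ?_ hδ0.le
      linarith
    calc _ = δ * (W + (eU + eE)) := by ring
      _ ≤ δ * (2 * Q + y) * T := by linarith
      _ = _ := by rw [hδQ]
  have hyT : 0 < y * T := by positivity
  rw [abs_le] at hZW hqZ hWq
  rw [abs_lt]
  constructor <;> linarith [hZW.1, hZW.2, hqZ.1, hqZ.2, hWq.1, hWq.2]

namespace Panel

variable {Ω : Type*} {N1 N2 p1 p2 G0 H0 G H : ℕ}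
variable [mΩ : MeasurableSpace Ω] {μ : Measure Ω} [IsProbabilityMeasure μ]
  {M : Panel Ω N1 N2 p1 p2 G0 H0} {T : ℕ} {R τlo τhi σ K c κ cgap cpi : ℝ}

/-- One side is a function of the covariate process, the other of the noise process; exogeneity
separates them. -/
lemma Assumptions.indepFun_projected (ha : M.Assumptions μ T R τlo τhi σ K c κ cgap cpi)
    (s : ℤ) (η1 : Fin 2 → Fin N1 → Fin p1 → ℝ) (η2 : Fin 2 → Fin N2 → Fin p2 → ℝ)
    (i : Fin N1) (j : Fin N2) (u : RegIdx p1 p2 → ℝ) :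
    IndepFun (fun ω => (M.projected T s η1 η2 ω).ofLp)
      (fun ω (k : Fin T) => M.noisePart i j u k ω) μ := by
  have hφ : Measurable (fun (x : Fin N1 × Fin N2 × ℤ → ℝ) (k : Fin T) =>
      ∑ τ ∈ Finset.range k, ∑ a : Fin N1 × Fin N2, M.lagCoef i j u τ a
        * x (a.1, a.2, (((k : ℕ) - τ : ℕ) : ℤ))) :=
    measurable_pi_lambda _ fun k => Finset.measurable_sum _ fun τ _ =>
      Finset.measurable_sum _ fun a _ => (measurable_pi_apply _).const_mul _
  have hψ : Measurable (fun (x : (ℤ → Fin N1 → Fin p1 → ℝ) × (ℤ → Fin N2 → Fin p2 → ℝ))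
      (q : Fin (T + 1) × Fin 2 × (Fin N1 ⊕ Fin N2)) => match q with
        | (l, b, Sum.inl i) => ∑ a, x.1 (s + (l : ℕ)) i a * η1 b i a
        | (l, b, Sum.inr j) => ∑ a, x.2 (s + (l : ℕ)) j a * η2 b j a) := by
    refine measurable_pi_lambda _ ?_
    rintro ⟨l, b, i | j⟩
    · exact Finset.measurable_sum _ fun a _ => Measurable.mul_const (by fun_prop) _
    · exact Finset.measurable_sum _ fun a _ => Measurable.mul_const (by fun_prop) _
  exact (ha.eps_exog.comp hφ hψ).symm

lemma IsModel.measurable_noisePart (hm : M.IsModel μ) (i : Fin N1) (j : Fin N2)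
    (u : RegIdx p1 p2 → ℝ) (k : ℕ) : Measurable (M.noisePart i j u k) :=
  measurable_noiseFilter (fun _ _ => hm.measurable_eps _ _ _) _ _

lemma Assumptions.memLp_noisePart (ha : M.Assumptions μ T R τlo τhi σ K c κ cgap cpi)
    (hm : M.IsModel μ) (i : Fin N1) (j : Fin N2) (u : RegIdx p1 p2 → ℝ) (k : ℕ) :
    MemLp (M.noisePart i j u k) 2 μ := (ha.isNoise hm).memLp_noiseFilter _ _

lemma Assumptions.integral_noisePart (ha : M.Assumptions μ T R τlo τhi σ K c κ cgap cpi)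
    (hm : M.IsModel μ) (i : Fin N1) (j : Fin N2) (u : RegIdx p1 p2 → ℝ) (k : ℕ) :
    ∫ ω, M.noisePart i j u k ω ∂μ = 0 := by
  unfold noisePart noiseFilter
  rw [integral_finsetSum _ fun τ _ =>
    ((ha.isNoise hm).memLp_noiseForm _ _).integrable (by norm_num)]
  simp [(ha.isNoise hm).mean_noiseForm]

lemma IsModel.memLp_startPart (hm : M.IsModel μ) (i : Fin N1) (j : Fin N2)
    (u : RegIdx p1 p2 → ℝ) (k : ℕ) : MemLp (M.startPart i j u k) 2 μ :=
  memLp_finsetSum _ fun _ _ => (hm.memLp_Y _ _ _).const_mul _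

/-- Obtained by subtraction from the regressor form, whose square integrability is known. -/
lemma Assumptions.memLp_covPart (ha : M.Assumptions μ T R τlo τhi σ K c κ cgap cpi)
    (hm : M.IsModel μ) (hc : 0 < c) (hK : 0 < K) (i : Fin N1) (j : Fin N2)
    (u : RegIdx p1 p2 → ℝ) (k : ℕ) : MemLp (M.covPart i j u k) 2 μ := by
  have h := ((ha.memLp_regForm hm hc hK i j u ((k : ℤ) + 1)).sub
    (hm.memLp_startPart i j u k)).sub (ha.memLp_noisePart hm i j u k)
  refine h.ae_eq (ae_of_all _ fun ω => ?_)
  have := hm.regForm_decomp i j u k ω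
  simp only [Pi.sub_apply]
  linarith

lemma Assumptions.integral_covPart_mul_noisePart
    (ha : M.Assumptions μ T R τlo τhi σ K c κ cgap cpi) (hm : M.IsModel μ) (hc : 0 < c)
    (hK : 0 < K) (i : Fin N1) (j : Fin N2) (u : RegIdx p1 p2 → ℝ) {k : ℕ} (hk : k < T) :
    ∫ ω, M.covPart i j u k ω * M.noisePart i j u k ω ∂μ = 0 := by
  have hind : IndepFun (M.covPart i j u k) (M.noisePart i j u k) μ := by
    have h1 := ha.indepFun_projected (0 : ℤ) (M.dirX (1 : ℝ)⁻¹ u) (M.dirZ (1 : ℝ)⁻¹ u) i j u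
    have h2 : Measurable (fun v : (Fin (T + 1) × Fin 2 × (Fin N1 ⊕ Fin N2)) → ℝ =>
        M.covMap T 1 i j u v ⟨k, hk⟩) :=
      ((LinearMap.proj (⟨k, hk⟩ : Fin T) ∘ₗ
        M.covMap T 1 i j u).continuous_of_finiteDimensional).measurable
    have h3 := h1.comp h2 (measurable_pi_apply (⟨k, hk⟩ : Fin T))
    have e : M.covPart i j u k = (fun v : (Fin (T + 1) × Fin 2 × (Fin N1 ⊕ Fin N2)) → ℝ =>
        M.covMap T 1 i j u v ⟨k, hk⟩) ∘ fun ω =>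
          (M.projected T 0 (M.dirX (1 : ℝ)⁻¹ u) (M.dirZ (1 : ℝ)⁻¹ u) ω).ofLp := by
      ext ω
      exact M.covPart_eq T one_ne_zero i j u ⟨k, hk⟩ ω
    rw [e]
    exact h3
  have h := hind.integral_mul_eq_mul_integral (ha.memLp_covPart hm hc hK i j u k).1
    (ha.memLp_noisePart hm i j u k).1
  rw [ha.integral_noisePart hm i j u k, mul_zero] at h
  exact h

end Panel

end

/-! ### Mean energies and the tail of the sample energy. -/

section

namespace Panel

section Moments

variable {Ω : Type*} {N1 N2 p1 p2 G0 H0 G H : ℕ}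
variable [mΩ : MeasurableSpace Ω] {μ : Measure Ω} [IsProbabilityMeasure μ]
  {M : Panel Ω N1 N2 p1 p2 G0 H0} {T : ℕ} {R τlo τhi σ K c κ cgap cpi : ℝ}

/-- Mean energy of the covariate part and of the noise part. -/
def partEnergy (M : Panel Ω N1 N2 p1 p2 G0 H0) (μ : Measure Ω) (T : ℕ) (i : Fin N1) (j : Fin N2)
    (u : RegIdx p1 p2 → ℝ) : ℝ :=
  ∫ ω, ∑ k ∈ Finset.range T, M.covPart i j u k ω ^ 2 ∂μ
    + ∫ ω, ∑ k ∈ Finset.range T, M.noisePart i j u k ω ^ 2 ∂μ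

/-- The cross terms have mean zero: the noise part is centred and independent of the covariate part.
-/
lemma Assumptions.partEnergy_eq (ha : M.Assumptions μ T R τlo τhi σ K c κ cgap cpi)
    (hm : M.IsModel μ) (hc : 0 < c) (hK : 0 < K) (i : Fin N1) (j : Fin N2)
    (u : RegIdx p1 p2 → ℝ) :
    ∫ ω, ∑ k ∈ Finset.range T, (M.covPart i j u k ω + M.noisePart i j u k ω) ^ 2 ∂μ
      = M.partEnergy μ T i j u := by
  have hU : ∀ k, Integrable (fun ω => M.covPart i j u k ω ^ 2) μ :=
    fun k => (ha.memLp_covPart hm hc hK i j u k).integrable_sq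
  have hE : ∀ k, Integrable (fun ω => M.noisePart i j u k ω ^ 2) μ :=
    fun k => (ha.memLp_noisePart hm i j u k).integrable_sq
  have hUE : ∀ k, Integrable (fun ω => M.covPart i j u k ω * M.noisePart i j u k ω) μ :=
    fun k => (ha.memLp_covPart hm hc hK i j u k).integrable_mul (ha.memLp_noisePart hm i j u k)
  have hW : ∀ k, Integrable (fun ω => (M.covPart i j u k ω + M.noisePart i j u k ω) ^ 2) μ :=
    fun k => ((ha.memLp_covPart hm hc hK i j u k).add
      (ha.memLp_noisePart hm i j u k)).integrable_sq
  unfold partEnergy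
  rw [integral_finsetSum _ fun k _ => hW k, integral_finsetSum _ fun k _ => hU k,
    integral_finsetSum _ fun k _ => hE k, ← Finset.sum_add_distrib]
  refine Finset.sum_congr rfl fun k hk => ?_
  have e : (fun ω => (M.covPart i j u k ω + M.noisePart i j u k ω) ^ 2)
      = fun ω => (M.covPart i j u k ω ^ 2 + M.noisePart i j u k ω ^ 2)
        + 2 * (M.covPart i j u k ω * M.noisePart i j u k ω) := by
    ext ω; ring
  have hUpE : Integrable (fun ω => M.covPart i j u k ω ^ 2 + M.noisePart i j u k ω ^ 2) μ :=
    (hU k).add (hE k)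
  rw [e, integral_add hUpE ((hUE k).const_mul 2), integral_add (hU k) (hE k),
    integral_const_mul, ha.integral_covPart_mul_noisePart hm hc hK i j u (Finset.mem_range.1 hk)]
  ring

lemma Assumptions.integral_energy (ha : M.Assumptions μ T R τlo τhi σ K c κ cgap cpi)
    (hm : M.IsModel μ) (hc : 0 < c) (hK : 0 < K) (i : Fin N1) (j : Fin N2)
    (u : RegIdx p1 p2 → ℝ) :
    ∫ ω, ∑ k ∈ Finset.range T, M.regForm i j u ((k : ℤ) + 1) ω ^ 2 ∂μ
      = T * M.quad μ i j u := by
  rw [integral_finsetSum _ fun k _ => (ha.memLp_regForm hm hc hK i j u _).integrable_sq]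
  simp [ha.integral_regForm_sq hm hc hK]

lemma Assumptions.abs_quad_sub_partEnergy_le
    (ha : M.Assumptions μ T R τlo τhi σ K c κ cgap cpi)
    (hm : M.IsModel μ) (hc : 0 < c) (hK : 0 < K) (i : Fin N1) (j : Fin N2)
    (u : RegIdx p1 p2 → ℝ) {δ : ℝ} (hδ : 0 < δ) :
    |T * M.quad μ i j u - M.partEnergy μ T i j u|
      ≤ (1 + 1 / δ) * ∫ ω, ∑ k ∈ Finset.range T, M.startPart i j u k ω ^ 2 ∂μ
        + δ * M.partEnergy μ T i j u := by
  have hR : Integrable (fun ω => ∑ k ∈ Finset.range T, M.startPart i j u k ω ^ 2) μ :=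
    integrable_finsetSum _ fun k _ => (hm.memLp_startPart i j u k).integrable_sq
  have hW : Integrable (fun ω => ∑ k ∈ Finset.range T,
      (M.covPart i j u k ω + M.noisePart i j u k ω) ^ 2) μ :=
    integrable_finsetSum _ fun k _ => ((ha.memLp_covPart hm hc hK i j u k).add
      (ha.memLp_noisePart hm i j u k)).integrable_sq
  have hZ : Integrable (fun ω => ∑ k ∈ Finset.range T, M.regForm i j u ((k : ℤ) + 1) ω ^ 2) μ :=
    integrable_finsetSum _ fun k _ => (ha.memLp_regForm hm hc hK i j u _).integrable_sq
  rw [← ha.integral_energy hm hc hK, ← ha.partEnergy_eq hm hc hK, ← integral_sub hZ hW,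
    ← integral_const_mul, ← integral_const_mul, ← integral_add (hR.const_mul _) (hW.const_mul _)]
  refine abs_integral_le_integral_abs.trans ?_
  refine integral_mono (hZ.sub hW).abs ((hR.const_mul _).add (hW.const_mul _)) fun ω => ?_
  simp only [hm.regForm_decomp i j u _ ω]
  exact sum_abs_add_sq_sub_sq_le hδ _ _ _

/-- From `w² ≤ 2 (r + w)² + 2 r²`: the energy of the two parts is bounded through `Σ` and the start
part, without a separate bound on each. -/
lemma Assumptions.partEnergy_le (ha : M.Assumptions μ T R τlo τhi σ K c κ cgap cpi)
    (hm : M.IsModel μ) (hc : 0 < c) (hK : 0 < K) (i : Fin N1) (j : Fin N2)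
    (u : RegIdx p1 p2 → ℝ) :
    M.partEnergy μ T i j u ≤ 2 * (T * M.quad μ i j u)
      + 2 * ∫ ω, ∑ k ∈ Finset.range T, M.startPart i j u k ω ^ 2 ∂μ := by
  have hR : Integrable (fun ω => ∑ k ∈ Finset.range T, M.startPart i j u k ω ^ 2) μ :=
    integrable_finsetSum _ fun k _ => (hm.memLp_startPart i j u k).integrable_sq
  have hW : Integrable (fun ω => ∑ k ∈ Finset.range T,
      (M.covPart i j u k ω + M.noisePart i j u k ω) ^ 2) μ :=
    integrable_finsetSum _ fun k _ => ((ha.memLp_covPart hm hc hK i j u k).add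
      (ha.memLp_noisePart hm i j u k)).integrable_sq
  have hZ : Integrable (fun ω => ∑ k ∈ Finset.range T, M.regForm i j u ((k : ℤ) + 1) ω ^ 2) μ :=
    integrable_finsetSum _ fun k _ => (ha.memLp_regForm hm hc hK i j u _).integrable_sq
  rw [← ha.integral_energy hm hc hK, ← ha.partEnergy_eq hm hc hK, ← integral_const_mul,
    ← integral_const_mul, ← integral_add (hZ.const_mul _) (hR.const_mul _)]
  refine integral_mono hW ((hZ.const_mul _).add (hR.const_mul _)) fun ω => ?_
  simp only [hm.regForm_decomp i j u _ ω]
  rw [Finset.mul_sum, Finset.mul_sum, ← Finset.sum_add_distrib]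
  refine Finset.sum_le_sum fun k _ => ?_
  nlinarith [sq_nonneg (2 * M.startPart i j u k ω + (M.covPart i j u k ω + M.noisePart i j u k ω))]

/-- Both `ζ⁰`, a block of `Θ⁰_ij`, and the block of `u` have norm at most `S`; the scaling `c / S`
makes both admissible at once. The column `j` serves only to place `ζ⁰` inside some `Θ⁰_ij`. -/
lemma Assumptions.dirX_sq_le {S : ℝ} (hc : 0 < c) (hS : 1 ≤ S) (j : Fin N2)
    (hcoef : ∀ i j, ∑ a, M.coef0 i j a ^ 2 ≤ S ^ 2)
    {u : RegIdx p1 p2 → ℝ} (hu : ∑ a, u a ^ 2 ≤ 1) (b : Fin 2) (i : Fin N1) :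
    ∑ a, M.dirX (S / c)⁻¹ u b i a ^ 2 ≤ c ^ 2 := by
  have hS0 : 0 < S := by linarith
  have h1 : ∑ a, M.par.zeta (M.g0 i) a ^ 2 ≤ S ^ 2 :=
    (sum_regIdx_sq (M.coef0 i j)).1.trans (hcoef i j)
  have h2 : ∑ a, u (.inl (.inr a)) ^ 2 ≤ S ^ 2 :=
    (sum_regIdx_sq u).1.trans (hu.trans (by nlinarith))
  have h3 : (S / c)⁻¹ ^ 2 * S ^ 2 = c ^ 2 := by field_simp
  unfold dirX
  split_ifs <;> simp_rw [mul_pow] <;> rw [← Finset.mul_sum, ← h3] <;>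
    exact mul_le_mul_of_nonneg_left (by assumption) (sq_nonneg _)

lemma Assumptions.dirZ_sq_le {S : ℝ} (hc : 0 < c) (hS : 1 ≤ S) (i : Fin N1)
    (hcoef : ∀ i j, ∑ a, M.coef0 i j a ^ 2 ≤ S ^ 2)
    {u : RegIdx p1 p2 → ℝ} (hu : ∑ a, u a ^ 2 ≤ 1) (b : Fin 2) (j : Fin N2) :
    ∑ a, M.dirZ (S / c)⁻¹ u b j a ^ 2 ≤ c ^ 2 := by
  have hS0 : 0 < S := by linarith
  have h1 : ∑ a, M.par.del (M.h0 j) a ^ 2 ≤ S ^ 2 :=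
    (sum_regIdx_sq (M.coef0 i j)).2.trans (hcoef i j)
  have h2 : ∑ a, u (.inr (.inl (.inr a))) ^ 2 ≤ S ^ 2 :=
    (sum_regIdx_sq u).2.trans (hu.trans (by nlinarith))
  have h3 : (S / c)⁻¹ ^ 2 * S ^ 2 = c ^ 2 := by field_simp
  unfold dirZ
  split_ifs <;> simp_rw [mul_pow] <;> rw [← Finset.mul_sum, ← h3] <;>
    exact mul_le_mul_of_nonneg_left (by assumption) (sq_nonneg _)

end Moments

-- Four bad events, one each for the start part, the covariate norm, the noise energy and the
-- covariate-noise cross term; outside them `energy_deviation_lt` applies. Three have probability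
-- exponentially small in `T`. Only the start event, an exponential tail at level `√T`, is limited
-- to `√T`.
set_option maxHeartbeats 1000000 in
lemma exists_quad_tail {τlo τhi σ K c κ x : ℝ} (hτlo : 0 < τlo) (hτhi : 0 < τhi) (hσ : 0 < σ)
    (hK : 0 < K) (hc : 0 < c) (hκ : κ < 1) (hx : 0 < x) :
    ∃ C : ℝ, 0 < C ∧ ∃ b : ℝ, 0 < b ∧
    ∀ {Ω : Type*} [MeasurableSpace Ω] {μ : Measure Ω} [IsProbabilityMeasure μ]
      {N1 N2 p1 p2 G0 H0 T : ℕ} {M : Panel Ω N1 N2 p1 p2 G0 H0} {R cgap cpi : ℝ},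
      M.IsModel μ → M.Assumptions μ T R τlo τhi σ K c κ cgap cpi → 0 < T →
      ∀ (i : Fin N1) (j : Fin N2) (u : RegIdx p1 p2 → ℝ), ∑ a, u a ^ 2 ≤ 1 →
      μ {ω | x * T ≤ |∑ k ∈ Finset.range T, M.regForm i j u ((k : ℤ) + 1) ω ^ 2
        - T * M.quad μ i j u|} ≤ ENNReal.ofReal (C * Real.exp (-(b * √T))) := by
  -- Positivity is needed because the filter coefficients are normalised by `κ'^τ`.
  set κ' : ℝ := max κ (1 / 2) with hκ'
  have hκκ : κ ≤ κ' := le_max_left _ _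
  have hκ0 : 0 < κ' := lt_of_lt_of_le (by norm_num) (le_max_right _ _)
  have hκ1 : κ' < 1 := max_lt hκ (by norm_num)
  have h1κ : 0 < 1 - κ' := by linarith
  set S : ℝ := √(τhi / τlo) + 1 with hS
  have hS1 : 1 ≤ S := by rw [hS]; linarith [Real.sqrt_nonneg (τhi / τlo)]
  have hS0 : 0 < S := by linarith
  have hS2 : τhi / τlo ≤ S ^ 2 := by
    have h0 : 0 ≤ τhi / τlo := by positivity
    nlinarith [Real.sq_sqrt h0, Real.sqrt_nonneg (τhi / τlo)]
  set D : ℝ := S / c with hD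
  have hD0 : 0 < D := by positivity
  set L : ℝ := 10 * D / (1 - κ') with hL
  have hL0 : 0 < L := by positivity
  set k0 : ℝ := K * S / c + 2 * σ with hk0
  have hk1 : K * S / c ≤ k0 := by linarith
  have hk2 : 2 * σ ^ 2 ≤ k0 ^ 2 := by
    have : 2 * σ ≤ k0 := by
      have : 0 < K * S / c := by positivity
      linarith
    nlinarith
  set V : ℝ := 3 / (1 - κ') with hV
  have hV0 : 0 < V := by positivity
  set ρ : ℝ := V ^ 2 * τhi with hρ
  have hρ0 : 0 < ρ := by positivity
  set Q : ℝ := 2 * τhi + 2 * ρ with hQ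
  have hQ0 : 0 < Q := by positivity
  set y : ℝ := x / 8 with hy
  have hy0 : 0 < y := by positivity
  set z : ℝ := y / 4 with hz
  have hz0 : 0 < z := by positivity
  set δ : ℝ := y / (2 * Q + y) with hδ
  have hδ0 : 0 < δ := by positivity
  set t : ℝ := min 1 (z / (2 * √Q + 1)) with ht
  have ht0 : 0 < t := by positivity
  set y' : ℝ := y / (1 + 1 / δ) with hy'
  have hy'0 : 0 < y' := by positivity
  obtain ⟨b3, hb3, hA3⟩ := exists_energy_tail (L := 3) (proxy σ) hκ0 hκ1 hz0
  set b1 : ℝ := (1 - κ') / V * (√y' / 2) with hb1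
  set b2 : ℝ := t ^ 2 / (4 * (K * L) ^ 2) with hb2
  set b4 : ℝ := z ^ 2 / (K ^ 2 * L ^ 2 * (Q + z)) with hb4
  set b : ℝ := min (min b1 b2) (min b3 b4) with hb
  have hb1p : 0 < b1 := by positivity
  have hb2p : 0 < b2 := by positivity
  have hb4p : 0 < b4 := by positivity
  have hb0 : 0 < b := by rw [hb]; positivity
  have hbb1 : b ≤ b1 := (min_le_left _ _).trans (min_le_left _ _)
  have hbb2 : b ≤ b2 := (min_le_left _ _).trans (min_le_right _ _)
  have hbb3 : b ≤ b3 := (min_le_right _ _).trans (min_le_left _ _)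
  have hbb4 : b ≤ b4 := (min_le_right _ _).trans (min_le_right _ _)
  -- Below `T0` the mean effect of the start may exceed `y T`; the summand `exp (b √T0)` in the
  -- constant makes the claim trivial there.
  set T0 : ℝ := (1 + 1 / δ) * ρ / y with hT0
  set C1 : ℝ := 3 * Real.exp (9 * k0 ^ 2 / 2) + 60 + 2 + 2 with hC1
  have hC1p : 0 < C1 := by positivity
  refine ⟨C1 + Real.exp (b * √T0), by positivity, b, hb0, ?_⟩
  intro Ω _ μ _ N1 N2 p1 p2 G0 H0 T M R cgap cpi hm ha hT i j u hu
  have hT1 : (1 : ℝ) ≤ T := by exact_mod_cast hT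
  have hTp : (0 : ℝ) < T := by linarith
  have hsT1 : 1 ≤ √(T : ℝ) := Real.one_le_sqrt.2 hT1
  have hsT : √(T : ℝ) * √(T : ℝ) = T := Real.mul_self_sqrt hTp.le
  have hsTT : √(T : ℝ) ≤ T := (le_mul_of_one_le_right (by positivity) hsT1).trans_eq hsT
  rcases lt_or_ge (T : ℝ) T0 with hTT | hTT
  · refine prob_le_one.trans ?_
    rw [ENNReal.one_le_ofReal]
    have h1 : 1 ≤ Real.exp (b * √T0) * Real.exp (-(b * √T)) := by
      rw [← Real.exp_add]
      refine Real.one_le_exp ?_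
      have := mul_le_mul_of_nonneg_left (Real.sqrt_le_sqrt hTT.le) hb0.le
      linarith only [this]
    have h2 : 0 < C1 * Real.exp (-(b * √T)) := by positivity
    rw [add_mul]
    linarith only [h1, h2]
  have hl := ha.sum_abs_lagCoef_le hm hκκ hκ0.le i j hu
  have hcoef : ∀ i j, ∑ a, M.coef0 i j a ^ 2 ≤ S ^ 2 :=
    fun i j => (ha.coef0_sq_le hm hc hK hτlo i j).trans hS2
  set Vec := M.projected T 0 (M.dirX D⁻¹ u) (M.dirZ D⁻¹ u) with hVec
  have hconc : ConvexConcentration μ K Vec := ha.concentration 0 _ _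
    (fun b i => Assumptions.dirX_sq_le hc hS1 j hcoef hu b i)
    (fun b j => Assumptions.dirZ_sq_le hc hS1 i hcoef hu b j)
  have hVm : Measurable Vec := hm.measurable_projected _ _ _
  set A := M.covMap T D i j u with hA
  have hAL : ∀ v, l2 (A v) ≤ L * l2 v := M.l2_covMap_le T hD0.le i j u hκ0.le hκ1 hl
  have hcov : ∀ (k : Fin T) ω, M.covPart i j u k ω = A (Vec ω) k :=
    fun k ω => M.covPart_eq T hD0.ne' i j u k ω
  have hl2 : ∀ ω, l2 (A (Vec ω)) ^ 2 = ∑ k ∈ Finset.range T, M.covPart i j u k ω ^ 2 := by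
    intro ω
    rw [l2_sq, Finset.sum_range]
    exact Finset.sum_congr rfl fun k _ => by rw [hcov]
  set eU := ∫ ω, ∑ k ∈ Finset.range T, M.covPart i j u k ω ^ 2 ∂μ with heU
  set eE := ∫ ω, ∑ k ∈ Finset.range T, M.noisePart i j u k ω ^ 2 ∂μ with heE
  have heU0 : 0 ≤ eU := integral_nonneg fun ω => Finset.sum_nonneg fun _ _ => sq_nonneg _
  have heE0 : 0 ≤ eE := integral_nonneg fun ω => Finset.sum_nonneg fun _ _ => sq_nonneg _
  have hpe : M.partEnergy μ T i j u = eU + eE := rfl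
  have hRρ := ha.integral_startPart_sq_le hm hc hK i j u hκ0.le hκ1 hl
  have hquad : M.quad μ i j u ≤ τhi := by
    refine (ha.quad_bounds hm hc hK i j u).2.trans ?_
    have h0 : 0 ≤ ∑ a, u a ^ 2 := Finset.sum_nonneg fun _ _ => sq_nonneg _
    calc M.tauMax μ * ∑ a, u a ^ 2 ≤ τhi * ∑ a, u a ^ 2 := by gcongr; exact ha.tauMax_le
      _ ≤ τhi := mul_le_of_le_one_right hτhi.le hu
  have hqQ : eU + eE ≤ Q * T := by
    have h := ha.partEnergy_le hm hc hK i j u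
    rw [hpe] at h
    have h1 : T * M.quad μ i j u ≤ T * τhi := by gcongr
    have h2 : ρ ≤ ρ * T := le_mul_of_one_le_right hρ0.le hT1
    rw [hQ]
    linarith only [h, h1, h2, hRρ]
  have hqZ := ha.abs_quad_sub_partEnergy_le hm hc hK i j u hδ0
  have hδ1 : 0 < 1 + 1 / δ := by positivity
  set v := M.startWeight T i j u with hv
  have hvs : ∑ b, v b ≤ V := M.sum_startWeight_le T i j u hκ0.le hκ1 hl
  have hsub : {ω | x * T ≤ |∑ k ∈ Finset.range T, M.regForm i j u ((k : ℤ) + 1) ω ^ 2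
        - T * M.quad μ i j u|}
      ⊆ (({ω | 2 * (√y' / 2 * √T) ≤ ∑ b, v b * |M.Y b.1 b.2 0 ω|}
          ∪ {ω | t * √T ≤ |l2 (A (Vec ω)) - √(∫ ω', l2 (A (Vec ω')) ^ 2 ∂μ)|})
        ∪ {ω | z * T ≤ |∑ k ∈ Finset.range T, noiseFilter M.noise (M.lagCoef i j u) k ω ^ 2
            - ∫ ω', ∑ k ∈ Finset.range T, noiseFilter M.noise (M.lagCoef i j u) k ω' ^ 2 ∂μ|})
        ∪ {ω | z * T ≤ |∑ k : Fin T, A (Vec ω) k * M.noisePart i j u k ω|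
            ∧ ∑ k : Fin T, M.noisePart i j u k ω ^ 2 ≤ (Q + z) * T} := by
    intro ω hω
    by_contra hcon
    simp only [Set.mem_union, Set.mem_ofPred_eq, not_or, not_le, not_and] at hcon hω
    obtain ⟨⟨⟨h1, h2⟩, h3⟩, h4⟩ := hcon
    refine absurd hω (not_le.2 ?_)
    have hE : |∑ k ∈ Finset.range T, M.noisePart i j u k ω ^ 2 - eE| < z * T := h3
    have hEQ : ∑ k : Fin T, M.noisePart i j u k ω ^ 2 ≤ (Q + z) * T := by
      rw [← Finset.sum_range (fun k => M.noisePart i j u k ω ^ 2)]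
      linarith [(abs_lt.1 hE).2]
    have hX : |∑ k ∈ Finset.range T, M.covPart i j u k ω * M.noisePart i j u k ω| < z * T := by
      rw [Finset.sum_range]
      simp_rw [hcov]
      by_contra hc
      exact absurd (h4 (not_lt.1 hc)) (not_lt.2 hEQ)
    have hx8 : x = 8 * y := by rw [hy]; ring
    rw [hx8]
    have hRt : ∑ k ∈ Finset.range T, M.startPart i j u k ω ^ 2 ≤ y' * T := by
      refine (M.sum_startPart_sq_le T i j u ω).trans ?_
      have hnn : 0 ≤ ∑ b, v b * |M.Y b.1 b.2 0 ω| := Finset.sum_nonneg fun b _ =>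
        mul_nonneg (M.startWeight_nonneg T i j u b) (abs_nonneg _)
      have h5 : ∑ b, v b * |M.Y b.1 b.2 0 ω| ≤ √y' * √T := by linarith
      calc (∑ b, v b * |M.Y b.1 b.2 0 ω|) ^ 2 ≤ (√y' * √T) ^ 2 := by gcongr
        _ = y' * T := by rw [mul_pow, Real.sq_sqrt hy'0.le, Real.sq_sqrt hTp.le]
    have hW : ∑ k ∈ Finset.range T, (M.covPart i j u k ω + M.noisePart i j u k ω) ^ 2
        = l2 (A (Vec ω)) ^ 2
          + 2 * ∑ k ∈ Finset.range T, M.covPart i j u k ω * M.noisePart i j u k ω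
          + ∑ k ∈ Finset.range T, M.noisePart i j u k ω ^ 2 := by
      rw [hl2, Finset.mul_sum, ← Finset.sum_add_distrib, ← Finset.sum_add_distrib]
      exact Finset.sum_congr rfl fun k _ => by ring
    simp_rw [hl2] at h2
    refine energy_deviation_lt (ρ := ρ)
      (R := ∑ k ∈ Finset.range T, M.startPart i j u k ω ^ 2) hT1 hy0 hz hQ0.le hδ ht hW ?_ ?_
      heU0 heE0 hqQ ?_ ?_ h2
      hE hX
    · simp only [hm.regForm_decomp i j u _ ω]
      exact sum_abs_add_sq_sub_sq_le hδ0 _ _ _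
    · rw [← hpe]
      refine hqZ.trans ?_
      gcongr
    · rw [hT0, div_le_iff₀ hy0] at hTT
      linarith
    · calc _ ≤ (1 + 1 / δ) * (y' * T) := by gcongr
        _ = y * T := by rw [hy']; field_simp
  have hexp : ∀ {β s : ℝ}, b ≤ β → √(T : ℝ) ≤ s → Real.exp (-(β * s)) ≤ Real.exp (-(b * √T)) := by
    intro β s h1 h2
    refine Real.exp_le_exp.2 (neg_le_neg ?_)
    exact mul_le_mul h1 h2 (by positivity) (hb0.le.trans h1)
  have hP1 : μ {ω | 2 * (√y' / 2 * √T) ≤ ∑ b, v b * |M.Y b.1 b.2 0 ω|}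
      ≤ ENNReal.ofReal (3 * Real.exp (9 * k0 ^ 2 / 2) * Real.exp (-(b * √T))) := by
    refine (ha.weighted_Y_tail hm hc hK hS0 hcoef hk1 hk2 hκκ hκ0.le hκ1
      (M.startWeight_nonneg T i j u) hV0 hvs (by positivity)).trans ?_
    refine ENNReal.ofReal_le_ofReal ?_
    have := hexp hbb1 (le_refl √(T : ℝ))
    rw [mul_comm]
    refine mul_le_mul_of_nonneg_left ?_ (by positivity)
    refine le_trans (le_of_eq ?_) this
    rw [hb1]
    congr 1; ring
  have hP2 : μ {ω | t * √T ≤ |l2 (A (Vec ω)) - √(∫ ω', l2 (A (Vec ω')) ^ 2 ∂μ)|}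
      ≤ ENNReal.ofReal (60 * Real.exp (-(b * √T))) := by
    refine ((hconc.l2_map_sqrt A hVm hK hL0 hAL).2 _ (by positivity)).trans ?_
    refine ENNReal.ofReal_le_ofReal ?_
    have := hexp hbb2 hsTT
    refine mul_le_mul_of_nonneg_left ?_ (by norm_num)
    refine le_trans (le_of_eq ?_) this
    congr 1
    rw [hb2, mul_pow, Real.sq_sqrt hTp.le]
    ring
  have hP3 : μ {ω | z * T ≤ |∑ k ∈ Finset.range T, noiseFilter M.noise (M.lagCoef i j u) k ω ^ 2
            - ∫ ω', ∑ k ∈ Finset.range T, noiseFilter M.noise (M.lagCoef i j u) k ω' ^ 2 ∂μ|}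
      ≤ ENNReal.ofReal (2 * Real.exp (-(b * √T))) := by
    refine (hA3 (ha.isNoise hm) _ hl T).trans (ENNReal.ofReal_le_ofReal ?_)
    exact mul_le_mul_of_nonneg_left (hexp hbb3 hsTT) (by norm_num)
  have hP4 : μ {ω | z * T ≤ |∑ k : Fin T, A (Vec ω) k * M.noisePart i j u k ω|
            ∧ ∑ k : Fin T, M.noisePart i j u k ω ^ 2 ≤ (Q + z) * T}
      ≤ ENNReal.ofReal (2 * Real.exp (-(b * √T))) := by
    refine (hconc.cross A hVm (ha.integral_projected hc _ _ _) hL0 hAL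
      (measurable_pi_lambda _ fun k => hm.measurable_noisePart i j u k)
      (ha.indepFun_projected _ _ _ i j u) (by positivity) (by positivity)).trans ?_
    refine ENNReal.ofReal_le_ofReal (mul_le_mul_of_nonneg_left ?_ (by norm_num))
    refine le_trans (le_of_eq ?_) (hexp hbb4 hsTT)
    congr 1
    rw [hb4]
    field_simp
  have he0 := Real.exp_pos (-(b * √(T : ℝ)))
  refine (measure_mono hsub).trans ((measure_union_le _ _).trans ?_)
  refine (add_le_add ((measure_union_le _ _).trans (add_le_add ((measure_union_le _ _).trans
    (add_le_add hP1 hP2)) hP3)) hP4).trans ?_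
  rw [← ENNReal.ofReal_add (by positivity) (by positivity),
    ← ENNReal.ofReal_add (by positivity) (by positivity),
    ← ENNReal.ofReal_add (by positivity) (by positivity)]
  refine ENNReal.ofReal_le_ofReal ?_
  rw [hC1]
  have := mul_pos (Real.exp_pos (b * √T0)) he0
  linarith

end Panel

end

/-! ### The good event, uniform over cells and directions. -/

section

lemma l2_le_one {d : Type} [Fintype d] {x : d → ℝ} : l2 x ≤ 1 ↔ ∑ a, x a ^ 2 ≤ 1 := by
  unfold l2
  rw [Real.sqrt_le_left (by norm_num), one_pow]

/-- A finite set of test vectors that controls symmetric quadratic forms. -/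
lemma exists_quadratic_net (d : Type) [Fintype d] :
    ∃ S : Finset (d → ℝ), S.card ≤ 2 * 25 ^ Fintype.card d ∧ (∀ x ∈ S, ∑ a, x a ^ 2 ≤ 1) ∧
      ∀ B : LinearMap.BilinForm ℝ (d → ℝ), (∀ x y, B x y = B y x) → ∀ b : ℝ,
        (∀ x ∈ S, |B x x| ≤ b) → ∀ u, |B u u| ≤ 8 * b * ∑ a, u a ^ 2 := by
  classical
  obtain ⟨S, hcard, hS1, hnorm⟩ := exists_norming_net d
  -- Half sums and half differences of a norming net, so that polarisation recovers `B x y` on net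
  -- pairs.
  refine ⟨(S ×ˢ S).image (fun p => (1 / 2 : ℝ) • (p.1 + p.2))
    ∪ (S ×ˢ S).image (fun p => (1 / 2 : ℝ) • (p.1 - p.2)), ?_, ?_, ?_⟩
  · have h1 : (S ×ˢ S).card ≤ 25 ^ Fintype.card d := by
      rw [Finset.card_product]
      calc S.card * S.card ≤ 5 ^ Fintype.card d * 5 ^ Fintype.card d := Nat.mul_le_mul hcard hcard
        _ = 25 ^ Fintype.card d := by rw [← mul_pow]; norm_num
    refine (Finset.card_union_le _ _).trans ?_
    rw [two_mul]
    exact add_le_add (Finset.card_image_le.trans h1) (Finset.card_image_le.trans h1)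
  · have key : ∀ x ∈ S, ∀ y ∈ S, ∀ z : d → ℝ, (∀ a, z a ^ 2 ≤ (x a ^ 2 + y a ^ 2) / 2) →
        ∑ a, z a ^ 2 ≤ 1 := by
      intro x hx y hy z hz
      have h1 := l2_le_one.1 (hS1 x hx)
      have h2 := l2_le_one.1 (hS1 y hy)
      calc ∑ a, z a ^ 2 ≤ ∑ a, (x a ^ 2 + y a ^ 2) / 2 := Finset.sum_le_sum fun a _ => hz a
        _ = (∑ a, x a ^ 2 + ∑ a, y a ^ 2) / 2 := by
            rw [← Finset.sum_div, Finset.sum_add_distrib]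
        _ ≤ 1 := by linarith
    intro z hz
    simp only [Finset.mem_union, Finset.mem_image, Finset.mem_product, Prod.exists] at hz
    rcases hz with ⟨x, y, ⟨hx, hy⟩, rfl⟩ | ⟨x, y, ⟨hx, hy⟩, rfl⟩
    · refine key x hx y hy _ fun a => ?_
      simp only [Pi.smul_apply, Pi.add_apply, smul_eq_mul]
      nlinarith [sq_nonneg (x a - y a)]
    · refine key x hx y hy _ fun a => ?_
      simp only [Pi.smul_apply, Pi.sub_apply, smul_eq_mul]
      nlinarith [sq_nonneg (x a + y a)]
  · intro B hB b hb u
    have h1 : ∀ x ∈ S, ∀ y ∈ S, |B x y| ≤ 2 * b := by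
      intro x hx y hy
      have e : B x y = B ((1 / 2 : ℝ) • (x + y)) ((1 / 2 : ℝ) • (x + y))
          - B ((1 / 2 : ℝ) • (x - y)) ((1 / 2 : ℝ) • (x - y)) := by
        simp only [map_smul, map_add, map_sub, LinearMap.smul_apply, LinearMap.add_apply,
          LinearMap.sub_apply, smul_eq_mul, hB y x]
        ring
      rw [e]
      have h2 := hb ((1 / 2 : ℝ) • (x + y)) (Finset.mem_union_left _
        (Finset.mem_image.2 ⟨(x, y), Finset.mem_product.2 ⟨hx, hy⟩, rfl⟩))
      have h3 := hb ((1 / 2 : ℝ) • (x - y)) (Finset.mem_union_right _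
        (Finset.mem_image.2 ⟨(x, y), Finset.mem_product.2 ⟨hx, hy⟩, rfl⟩))
      exact (abs_sub _ _).trans (by linarith)
    have h2 : ∀ x ∈ S, |B x u| ≤ 2 * (2 * b) * l2 u := fun x hx => hnorm (B x) _ (h1 x hx) u
    -- The norming property is used once in each argument: `2 · 2 · 2b = 8b`.
    have h3 : |B u u| ≤ 2 * (2 * (2 * b) * l2 u) * l2 u := by
      refine hnorm (B.flip u) _ (fun x hx => ?_) u
      exact h2 x hx
    refine h3.trans (le_of_eq ?_)
    rw [← l2_sq]
    ring

namespace Panel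

section

variable {Ω : Type*} {N1 N2 p1 p2 G0 H0 G H : ℕ}
variable [mΩ : MeasurableSpace Ω]

/-- The sample second moments and the sample noise moments are close to their means, uniformly
over cells and directions. -/
def Good (M : Panel Ω N1 N2 p1 p2 G0 H0) (μ : Measure Ω) (T : ℕ) (ε e : ℝ) (ω : Ω) : Prop :=
  ∀ (i : Fin N1) (j : Fin N2) (u : RegIdx p1 p2 → ℝ),
    |∑ k ∈ Finset.range T, M.regForm i j u ((k : ℤ) + 1) ω ^ 2 - T * M.quad μ i j u|
        ≤ ε * T * ∑ a, u a ^ 2 ∧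
      |∑ k ∈ Finset.range T, M.eps i j ((k : ℤ) + 1) ω * M.regForm i j u ((k : ℤ) + 1) ω|
        ≤ e * T * l2 u

/-- Centred sample second moment form. -/
def centredForm (M : Panel Ω N1 N2 p1 p2 G0 H0) (μ : Measure Ω) (T : ℕ) (i : Fin N1) (j : Fin N2)
    (ω : Ω) : LinearMap.BilinForm ℝ (RegIdx p1 p2 → ℝ) :=
  Matrix.toBilin' <| Matrix.of fun a b => ∑ k ∈ Finset.range T,
    M.reg i j ((k : ℤ) + 1) ω a * M.reg i j ((k : ℤ) + 1) ω b - T * M.secondMoment μ i j 0 a b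

lemma centredForm_comm (M : Panel Ω N1 N2 p1 p2 G0 H0) (μ : Measure Ω) (T : ℕ) (i : Fin N1)
    (j : Fin N2) (ω : Ω) (x y : RegIdx p1 p2 → ℝ) :
    M.centredForm μ T i j ω x y = M.centredForm μ T i j ω y x := by
  simp only [centredForm, Matrix.toBilin'_apply, Matrix.of_apply]
  rw [Finset.sum_comm]
  refine Finset.sum_congr rfl fun a _ => Finset.sum_congr rfl fun b _ => ?_
  have h1 : M.secondMoment μ i j 0 b a = M.secondMoment μ i j 0 a b := by
    simp [secondMoment, mul_comm]
  have h2 : ∀ k : ℕ, M.reg i j ((k : ℤ) + 1) ω b * M.reg i j ((k : ℤ) + 1) ω a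
      = M.reg i j ((k : ℤ) + 1) ω a * M.reg i j ((k : ℤ) + 1) ω b := fun k => mul_comm _ _
  simp_rw [h1, h2]
  ring

/-- `u ↦ ∑ₜ ε_ijt 𝒳_ijtᵀ u`. -/
def noiseMap (M : Panel Ω N1 N2 p1 p2 G0 H0) (T : ℕ) (i : Fin N1) (j : Fin N2)
    (ω : Ω) : (RegIdx p1 p2 → ℝ) →ₗ[ℝ] ℝ where
  toFun u := ∑ k ∈ Finset.range T, M.eps i j ((k : ℤ) + 1) ω * M.regForm i j u ((k : ℤ) + 1) ω
  map_add' u v := by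
    rw [← Finset.sum_add_distrib]
    refine Finset.sum_congr rfl fun k _ => ?_
    simp only [regForm, Pi.add_apply, mul_add, Finset.sum_add_distrib]
  map_smul' r u := by
    simp only [regForm, Pi.smul_apply, smul_eq_mul, RingHom.id_apply, Finset.mul_sum]
    exact Finset.sum_congr rfl fun k _ => Finset.sum_congr rfl fun a _ => by ring

variable {μ : Measure Ω} [IsProbabilityMeasure μ]
  {M : Panel Ω N1 N2 p1 p2 G0 H0} {T : ℕ} {R τlo τhi σ K c κ cgap cpi : ℝ}

lemma Assumptions.centredForm_self (ha : M.Assumptions μ T R τlo τhi σ K c κ cgap cpi)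
    (hm : M.IsModel μ) (hc : 0 < c) (hK : 0 < K) (i : Fin N1) (j : Fin N2)
    (u : RegIdx p1 p2 → ℝ) (ω : Ω) :
    M.centredForm μ T i j ω u u
      = ∑ k ∈ Finset.range T, M.regForm i j u ((k : ℤ) + 1) ω ^ 2 - T * M.quad μ i j u := by
  have h1 : M.quad μ i j u = ∑ a, ∑ b, u a * M.secondMoment μ i j 0 a b * u b := by
    unfold quad
    simp only [pow_two]
    exact ha.integral_regForm_mul hm hc hK i j u u 0
  have h2 : ∀ k : ℕ, M.regForm i j u ((k : ℤ) + 1) ω ^ 2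
      = ∑ a, ∑ b, u a * (M.reg i j ((k : ℤ) + 1) ω a * M.reg i j ((k : ℤ) + 1) ω b) * u b := by
    intro k
    rw [pow_two, regForm, Finset.sum_mul_sum]
    exact Finset.sum_congr rfl fun a _ => Finset.sum_congr rfl fun b _ => by ring
  simp_rw [h1, h2]
  rw [Finset.sum_comm, Finset.mul_sum, ← Finset.sum_sub_distrib]
  simp only [centredForm, Matrix.toBilin'_apply, Matrix.of_apply]
  refine Finset.sum_congr rfl fun a _ => ?_
  rw [Finset.sum_comm, Finset.mul_sum, ← Finset.sum_sub_distrib]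
  refine Finset.sum_congr rfl fun b _ => ?_
  rw [mul_sub, sub_mul, Finset.mul_sum, Finset.sum_mul]
  ring

end

/-- A union bound over the `N1 N2` cells and two nets of size exponential in `m`. The energy is
needed only at fixed precision, the noise at precision of order `√A`, which produces the factor `A`
in its exponent. -/
lemma exists_good_tail {τlo τhi σ K c κ ε ε' Amax : ℝ} (hτlo : 0 < τlo) (hτhi : 0 < τhi)
    (hσ : 0 < σ) (hK : 0 < K) (hc : 0 < c) (hκ : κ < 1) (hε : 0 < ε) (hε' : 0 < ε')
    (hA : 0 < Amax) :
    ∃ c1 : ℝ, 0 < c1 ∧ ∃ c2 : ℝ, 0 < c2 ∧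
    ∀ {Ω : Type*} [MeasurableSpace Ω] {μ : Measure Ω} [IsProbabilityMeasure μ]
      {N1 N2 p1 p2 G0 H0 T : ℕ} {M : Panel Ω N1 N2 p1 p2 G0 H0} {R cgap cpi : ℝ},
      M.IsModel μ → M.Assumptions μ T R τlo τhi σ K c κ cgap cpi → 0 < T →
      ∀ A : ℝ, 0 < A → A ≤ Amax →
      μ {ω | ¬ M.Good μ T ε (ε' * √A) ω}
        ≤ ENNReal.ofReal ((N1 : ℝ) * N2
            * Real.exp (-(c1 * √T * A) + c2 * ((p1 : ℝ) + p2 + 3))) := by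
  obtain ⟨C, hC, b, hb, htail⟩ := exists_quad_tail hτlo hτhi hσ hK hc hκ
    (show 0 < ε / 8 by positivity)
  -- The exponent of `noise_tail` per unit of `A T`, at level `e T / 2` and energy `(τhi + ε) T`.
  set b' : ℝ := ε' ^ 2 / (8 * σ ^ 2 * (τhi + ε)) with hb'
  have hb'0 : 0 < b' := by positivity
  have hC3 : 1 < 25 * (2 * C + 3) := by linarith
  -- With `A ≤ Amax`, the quotient `b / Amax` turns the rate `b √T` into at least `c1 √T A`. The
  -- logarithm absorbs net sizes and prefactors, through `25^m (2C + 2) ≤ (25 (2C + 3))^m`.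
  refine ⟨min b' (b / Amax), by positivity, Real.log (25 * (2 * C + 3)), Real.log_pos hC3, ?_⟩
  intro Ω _ μ _ N1 N2 p1 p2 G0 H0 T M R cgap cpi hm ha hT A hA0 hAm
  have hT1 : (1 : ℝ) ≤ T := by exact_mod_cast hT
  have hTp : (0 : ℝ) < T := by linarith
  have hsT1 : 1 ≤ √(T : ℝ) := Real.one_le_sqrt.2 hT1
  have hsT : √(T : ℝ) * √(T : ℝ) = T := Real.mul_self_sqrt hTp.le
  have hsTT : √(T : ℝ) ≤ T := (le_mul_of_one_le_right (by positivity) hsT1).trans_eq hsT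
  set c1 := min b' (b / Amax) with hc1
  have hc1p : 0 < c1 := by positivity
  set m : ℕ := p1 + p2 + 3 with hmdef
  have hcard : Fintype.card (RegIdx p1 p2) = m := by
    simp only [RegIdx, Fintype.card_sum, Fintype.card_unit, Fintype.card_fin]
    omega
  obtain ⟨S1, hS1c, hS1u, hS1⟩ := exists_quadratic_net (RegIdx p1 p2)
  obtain ⟨S2, hS2c, hS2u, hS2⟩ := exists_norming_net (RegIdx p1 p2)
  rw [hcard] at hS1c hS2c
  set E1 : Fin N1 → Fin N2 → (RegIdx p1 p2 → ℝ) → Set Ω := fun i j u =>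
    {ω | ε / 8 * T ≤ |∑ k ∈ Finset.range T, M.regForm i j u ((k : ℤ) + 1) ω ^ 2
        - T * M.quad μ i j u|} with hE1
  set e : ℝ := ε' * √A with he
  have he0 : 0 < e := by positivity
  set E2 : Fin N1 → Fin N2 → (RegIdx p1 p2 → ℝ) → Set Ω := fun i j u =>
    {ω | e / 2 * T ≤ |∑ k ∈ Finset.range T, M.eps i j ((k : ℤ) + 1) ω
          * M.regForm i j u ((k : ℤ) + 1) ω|
        ∧ ∑ k ∈ Finset.range T, M.regForm i j u ((k : ℤ) + 1) ω ^ 2 ≤ (τhi + ε) * T} with hE2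
  have hsub : {ω | ¬ M.Good μ T ε e ω}
      ⊆ ⋃ i ∈ (Finset.univ : Finset (Fin N1)), ⋃ j ∈ (Finset.univ : Finset (Fin N2)),
        ((⋃ u ∈ S1, E1 i j u) ∪ ⋃ u ∈ S2, E2 i j u) := by
    intro ω hω
    by_contra hcon
    simp only [Set.mem_iUnion, Set.mem_union, Finset.mem_univ, not_exists, not_or, exists_prop,
      not_and, true_and, hE1, hE2, Set.mem_ofPred_eq, not_le] at hcon
    refine hω fun i j => ?_
    obtain ⟨h1, h2⟩ := hcon i j
    have hq : ∀ u, |∑ k ∈ Finset.range T, M.regForm i j u ((k : ℤ) + 1) ω ^ 2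
        - T * M.quad μ i j u| ≤ ε * T * ∑ a, u a ^ 2 := by
      intro u
      have h3 := hS1 (M.centredForm μ T i j ω) (M.centredForm_comm μ T i j ω) (ε / 8 * T)
        (fun x hx => by
          rw [ha.centredForm_self hm hc hK]
          exact (h1 x hx).le) u
      rw [ha.centredForm_self hm hc hK] at h3
      exact h3.trans (le_of_eq (by ring))
    refine fun u => ⟨hq u, ?_⟩
    -- The energy bound, already known for all directions, supplies the second condition of the
    -- noise event at net points.
    have h4 := hS2 (M.noiseMap T i j ω) (e / 2 * T) (fun x hx => by
      by_contra hc'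
      have h5 := h2 x hx (not_le.1 hc').le
      have h6 := hq x
      have hx1 := l2_le_one.1 (hS2u x hx)
      have h7 : M.quad μ i j x ≤ τhi := by
        refine (ha.quad_bounds hm hc hK i j x).2.trans ?_
        have h0 : 0 ≤ ∑ a, x a ^ 2 := Finset.sum_nonneg fun _ _ => sq_nonneg _
        calc M.tauMax μ * ∑ a, x a ^ 2 ≤ τhi * ∑ a, x a ^ 2 := by gcongr; exact ha.tauMax_le
          _ ≤ τhi := mul_le_of_le_one_right hτhi.le hx1
      have h8 : T * M.quad μ i j x ≤ T * τhi := by gcongr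
      have h9 : ε * T * ∑ a, x a ^ 2 ≤ ε * T := mul_le_of_le_one_right (by positivity) hx1
      linarith [(abs_le.1 h6).2]) u
    exact h4.trans (le_of_eq (by ring))
  have hP1 : ∀ i j, ∀ u ∈ S1, μ (E1 i j u) ≤ ENNReal.ofReal (C * Real.exp (-(c1 * √T * A))) := by
    intro i j u hu
    refine (htail hm ha hT i j u (hS1u u hu)).trans (ENNReal.ofReal_le_ofReal ?_)
    refine mul_le_mul_of_nonneg_left (Real.exp_le_exp.2 (neg_le_neg ?_)) hC.le
    have h1 : c1 * A ≤ b := by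
      calc c1 * A ≤ b / Amax * Amax :=
            mul_le_mul (min_le_right _ _) hAm hA0.le (by positivity)
        _ = b := by field_simp
    calc c1 * √T * A = c1 * A * √T := by ring
      _ ≤ b * √T := by gcongr
  have hP2 : ∀ i j, ∀ u ∈ S2, μ (E2 i j u) ≤ ENNReal.ofReal (2 * Real.exp (-(c1 * √T * A))) := by
    intro i j u hu
    refine (ha.noise_tail hm hσ i j u (x := e / 2 * T) (by positivity)
      (by positivity)).trans (ENNReal.ofReal_le_ofReal ?_)
    refine mul_le_mul_of_nonneg_left (Real.exp_le_exp.2 ?_) (by norm_num)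
    have h1 : -(e / 2 * (T : ℝ)) ^ 2 / (2 * σ ^ 2 * ((τhi + ε) * T)) = -(b' * A * T) := by
      rw [hb', he, mul_pow, div_pow, mul_pow, Real.sq_sqrt hA0.le]
      field_simp
      ring
    rw [h1]
    refine neg_le_neg ?_
    calc c1 * √T * A = c1 * A * √T := by ring
      _ ≤ b' * A * T := by
        have : c1 ≤ b' := min_le_left _ _
        gcongr
  set X := Real.exp (-(c1 * √T * A)) with hX
  have hX0 : 0 < X := Real.exp_pos _
  have hcell : ∀ i j, μ ((⋃ u ∈ S1, E1 i j u) ∪ ⋃ u ∈ S2, E2 i j u)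
      ≤ ENNReal.ofReal (Real.exp (-(c1 * √T * A)
        + Real.log (25 * (2 * C + 3)) * ((p1 : ℝ) + p2 + 3))) := by
    intro i j
    have h1 : μ (⋃ u ∈ S1, E1 i j u) ≤ ENNReal.ofReal (2 * 25 ^ m * (C * X)) := by
      refine (measure_biUnion_finset_le _ _).trans ((Finset.sum_le_sum (hP1 i j)).trans ?_)
      rw [Finset.sum_const, nsmul_eq_mul, ← ENNReal.ofReal_natCast,
        ← ENNReal.ofReal_mul (Nat.cast_nonneg _)]
      refine ENNReal.ofReal_le_ofReal (mul_le_mul_of_nonneg_right ?_ (by positivity))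
      exact_mod_cast hS1c
    have h2 : μ (⋃ u ∈ S2, E2 i j u) ≤ ENNReal.ofReal (25 ^ m * (2 * X)) := by
      refine (measure_biUnion_finset_le _ _).trans ((Finset.sum_le_sum (hP2 i j)).trans ?_)
      rw [Finset.sum_const, nsmul_eq_mul, ← ENNReal.ofReal_natCast,
        ← ENNReal.ofReal_mul (Nat.cast_nonneg _)]
      refine ENNReal.ofReal_le_ofReal (mul_le_mul_of_nonneg_right ?_ (by positivity))
      have h3 : S2.card ≤ 25 ^ m := hS2c.trans (Nat.pow_le_pow_left (by norm_num) m)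
      exact_mod_cast h3
    refine (measure_union_le _ _).trans ((add_le_add h1 h2).trans ?_)
    rw [← ENNReal.ofReal_add (by positivity) (by positivity)]
    refine ENNReal.ofReal_le_ofReal ?_
    rw [Real.exp_add]
    have h4 : Real.exp (Real.log (25 * (2 * C + 3)) * ((p1 : ℝ) + p2 + 3))
        = (25 * (2 * C + 3)) ^ m := by
      have : ((p1 : ℝ) + p2 + 3) = (m : ℝ) := by rw [hmdef]; push_cast; ring
      rw [this, mul_comm, Real.exp_nat_mul, Real.exp_log (by linarith)]
    rw [h4, ← hX, mul_pow]
    have h5 : 2 * C + 2 ≤ (2 * C + 3) ^ m := by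
      have : (2 * C + 3) ^ 1 ≤ (2 * C + 3) ^ m :=
        pow_le_pow_right₀ (by linarith) (by omega)
      linarith
    have h6 : (0 : ℝ) < 25 ^ m * X := by positivity
    calc 2 * 25 ^ m * (C * X) + 25 ^ m * (2 * X) = (25 ^ m * X) * (2 * C + 2) := by ring
      _ ≤ (25 ^ m * X) * (2 * C + 3) ^ m := by gcongr
      _ = _ := by ring
  refine (measure_mono hsub).trans ?_
  refine (measure_biUnion_finset_le _ _).trans ((Finset.sum_le_sum fun i _ =>
    (measure_biUnion_finset_le _ _).trans (Finset.sum_le_sum fun j _ => hcell i j)).trans ?_)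
  rw [Finset.sum_const, Finset.sum_const, Finset.card_univ, Finset.card_univ, Fintype.card_fin,
    Fintype.card_fin, nsmul_eq_mul, nsmul_eq_mul, mul_assoc (N1 : ℝ),
    ENNReal.ofReal_mul (Nat.cast_nonneg _), ENNReal.ofReal_mul (Nat.cast_nonneg _),
    ENNReal.ofReal_natCast, ENNReal.ofReal_natCast]

end Panel

end

/-! ### Discrepancies, group separation and the least squares criterion. -/

section

lemma sum_Icc_int (T : ℕ) (f : ℤ → ℝ) :
    ∑ t ∈ Finset.Icc (1 : ℤ) T, f t = ∑ k ∈ Finset.range T, f ((k : ℤ) + 1) := by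
  symm
  refine Finset.sum_nbij' (fun k => (k : ℤ) + 1) (fun t => (t - 1).toNat) ?_ ?_ ?_ ?_ ?_
  · intro k hk
    simp only [Finset.mem_range, Finset.mem_Icc] at *
    omega
  · intro t ht
    simp only [Finset.mem_range, Finset.mem_Icc] at *
    omega
  · intro k _
    simp
  · intro t ht
    simp only [Finset.mem_Icc] at ht
    omega
  · intro k _
    rfl

lemma sqDist_nonneg {ι : Type} [Fintype ι] (u v : ι → ℝ) : 0 ≤ sqDist u v :=
  Finset.sum_nonneg fun _ _ => sq_nonneg _

namespace Panel

variable {Ω : Type*} {N1 N2 p1 p2 G0 H0 G H : ℕ}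

/-- Mean squared error of the row parameters. -/
def rowDisc (M : Panel Ω N1 N2 p1 p2 G0 H0) (θ : Params p1 p2 G H) (gm : Fin N1 → Fin G) : ℝ :=
  1 / (N1 : ℝ) * ∑ i, sqDist (θ.row (gm i)) (M.par.row (M.g0 i))

lemma rowDisc_nonneg (M : Panel Ω N1 N2 p1 p2 G0 H0) (θ : Params p1 p2 G H)
    (gm : Fin N1 → Fin G) : 0 ≤ M.rowDisc θ gm :=
  mul_nonneg (by positivity) (Finset.sum_nonneg fun _ _ => sqDist_nonneg _ _)

lemma colDisc_nonneg (M : Panel Ω N1 N2 p1 p2 G0 H0) (θ : Params p1 p2 G H)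
    (gm : Fin N1 → Fin G) (h : Fin H) (h0 : Fin H0) : 0 ≤ M.colDisc θ gm h h0 :=
  add_nonneg (sqDist_nonneg _ _)
    (mul_nonneg (by positivity) (Finset.sum_nonneg fun _ _ => sq_nonneg _))

lemma sqDist_coef {G' H' : ℕ} (θ : Params p1 p2 G H) (θ' : Params p1 p2 G' H') (g : Fin G)
    (h : Fin H) (g' : Fin G') (h' : Fin H') :
    sqDist (θ.coef g h) (θ'.coef g' h') = sqDist (θ.row g) (θ'.row g')
      + (sqDist (θ.col h) (θ'.col h') + |θ.alpha g h - θ'.alpha g' h'| ^ 2) := by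
  unfold sqDist Params.coef
  rw [Fintype.sum_sum_type, Fintype.sum_sum_type (α₁ := Unit ⊕ Fin p2)]
  simp only [Sum.elim_inl, Sum.elim_inr, Finset.univ_unique, Finset.sum_singleton, sq_abs]

lemma sum_sqDist_coef (M : Panel Ω N1 N2 p1 p2 G0 H0) (hN1 : 0 < N1) (θ : Params p1 p2 G H)
    (gm : Fin N1 → Fin G) (h : Fin H) (h0 : Fin H0) :
    ∑ i, sqDist (θ.coef (gm i) h) (M.par.coef (M.g0 i) h0)
      = N1 * (M.rowDisc θ gm + M.colDisc θ gm h h0) := by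
  have hN : (0 : ℝ) < N1 := by exact_mod_cast hN1
  simp only [sqDist_coef, Finset.sum_add_distrib, Finset.sum_const, Finset.card_univ,
    Fintype.card_fin, nsmul_eq_mul, rowDisc, colDisc]
  field_simp

/-- The row error is common to all columns; the memberships of columns enter only through the mean
of `colDisc`. -/
lemma pseudoDist_eq (M : Panel Ω N1 N2 p1 p2 G0 H0) (hN1 : 0 < N1) (hN2 : 0 < N2)
    (θ : Params p1 p2 G H) (gm : Fin N1 → Fin G) (hm : Fin N2 → Fin H) :
    M.pseudoDist θ gm hm = M.rowDisc θ gm + 1 / (N2 : ℝ) * ∑ j, M.colDisc θ gm (hm j) (M.h0 j) := by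
  have hN : (0 : ℝ) < N1 := by exact_mod_cast hN1
  have hN' : (0 : ℝ) < N2 := by exact_mod_cast hN2
  unfold pseudoDist
  rw [Finset.sum_comm]
  simp only [sum_sqDist_coef M hN1]
  rw [← Finset.mul_sum, Finset.sum_add_distrib, Finset.sum_const, Finset.card_univ,
    Fintype.card_fin, nsmul_eq_mul]
  field_simp

lemma rowDisc_le_pseudoDist (M : Panel Ω N1 N2 p1 p2 G0 H0) (hN1 : 0 < N1) (hN2 : 0 < N2)
    (θ : Params p1 p2 G H) (gm : Fin N1 → Fin G) (hm : Fin N2 → Fin H) :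
    M.rowDisc θ gm ≤ M.pseudoDist θ gm hm := by
  rw [M.pseudoDist_eq hN1 hN2]
  exact le_add_of_nonneg_right
    (mul_nonneg (by positivity) (Finset.sum_nonneg fun _ _ => M.colDisc_nonneg _ _ _ _))

/-- Squared distance of two true column groups. -/
def trueDisc (M : Panel Ω N1 N2 p1 p2 G0 H0) (h h' : Fin H0) : ℝ := M.colDisc M.par M.g0 h h'

/-- A triangle inequality through the estimated group; the factor `2` is the price of squared
distances. -/
lemma trueDisc_le (M : Panel Ω N1 N2 p1 p2 G0 H0) (θ : Params p1 p2 G H)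
    (gm : Fin N1 → Fin G) (h : Fin H) (h0 h0' : Fin H0) :
    M.trueDisc h0 h0' ≤ 2 * (M.colDisc θ gm h h0 + M.colDisc θ gm h h0') := by
  unfold trueDisc colDisc sqDist
  have h1 : ∑ a, (M.par.col h0 a - M.par.col h0' a) ^ 2
      ≤ 2 * (∑ a, (θ.col h a - M.par.col h0 a) ^ 2 + ∑ a, (θ.col h a - M.par.col h0' a) ^ 2) := by
    rw [← Finset.sum_add_distrib, Finset.mul_sum]
    refine Finset.sum_le_sum fun a _ => ?_
    nlinarith [sq_nonneg ((θ.col h a - M.par.col h0 a) + (θ.col h a - M.par.col h0' a))]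
  have h2 : ∑ i, |M.par.alpha (M.g0 i) h0 - M.par.alpha (M.g0 i) h0'| ^ 2
      ≤ 2 * (∑ i, |θ.alpha (gm i) h - M.par.alpha (M.g0 i) h0| ^ 2
        + ∑ i, |θ.alpha (gm i) h - M.par.alpha (M.g0 i) h0'| ^ 2) := by
    rw [← Finset.sum_add_distrib, Finset.mul_sum]
    refine Finset.sum_le_sum fun i _ => ?_
    simp only [sq_abs]
    nlinarith [sq_nonneg ((θ.alpha (gm i) h - M.par.alpha (M.g0 i) h0)
      + (θ.alpha (gm i) h - M.par.alpha (M.g0 i) h0'))]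
  have h3 := mul_le_mul_of_nonneg_left h2 (show (0 : ℝ) ≤ 1 / N1 by positivity)
  linarith

/-- The neighbourhood in terms of its two covering conditions. -/
lemma mem_nbhd_iff [Nonempty (Fin H)] [Nonempty (Fin H0)] (M : Panel Ω N1 N2 p1 p2 G0 H0)
    (θ : Params p1 p2 G H) (gm : Fin N1 → Fin G) (η : ℝ) :
    θ ∈ M.nbhd gm η ↔ (∀ h0, ∃ h, M.colDisc θ gm h h0 < η) ∧
      ∀ h, ∃ h0, M.colDisc θ gm h h0 < η := by
  have hfin : ∀ {a : ℕ} [Nonempty (Fin a)] (f : Fin a → ℝ), (⨆ x, f x) < η ↔ ∀ x, f x < η := by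
    intro a _ f
    constructor
    · exact fun h x => (le_ciSup (Set.finite_range f).bddAbove x).trans_lt h
    · intro h
      obtain ⟨x, hx⟩ := exists_eq_ciSup_of_finite (f := f)
      rw [← hx]
      exact h x
  have hinf : ∀ {a : ℕ} [Nonempty (Fin a)] (f : Fin a → ℝ), (⨅ x, f x) < η ↔ ∃ x, f x < η := by
    intro a _ f
    exact ⟨exists_lt_of_ciInf_lt,
      fun ⟨x, hx⟩ => (ciInf_le (Set.finite_range f).bddBelow x).trans_lt hx⟩
  change M.hausdorff θ gm < η ↔ _
  unfold hausdorff
  rw [max_lt_iff, hfin, hfin]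
  simp only [hinf]

variable [mΩ : MeasurableSpace Ω] {μ : Measure Ω} [IsProbabilityMeasure μ]
  {M : Panel Ω N1 N2 p1 p2 G0 H0} {T : ℕ} {R τlo τhi σ K c κ cgap cpi : ℝ}

lemma Assumptions.cpi_le_one (ha : M.Assumptions μ T R τlo τhi σ K c κ cgap cpi) (hN1 : 0 < N1) :
    cpi ≤ 1 := by
  refine (ha.prop_row (M.g0 ⟨0, hN1⟩)).trans ?_
  rw [div_le_one (by exact_mod_cast hN1)]
  exact_mod_cast (Finset.card_le_univ _).trans_eq (Fintype.card_fin _)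

lemma Assumptions.exists_col (ha : M.Assumptions μ T R τlo τhi σ K c κ cgap cpi) (h : Fin H0) :
    ∃ j, M.h0 j = h := by
  by_contra! hcon
  have h1 := ha.prop_col h
  rw [Finset.filter_false_of_mem fun j _ => hcon j] at h1
  simp at h1
  linarith [ha.cpi_pos]

/-- The row group attaining the maximal difference of `α⁰` fills at least a share `cpi` of the rows,
so averaging over rows loses at most this factor. -/
lemma Assumptions.gap_le_trueDisc (ha : M.Assumptions μ T R τlo τhi σ K c κ cgap cpi)
    (hN1 : 0 < N1) {h h' : Fin H0} (hne : h ≠ h') : cgap * cpi ≤ M.trueDisc h h' := by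
  have hN : (0 : ℝ) < N1 := by exact_mod_cast hN1
  have : Nonempty (Fin G0) := ⟨M.g0 ⟨0, hN1⟩⟩
  have h1 := ha.gap_col h h' hne
  obtain ⟨g, hg⟩ := exists_eq_ciSup_of_finite
    (f := fun g => |M.par.alpha g h - M.par.alpha g h'| ^ 2)
  rw [← hg] at h1
  have h2 : cpi * |M.par.alpha g h - M.par.alpha g h'| ^ 2
      ≤ 1 / (N1 : ℝ) * ∑ i, |M.par.alpha (M.g0 i) h - M.par.alpha (M.g0 i) h'| ^ 2 := by
    calc cpi * |M.par.alpha g h - M.par.alpha g h'| ^ 2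
        ≤ ((Finset.univ.filter fun i => M.g0 i = g).card : ℝ) / N1
            * |M.par.alpha g h - M.par.alpha g h'| ^ 2 := by
          gcongr; exact ha.prop_row g
      _ = 1 / (N1 : ℝ) * ∑ i ∈ Finset.univ.filter fun i => M.g0 i = g,
            |M.par.alpha (M.g0 i) h - M.par.alpha (M.g0 i) h'| ^ 2 := by
          rw [Finset.sum_congr rfl (g := fun _ => |M.par.alpha g h - M.par.alpha g h'| ^ 2)
            fun i hi => by rw [(Finset.mem_filter.1 hi).2]]
          rw [Finset.sum_const, nsmul_eq_mul]
          ring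
      _ ≤ _ := by
          refine mul_le_mul_of_nonneg_left ?_ (by positivity)
          exact Finset.sum_le_sum_of_subset_of_nonneg (Finset.filter_subset _ _)
            fun _ _ _ => sq_nonneg _
  have h3 : cpi * sqDist (M.par.col h) (M.par.col h') ≤ sqDist (M.par.col h) (M.par.col h') :=
    mul_le_of_le_one_left (sqDist_nonneg _ _) (ha.cpi_le_one hN1)
  have h4 := mul_le_mul_of_nonneg_left h1 ha.cpi_pos.le
  unfold trueDisc colDisc
  linarith

/-- Both groups are occupied, so both coefficient vectors obey `coef0_sq_le`. With two column groups
this bounds `cgap * cpi` by model constants alone. -/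
lemma Assumptions.trueDisc_le_const (ha : M.Assumptions μ T R τlo τhi σ K c κ cgap cpi)
    (hm : M.IsModel μ) (hc : 0 < c) (hK : 0 < K) (hτlo : 0 < τlo) (hN1 : 0 < N1) (h h' : Fin H0) :
    M.trueDisc h h' ≤ 4 * (τhi / τlo) := by
  have hN : (0 : ℝ) < N1 := by exact_mod_cast hN1
  obtain ⟨j, rfl⟩ := ha.exists_col h
  obtain ⟨j', rfl⟩ := ha.exists_col h'
  have h1 := M.sum_sqDist_coef hN1 M.par M.g0 (M.h0 j) (M.h0 j')
  have h2 : ∑ i, sqDist (M.par.coef (M.g0 i) (M.h0 j)) (M.par.coef (M.g0 i) (M.h0 j'))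
      ≤ N1 * (4 * (τhi / τlo)) := by
    calc _ ≤ ∑ _i : Fin N1, 4 * (τhi / τlo) := by
          refine Finset.sum_le_sum fun i _ => ?_
          have h3 := ha.coef0_sq_le hm hc hK hτlo i j
          have h4 := ha.coef0_sq_le hm hc hK hτlo i j'
          have h5 : sqDist (M.par.coef (M.g0 i) (M.h0 j)) (M.par.coef (M.g0 i) (M.h0 j'))
              ≤ 2 * (∑ a, M.coef0 i j a ^ 2 + ∑ a, M.coef0 i j' a ^ 2) := by
            unfold sqDist coef0
            rw [← Finset.sum_add_distrib, Finset.mul_sum]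
            refine Finset.sum_le_sum fun a _ => ?_
            nlinarith [sq_nonneg (M.par.coef (M.g0 i) (M.h0 j) a
              + M.par.coef (M.g0 i) (M.h0 j') a)]
          linarith
      _ = _ := by rw [Finset.sum_const, Finset.card_univ, Fintype.card_fin, nsmul_eq_mul]
  rw [h1] at h2
  have h6 := le_of_mul_le_mul_left h2 hN
  have h7 := M.rowDisc_nonneg M.par M.g0
  unfold trueDisc
  linarith

/-- The residual is `ε - 𝒳ᵀ(Θ - Θ⁰)`; its square is expanded. -/
lemma IsModel.colLoss_eq (hm : M.IsModel μ) (θ : Params p1 p2 G H) (gm : Fin N1 → Fin G) (ω : Ω)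
    (j : Fin N2) (h : Fin H) :
    M.colLoss T θ gm ω j h
      = ∑ i, (∑ k ∈ Finset.range T, M.eps i j ((k : ℤ) + 1) ω ^ 2
        - 2 * ∑ k ∈ Finset.range T, M.eps i j ((k : ℤ) + 1) ω
          * M.regForm i j (fun a => θ.coef (gm i) h a - M.coef0 i j a) ((k : ℤ) + 1) ω
        + ∑ k ∈ Finset.range T,
          M.regForm i j (fun a => θ.coef (gm i) h a - M.coef0 i j a) ((k : ℤ) + 1) ω ^ 2) := by
  unfold colLoss
  refine Finset.sum_congr rfl fun i _ => ?_
  rw [sum_Icc_int, Finset.mul_sum, ← Finset.sum_sub_distrib, ← Finset.sum_add_distrib]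
  refine Finset.sum_congr rfl fun k _ => ?_
  have h1 : M.regForm i j (fun a => θ.coef (gm i) h a - M.coef0 i j a) ((k : ℤ) + 1) ω
      = ∑ a, M.reg i j ((k : ℤ) + 1) ω a * θ.coef (gm i) h a
        - M.regForm i j (M.coef0 i j) ((k : ℤ) + 1) ω := by
    simp only [regForm, mul_sub, Finset.sum_sub_distrib]
  rw [h1, hm.Y_eq]
  ring

/-- Two-sided bound of the least squares criterion on the good event. -/
lemma Assumptions.colLoss_bounds (ha : M.Assumptions μ T R τlo τhi σ K c κ cgap cpi)
    (hm : M.IsModel μ) (hc : 0 < c) (hK : 0 < K) (hN1 : 0 < N1) {ε ε' A : ℝ} (hε' : 0 ≤ ε')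
    (hA : 0 ≤ A) {ω : Ω} (hg : M.Good μ T ε (ε' * √A) ω) (θ : Params p1 p2 G H)
    (gm : Fin N1 → Fin G) (j : Fin N2) (h : Fin H) :
    T * (N1 * ((M.tauMin μ - ε - ε') * (M.rowDisc θ gm + M.colDisc θ gm h (M.h0 j)) - ε' * A))
        ≤ M.colLoss T θ gm ω j h - ∑ i, ∑ k ∈ Finset.range T, M.eps i j ((k : ℤ) + 1) ω ^ 2 ∧
      M.colLoss T θ gm ω j h - ∑ i, ∑ k ∈ Finset.range T, M.eps i j ((k : ℤ) + 1) ω ^ 2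
        ≤ T * (N1 * ((M.tauMax μ + ε + ε') * (M.rowDisc θ gm + M.colDisc θ gm h (M.h0 j))
          + ε' * A)) := by
  set u : Fin N1 → RegIdx p1 p2 → ℝ := fun i a => θ.coef (gm i) h a - M.coef0 i j a with hu
  have hsum : ∑ i, ∑ a, u i a ^ 2 = N1 * (M.rowDisc θ gm + M.colDisc θ gm h (M.h0 j)) :=
    M.sum_sqDist_coef hN1 θ gm h (M.h0 j)
  rw [hm.colLoss_eq, ← Finset.sum_sub_distrib]
  have hT : (0 : ℝ) ≤ T := Nat.cast_nonneg T
  have hcross : ∀ i, 2 * |∑ k ∈ Finset.range T, M.eps i j ((k : ℤ) + 1) ω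
          * M.regForm i j (u i) ((k : ℤ) + 1) ω| ≤ T * (ε' * (A + ∑ a, u i a ^ 2)) := by
    intro i
    have h1 := (hg i j (u i)).2
    -- Young's inequality trades the noise term for a small multiple of the squared error and of
    -- `A`.
    have h2 : 2 * (√A * l2 (u i)) ≤ A + ∑ a, u i a ^ 2 := by
      rw [← l2_sq]
      nlinarith [sq_nonneg (√A - l2 (u i)), Real.sq_sqrt hA]
    have h3 := mul_le_mul_of_nonneg_left (mul_le_mul_of_nonneg_left h2 hε') hT
    linarith
  constructor
  · calc _ = ∑ i, T * ((M.tauMin μ - ε - ε') * ∑ a, u i a ^ 2 - ε' * A) := by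
          rw [← Finset.mul_sum, Finset.sum_sub_distrib, ← Finset.mul_sum, hsum, Finset.sum_const,
            Finset.card_univ, Fintype.card_fin, nsmul_eq_mul]
          ring
      _ ≤ _ := by
          refine Finset.sum_le_sum fun i _ => ?_
          have h1 := (abs_le.1 (hg i j (u i)).1).1
          have h2 := mul_le_mul_of_nonneg_left (ha.quad_bounds hm hc hK i j (u i)).1 hT
          have h4 := hcross i
          have h5 := le_abs_self (∑ k ∈ Finset.range T, M.eps i j ((k : ℤ) + 1) ω
              * M.regForm i j (u i) ((k : ℤ) + 1) ω)
          linarith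
  · calc _ ≤ ∑ i, T * ((M.tauMax μ + ε + ε') * ∑ a, u i a ^ 2 + ε' * A) := by
          refine Finset.sum_le_sum fun i _ => ?_
          have h1 := (abs_le.1 (hg i j (u i)).1).2
          have h2 := mul_le_mul_of_nonneg_left (ha.quad_bounds hm hc hK i j (u i)).2 hT
          have h4 := hcross i
          have h5 := neg_abs_le (∑ k ∈ Finset.range T, M.eps i j ((k : ℤ) + 1) ω
              * M.regForm i j (u i) ((k : ℤ) + 1) ω)
          linarith
      _ = _ := by
          rw [← Finset.mul_sum, Finset.sum_add_distrib, ← Finset.mul_sum, hsum, Finset.sum_const,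
            Finset.card_univ, Fintype.card_fin, nsmul_eq_mul]
          ring

/-- On the good event a label with a smaller criterion is not much worse. -/
lemma Assumptions.colDisc_le_of_colLoss_le
    (ha : M.Assumptions μ T R τlo τhi σ K c κ cgap cpi)
    (hm : M.IsModel μ) (hc : 0 < c) (hK : 0 < K) (hN1 : 0 < N1) (hT : 0 < T) {ε ε' A : ℝ}
    (hε' : 0 ≤ ε') (hA : 0 ≤ A) {ω : Ω} (hg : M.Good μ T ε (ε' * √A) ω) (θ : Params p1 p2 G H)
    (gm : Fin N1 → Fin G) (j : Fin N2) {h h' : Fin H}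
    (hl : M.colLoss T θ gm ω j h ≤ M.colLoss T θ gm ω j h') :
    (M.tauMin μ - ε - ε') * (M.rowDisc θ gm + M.colDisc θ gm h (M.h0 j))
      ≤ (M.tauMax μ + ε + ε') * (M.rowDisc θ gm + M.colDisc θ gm h' (M.h0 j))
        + 2 * ε' * A := by
  have hN : (0 : ℝ) < N1 := by exact_mod_cast hN1
  have hTp : (0 : ℝ) < T := by exact_mod_cast hT
  have h1 := (ha.colLoss_bounds hm hc hK hN1 hε' hA hg θ gm j h).1
  have h2 := (ha.colLoss_bounds hm hc hK hN1 hε' hA hg θ gm j h').2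
  have h3 := le_of_mul_le_mul_left (le_of_mul_le_mul_left
    (h1.trans ((sub_le_sub_right hl _).trans h2)) hTp) hN
  linarith

end Panel

end

/-! ### Consequences on the good event. -/

section

namespace Panel

variable {Ω : Type*} {N1 N2 p1 p2 G0 H0 G H : ℕ}
variable [mΩ : MeasurableSpace Ω] {μ : Measure Ω} [IsProbabilityMeasure μ]
  {M : Panel Ω N1 N2 p1 p2 G0 H0} {T : ℕ} {R τlo τhi σ K c κ cgap cpi : ℝ}

lemma Assumptions.gap_le_colDisc (ha : M.Assumptions μ T R τlo τhi σ K c κ cgap cpi)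
    (hN1 : 0 < N1) (θ : Params p1 p2 G H) (gm : Fin N1 → Fin G) (h : Fin H) {h0 h0' : Fin H0}
    (hne : h0 ≠ h0') : cgap * cpi ≤ 2 * (M.colDisc θ gm h h0 + M.colDisc θ gm h h0') :=
  (ha.gap_le_trueDisc hN1 hne).trans (M.trueDisc_le θ gm h h0 h0')

lemma Assumptions.tauMin_le_tauMax (ha : M.Assumptions μ T R τlo τhi σ K c κ cgap cpi)
    (hm : M.IsModel μ) (hc : 0 < c) (hK : 0 < K) (hN1 : 0 < N1) (hN2 : 0 < N2) :
    M.tauMin μ ≤ M.tauMax μ := by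
  set u : RegIdx p1 p2 → ℝ := fun a => if a = .inr (.inr ()) then 1 else 0 with hu
  have h3 : ∑ a, u a ^ 2 = 1 := by simp only [hu, ite_pow]; simp
  obtain ⟨h1, h2⟩ := ha.quad_bounds hm hc hK ⟨0, hN1⟩ ⟨0, hN2⟩ u
  rw [h3, mul_one] at h1 h2
  exact h1.trans h2

/-- The label sets form a partition. -/
lemma Assumptions.labelSet_partition (ha : M.Assumptions μ T R τlo τhi σ K c κ cgap cpi)
    (hN1 : 0 < N1) (hN2 : 0 < N2) (hH : H0 ≤ H) (gm : Fin N1 → Fin G) {η : ℝ}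
    (hη : η < cpi * cgap / 4) {θ : Params p1 p2 G H} (hθ : θ ∈ M.nbhd gm η) :
    (∀ h0, (M.labelSet θ gm η h0).Nonempty) ∧
      (∀ h0 h0', h0 ≠ h0' → Disjoint (M.labelSet θ gm η h0) (M.labelSet θ gm η h0')) ∧
      (⋃ h0, M.labelSet θ gm η h0) = Set.univ := by
  have : Nonempty (Fin H0) := ⟨M.h0 ⟨0, hN2⟩⟩
  have : Nonempty (Fin H) := ⟨Fin.castLE hH (M.h0 ⟨0, hN2⟩)⟩
  rw [mem_nbhd_iff] at hθ
  refine ⟨fun h0 => ?_, fun h0 h0' hne => ?_, Set.eq_univ_of_forall fun h => ?_⟩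
  · obtain ⟨h, hh⟩ := hθ.1 h0
    exact ⟨h, hh.le⟩
  · rw [Set.disjoint_left]
    intro h h1 h2
    change M.colDisc θ gm h h0 ≤ η at h1
    change M.colDisc θ gm h h0' ≤ η at h2
    have h3 := ha.gap_le_colDisc hN1 θ gm h hne
    linarith
  · obtain ⟨h0, hh⟩ := hθ.2 h
    exact Set.mem_iUnion.2 ⟨h0, hh.le⟩

/-- On the good event, least squares labels are consistent given parameters near the truth. -/
lemma Assumptions.labels_mem_labelSet (ha : M.Assumptions μ T R τlo τhi σ K c κ cgap cpi)
    (hm : M.IsModel μ) (hc : 0 < c) (hK : 0 < K) (hτlo : 0 < τlo) (hN1 : 0 < N1) (hN2 : 0 < N2)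
    (hT : 0 < T) {ω : Ω} (hg : M.Good μ T (τlo / 32) (τlo / 32 * √(cgap * cpi)) ω)
    {η r : ℝ} (hη : η < M.tauMin μ * cgap * cpi / (4 * (M.tauMin μ + M.tauMax μ)))
    (hr : (τhi + τlo) * r ≤ τlo / 8 * (cgap * cpi)) {θ : Params p1 p2 G H}
    {gm : Fin N1 → Fin G} {lab hhat : Fin N2 → Fin H} (hd : M.pseudoDist θ gm lab ≤ r)
    (hθ : θ ∈ M.nbhd gm η) (hhat_min : M.IsColArgmin T θ gm ω hhat) (j : Fin N2) :
    hhat j ∈ M.labelSet θ gm η (M.h0 j) := by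
  have : Nonempty (Fin H0) := ⟨M.h0 j⟩
  have : Nonempty (Fin H) := ⟨hhat j⟩
  rw [mem_nbhd_iff] at hθ
  by_contra hcon
  change ¬ M.colDisc θ gm (hhat j) (M.h0 j) ≤ η at hcon
  obtain ⟨h0, hh0⟩ := hθ.2 (hhat j)
  obtain ⟨h, hh⟩ := hθ.1 (M.h0 j)
  have hne : h0 ≠ M.h0 j := by
    rintro rfl
    exact hcon hh0.le
  have hA : 0 < cgap * cpi := mul_pos ha.cgap_pos ha.cpi_pos
  have hcore := ha.colDisc_le_of_colLoss_le hm hc hK hN1 hT (by positivity) hA.le hg θ gm j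
    (hhat_min j h)
  have hgap := ha.gap_le_colDisc hN1 θ gm (hhat j) hne
  have hmin := ha.tauMin_ge
  have hmax := ha.tauMax_le
  have hmm := ha.tauMin_le_tauMax hm hc hK hN1 hN2
  have hρ0 := M.rowDisc_nonneg θ gm
  have hρr := (M.rowDisc_le_pseudoDist hN1 hN2 θ gm lab).trans hd
  set A := cgap * cpi with hAdef
  set ρ := M.rowDisc θ gm
  set tm := M.tauMin μ
  set tM := M.tauMax μ
  set D1 := M.colDisc θ gm (hhat j) (M.h0 j)
  set D2 := M.colDisc θ gm h (M.h0 j)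
  rw [lt_div_iff₀ (by linarith), mul_assoc tm, ← hAdef] at hη
  have hp : 0 < tm - τlo / 32 - τlo / 32 := by linarith
  -- The gap forces `D1 ≥ A / 2 - η`. The errors sum to `τlo A (1/32 + 1/8 + 1/16) = 7/32 τlo A`,
  -- less than the `tm A / 4` spared by the bound on `η`.
  have h1 : (tm - τlo / 32 - τlo / 32) * (A / 2 - η) ≤ (tm - τlo / 32 - τlo / 32) * D1 :=
    mul_le_mul_of_nonneg_left (by linarith) hp.le
  have h2 : (tM + τlo / 32 + τlo / 32) * D2 ≤ (tM + τlo / 32 + τlo / 32) * η :=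
    mul_le_mul_of_nonneg_left hh.le (by linarith)
  have h3 : (tM - tm + τlo / 8) * ρ ≤ (τhi + τlo) * r :=
    mul_le_mul (by linarith) hρr hρ0 (by linarith)
  have h4 : τlo * A ≤ tm * A := mul_le_mul_of_nonneg_right hmin hA.le
  have h5 : 0 < τlo * A := by positivity
  linarith

/-- If every label were worse, the columns of this true group, a share of at least `cpi`, would
alone push the mean above the pseudo distance. -/
lemma Assumptions.exists_colDisc_le (ha : M.Assumptions μ T R τlo τhi σ K c κ cgap cpi)
    (hN1 : 0 < N1) (hN2 : 0 < N2) (θ : Params p1 p2 G H) (gm : Fin N1 → Fin G)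
    (lab : Fin N2 → Fin H) (h0 : Fin H0) :
    ∃ h, M.colDisc θ gm h h0 ≤ M.pseudoDist θ gm lab / cpi := by
  by_contra! hcon
  have hN : (0 : ℝ) < N2 := by exact_mod_cast hN2
  have hcpi := ha.cpi_pos
  have h1 := ha.prop_col h0
  obtain ⟨j0, hj0⟩ := ha.exists_col h0
  set x := M.pseudoDist θ gm lab / cpi with hx
  set F := Finset.univ.filter fun j => M.h0 j = h0 with hF
  have hx0 : 0 ≤ x := by
    refine div_nonneg ?_ hcpi.le
    exact (M.rowDisc_nonneg θ gm).trans (M.rowDisc_le_pseudoDist hN1 hN2 θ gm lab)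
  have h2 : (F.card : ℝ) * x < ∑ j ∈ F, M.colDisc θ gm (lab j) (M.h0 j) := by
    rw [← nsmul_eq_mul]
    refine (Finset.sum_const x).symm.trans_lt
      (Finset.sum_lt_sum_of_nonempty ⟨j0, by simp [hF, hj0]⟩ fun j hj => ?_)
    rw [(Finset.mem_filter.1 hj).2]
    exact hcon _
  have h3 : ∑ j ∈ F, M.colDisc θ gm (lab j) (M.h0 j) ≤ ∑ j, M.colDisc θ gm (lab j) (M.h0 j) :=
    Finset.sum_le_sum_of_subset_of_nonneg (Finset.filter_subset _ _)
      fun _ _ _ => M.colDisc_nonneg _ _ _ _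
  have h4 : 1 / (N2 : ℝ) * ∑ j, M.colDisc θ gm (lab j) (M.h0 j) ≤ cpi * x := by
    have e : cpi * x = M.pseudoDist θ gm lab := by rw [hx]; field_simp
    rw [e, M.pseudoDist_eq hN1 hN2]
    linarith [M.rowDisc_nonneg θ gm]
  rw [le_div_iff₀ hN] at h1
  rw [div_mul_eq_mul_div, one_mul, div_le_iff₀ hN] at h4
  have h5 := mul_le_mul_of_nonneg_right h1 hx0
  linarith

/-- On the good event, least squares labels point to parameters near the truth. -/
lemma Assumptions.colDisc_labels_lt (ha : M.Assumptions μ T R τlo τhi σ K c κ cgap cpi)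
    (hm : M.IsModel μ) (hc : 0 < c) (hK : 0 < K) (hτlo : 0 < τlo) (hN1 : 0 < N1) (hN2 : 0 < N2)
    (hT : 0 < T) {α : ℝ} (hα : 0 < α) (hα1 : α ≤ 1) {ω : Ω}
    (hg : M.Good μ T (τlo / 8) (τlo * α / 8 * √(cgap * cpi)) ω)
    {d : ℝ} (hd : (τhi + τlo) * (d / cpi) ≤ τlo * α * (cgap * cpi) / 16)
    {θ : Params p1 p2 G H} {gm : Fin N1 → Fin G} {lab hhat : Fin N2 → Fin H}
    (hdist : M.pseudoDist θ gm lab ≤ d)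
    (hhat_min : M.IsColArgmin T θ gm ω hhat) (j : Fin N2) :
    M.colDisc θ gm (hhat j) (M.h0 j) < α * (cgap * cpi) := by
  obtain ⟨h, hh⟩ := ha.exists_colDisc_le hN1 hN2 θ gm lab (M.h0 j)
  have hcpi := ha.cpi_pos
  have hA : 0 < cgap * cpi := mul_pos ha.cgap_pos ha.cpi_pos
  have hcore := ha.colDisc_le_of_colLoss_le hm hc hK hN1 hT (by positivity) hA.le hg θ gm j
    (hhat_min j h)
  have hmin := ha.tauMin_ge
  have hmax := ha.tauMax_le
  have hmm := ha.tauMin_le_tauMax hm hc hK hN1 hN2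
  have hρ0 := M.rowDisc_nonneg θ gm
  have hρr := (M.rowDisc_le_pseudoDist hN1 hN2 θ gm lab).trans hdist
  have hhd : M.colDisc θ gm h (M.h0 j) ≤ d / cpi := hh.trans (by gcongr)
  have hdc : d ≤ d / cpi := by
    rw [le_div_iff₀ hcpi]
    exact mul_le_of_le_one_right (hρ0.trans hρr) (ha.cpi_le_one hN1)
  have hD1 := M.colDisc_nonneg θ gm (hhat j) (M.h0 j)
  have hD2 := M.colDisc_nonneg θ gm h (M.h0 j)
  set A := cgap * cpi with hAdef
  set ρ := M.rowDisc θ gm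
  set tm := M.tauMin μ
  set tM := M.tauMax μ
  set D1 := M.colDisc θ gm (hhat j) (M.h0 j)
  set D2 := M.colDisc θ gm h (M.h0 j)
  have hατ : τlo * α ≤ τlo := mul_le_of_le_one_right hτlo.le hα1
  -- The competitor costs at most `τlo α A / 8` and the noise `τlo α A / 4`, together less than `τlo
  -- α A / 2`.
  have h1 : τlo / 2 * D1 ≤ (tm - τlo / 8 - τlo * α / 8) * (ρ + D1) :=
    mul_le_mul (by linarith) (by linarith) hD1 (by linarith)
  have h2 : (tM + τlo / 8 + τlo * α / 8) * (ρ + D2) ≤ (τhi + τlo) * (2 * (d / cpi)) :=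
    mul_le_mul (by linarith) (by linarith) (by linarith) (by linarith)
  have h3 : 0 < τlo * α * A := by positivity
  have h4 : τlo / 2 * D1 < τlo / 2 * (α * A) := by linarith
  exact lt_of_mul_lt_mul_left h4 (by positivity)

/-- True columns cover all true groups, and a surjective labelling covers all labels, which gives
both halves of the neighbourhood. Two columns with one label but different groups would give `A ≤ 2
(A/8 + A/8)`. -/
lemma Assumptions.labels_refine (ha : M.Assumptions μ T R τlo τhi σ K c κ cgap cpi)
    (hN1 : 0 < N1) (hN2 : 0 < N2) {a : ℝ} {θ : Params p1 p2 G H} {gm : Fin N1 → Fin G}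
    {hhat : Fin N2 → Fin H}
    (hlt : ∀ j, M.colDisc θ gm (hhat j) (M.h0 j) < min a (1 / 8) * (cgap * cpi)) :
    (Function.Surjective hhat → θ ∈ M.nbhd gm (a * (cgap * cpi))) ∧
      ∀ h : Fin H, ∃ h0 : Fin H0, {j | hhat j = h} ⊆ {j | M.h0 j = h0} := by
  have : Nonempty (Fin H0) := ⟨M.h0 ⟨0, hN2⟩⟩
  have : Nonempty (Fin H) := ⟨hhat ⟨0, hN2⟩⟩
  have hA : 0 < cgap * cpi := mul_pos ha.cgap_pos ha.cpi_pos
  have ha1 : ∀ j, M.colDisc θ gm (hhat j) (M.h0 j) < a * (cgap * cpi) := fun j =>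
    (hlt j).trans_le (mul_le_mul_of_nonneg_right (min_le_left _ _) hA.le)
  have ha2 : ∀ j, M.colDisc θ gm (hhat j) (M.h0 j) < 1 / 8 * (cgap * cpi) := fun j =>
    (hlt j).trans_le (mul_le_mul_of_nonneg_right (min_le_right _ _) hA.le)
  constructor
  · intro hs
    rw [mem_nbhd_iff]
    constructor
    · intro h0
      obtain ⟨j, rfl⟩ := ha.exists_col h0
      exact ⟨hhat j, ha1 j⟩
    · intro h
      obtain ⟨j, rfl⟩ := hs h
      exact ⟨M.h0 j, ha1 j⟩
  · intro h
    by_cases hex : ∃ j0, hhat j0 = h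
    · obtain ⟨j0, rfl⟩ := hex
      refine ⟨M.h0 j0, fun j hj => ?_⟩
      change hhat j = hhat j0 at hj
      change M.h0 j = M.h0 j0
      by_contra hne
      have h1 := ha.gap_le_colDisc hN1 θ gm (hhat j) hne
      have h2 := ha2 j
      have h3 := ha2 j0
      rw [← hj] at h3
      linarith
    · exact ⟨M.h0 ⟨0, hN2⟩, fun j hj => absurd ⟨j, hj⟩ hex⟩

end Panel

end

end GMNAR

end

/-! ### The theorem. -/

theorem theorem3
    (R τlo τhi σ K c κ : ℝ) (hR : 0 < R) (hτlo : 0 < τlo) (hτhi : 0 < τhi) (hσ : 0 < σ)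
    (hK : 0 < K) (hc : 0 < c) (hκ : κ < 1) :
    ∃ c1 : ℝ, 0 < c1 ∧ ∃ c2 : ℝ, 0 < c2 ∧
    ∀ (N1 N2 T p1 p2 G0 H0 G H : ℕ → ℕ)
      (Ω : ℕ → Type*) [∀ n, MeasurableSpace (Ω n)]
      (μ : ∀ n, Measure (Ω n)) [∀ n, IsProbabilityMeasure (μ n)]
      (M : ∀ n, GMNAR.Panel (Ω n) (N1 n) (N2 n) (p1 n) (p2 n) (G0 n) (H0 n))
      (cgap cpi : ℕ → ℝ),
      (∀ n, 0 < N1 n) → (∀ n, 0 < N2 n) → (∀ n, 0 < T n) →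
      Tendsto N1 atTop atTop → Tendsto N2 atTop atTop → Tendsto T atTop atTop →
      (∀ n, G0 n ≤ G n) → (∀ n, H0 n ≤ H n) →
      (∀ n, (M n).IsModel (μ n)) →
      (∀ n, (M n).Assumptions (μ n) (T n) R τlo τhi σ K c κ (cgap n) (cpi n)) →
      (∃ C : ℝ, ∀ n, cgap n ≤ C) →
      -- (i)
      (∀ (n : ℕ) (gm : Fin (N1 n) → Fin (G n)) (η : ℝ),
        η < cpi n * cgap n / 4 →
        ∀ θ : GMNAR.Params (p1 n) (p2 n) (G n) (H n), θ ∈ (M n).nbhd gm η →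
          (∀ h0, ((M n).labelSet θ gm η h0).Nonempty) ∧
          (∀ h0 h0', h0 ≠ h0' →
            Disjoint ((M n).labelSet θ gm η h0) ((M n).labelSet θ gm η h0')) ∧
          (⋃ h0, (M n).labelSet θ gm η h0) = Set.univ) ∧
      -- (ii)
      (∀ r : ℕ → ℝ, Tendsto (fun n => r n / (cgap n * cpi n)) atTop (𝓝 0) →
        ∀ᶠ n in atTop, ∀ η : ℝ,
          η < (M n).tauMin (μ n) * cgap n * cpi n
                / (4 * ((M n).tauMin (μ n) + (M n).tauMax (μ n))) →
          μ n {ω | ∃ (θ : GMNAR.Params (p1 n) (p2 n) (G n) (H n))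
              (gm : Fin (N1 n) → Fin (G n)) (hm hhat : Fin (N2 n) → Fin (H n)),
              (M n).pseudoDist θ gm hm ≤ r n ∧ θ ∈ (M n).nbhd gm η ∧
              (M n).IsColArgmin (T n) θ gm ω hhat ∧
              ¬ ∀ j, hhat j ∈ (M n).labelSet θ gm η ((M n).h0 j)}
            ≤ ENNReal.ofReal ((H n : ℝ) * N1 n * N2 n *
                Real.exp (-c1 * Real.sqrt (T n) * cgap n * cpi n
                  + c2 * ((p1 n : ℝ) + p2 n + 3)))) ∧
      -- (iii)
      (∀ (θhat : ∀ n, Ω n → GMNAR.Params (p1 n) (p2 n) (G n) (H n))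
        (ghat : ∀ n, Ω n → Fin (N1 n) → Fin (G n))
        (hm hhat : ∀ n, Ω n → Fin (N2 n) → Fin (H n)),
        -- the pseudo distance of the estimator is `O_p(T^{-1/2} (m + log (N1 N2)))`
        (∀ δ : ℝ, 0 < δ → ∃ B : ℝ, ∀ᶠ n in atTop,
          μ n {ω | B * (((p1 n : ℝ) + p2 n + 3 + Real.log ((N1 n : ℝ) * N2 n))
                / Real.sqrt (T n))
              < (M n).pseudoDist (θhat n ω) (ghat n ω) (hm n ω)} ≤ ENNReal.ofReal δ) →
        (∀ n ω, (M n).IsColArgmin (T n) (θhat n ω) (ghat n ω) ω (hhat n ω)) →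
        Tendsto (fun n => Real.sqrt (T n) * cgap n * cpi n ^ 2
          / (Real.log ((N1 n : ℝ) * N2 n * H n) + ((p1 n : ℝ) + p2 n + 3))) atTop atTop →
        ∀ a : ℝ, 0 < a →
          Tendsto (fun n => μ n {ω | ¬
            ((Function.Surjective (hhat n ω) →
                θhat n ω ∈ (M n).nbhd (ghat n ω) (a * (cgap n * cpi n))) ∧
              ∀ htilde : Fin (H n), ∃ h : Fin (H0 n),
                {j | hhat n ω j = htilde} ⊆ {j | (M n).h0 j = h})})
            atTop (𝓝 0)) := by
  obtain ⟨c1, hc1, c2, hc2, hgood⟩ := GMNAR.Panel.exists_good_tail hτlo hτhi hσ hK hc hκ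
    (show 0 < τlo / 32 by positivity) (show 0 < τlo / 32 by positivity)
    (show 0 < 4 * (τhi / τlo) by positivity)
  refine ⟨c1, hc1, c2, hc2, ?_⟩
  intro N1 N2 T p1 p2 G0 H0 G H Ω _ μ _ M cgap cpi hN1 hN2 hT _ _ _ _ hHH hm ha ⟨C, hC⟩
  have hA : ∀ n, 0 < cgap n * cpi n := fun n => mul_pos (ha n).cgap_pos (ha n).cpi_pos
  refine ⟨fun n gm η hη θ hθ => (ha n).labelSet_partition (hN1 n) (hN2 n) (hHH n) gm hη hθ,
    fun r hr => ?_, fun θhat ghat lab hhat hOp hmin hrate a ha0 => ?_⟩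
  · have hev : ∀ᶠ n in atTop, r n / (cgap n * cpi n) < τlo / 8 / (τhi + τlo) :=
      hr.eventually_lt_const (by positivity)
    filter_upwards [hev] with n hn η hη
    have hrn : (τhi + τlo) * r n ≤ τlo / 8 * (cgap n * cpi n) := by
      rw [div_lt_iff₀ (hA n), div_mul_eq_mul_div, lt_div_iff₀ (by positivity)] at hn
      linarith
    -- Only with two true column groups is `cgap * cpi` bounded by the constants, as
    -- `exists_good_tail` requires. With a single group the neighbourhood itself puts every label in
    -- its label set, and the bad event is empty.
    by_cases hex : ∃ h h' : Fin (H0 n), h ≠ h'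
    · obtain ⟨h, h', hne⟩ := hex
      have hAmax : cgap n * cpi n ≤ 4 * (τhi / τlo) :=
        ((ha n).gap_le_trueDisc (hN1 n) hne).trans
          ((ha n).trueDisc_le_const (hm n) hc hK hτlo (hN1 n) h h')
      refine le_trans (measure_mono ?_) ((hgood (hm n) (ha n) (hT n) _ (hA n) hAmax).trans
        (ENNReal.ofReal_le_ofReal ?_))
      · rintro ω ⟨θ, gm, lab, hh, hd, hθ, hmin, hbad⟩ hg
        exact hbad fun j => (ha n).labels_mem_labelSet (hm n) hc hK hτlo (hN1 n) (hN2 n) (hT n)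
          hg hη hrn hd hθ hmin j
      · have hH1 : (1 : ℝ) ≤ H n := by
          exact_mod_cast (Fin.pos h).trans_le (hHH n)
        have e : -(c1 * √(T n : ℝ) * (cgap n * cpi n)) = -c1 * √(T n : ℝ) * cgap n * cpi n := by
          ring
        rw [e]
        refine mul_le_mul_of_nonneg_right ?_ (Real.exp_pos _).le
        refine mul_le_mul_of_nonneg_right ?_ (Nat.cast_nonneg _)
        exact le_mul_of_one_le_left (Nat.cast_nonneg _) hH1
    · push Not at hex
      refine (measure_mono_null ?_ measure_empty).trans_le (zero_le)
      rintro ω ⟨θ, gm, lab, hh, hd, hθ, hmin, hbad⟩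
      refine hbad fun j => ?_
      have : Nonempty (Fin (H0 n)) := ⟨(M n).h0 j⟩
      have : Nonempty (Fin (H n)) := ⟨hh j⟩
      rw [GMNAR.Panel.mem_nbhd_iff] at hθ
      obtain ⟨h0, hh0⟩ := hθ.2 (hh j)
      rw [hex h0 ((M n).h0 j)] at hh0
      exact hh0.le
  · set α : ℝ := min a (1 / 8) with hα
    have hα0 : 0 < α := by positivity
    have hα1 : α ≤ 1 := (min_le_right _ _).trans (by norm_num)
    have hC0 : 0 < C := (ha 0).cgap_pos.trans_le (hC 0)
    -- The constants of (iii) may depend on the bound `C` of `cgap` and on `a`, as only convergence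
    -- is claimed.
    obtain ⟨b1, hb1, b2, hb2, hgood'⟩ := GMNAR.Panel.exists_good_tail hτlo hτhi hσ hK hc hκ
      (show 0 < τlo / 8 by positivity) (show 0 < τlo * α / 8 by positivity) hC0
    set L : ℕ → ℝ := fun n => Real.log ((N1 n : ℝ) * N2 n * H n) + ((p1 n : ℝ) + p2 n + 3)
      with hL
    have hN1' : ∀ n, (1 : ℝ) ≤ N1 n := fun n => by exact_mod_cast hN1 n
    have hN2' : ∀ n, (1 : ℝ) ≤ N2 n := fun n => by exact_mod_cast hN2 n
    have hNN : ∀ n, (1 : ℝ) ≤ (N1 n : ℝ) * N2 n := fun n => one_le_mul_of_one_le_of_one_le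
      (hN1' n) (hN2' n)
    have hH' : ∀ n, (1 : ℝ) ≤ H n := fun n => by
      exact_mod_cast (Fin.pos ((M n).h0 ⟨0, hN2 n⟩)).trans_le (hHH n)
    have hm3 : ∀ n, (1 : ℝ) ≤ (p1 n : ℝ) + p2 n + 3 := fun n => by
      linarith [Nat.cast_nonneg (α := ℝ) (p1 n), Nat.cast_nonneg (α := ℝ) (p2 n)]
    have hlog : ∀ n, Real.log ((N1 n : ℝ) * N2 n) ≤ Real.log ((N1 n : ℝ) * N2 n * H n) := fun n =>
      Real.log_le_log (by linarith [hNN n]) (le_mul_of_one_le_right (by linarith [hNN n]) (hH' n))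
    have hlog0 : ∀ n, 0 ≤ Real.log ((N1 n : ℝ) * N2 n) := fun n => Real.log_nonneg (hNN n)
    have hL1 : ∀ n, 1 ≤ L n := fun n => by linarith [hlog n, hlog0 n, hm3 n]
    rw [ENNReal.tendsto_nhds_zero]
    intro e he
    obtain ⟨δ, hδ0, hδe⟩ : ∃ δ : ℝ, 0 < δ ∧ ENNReal.ofReal (δ + δ) ≤ e := by
      obtain ⟨q, hq0, hqe⟩ := ENNReal.lt_iff_exists_nnreal_btwn.1 he
      refine ⟨q / 2, by simpa using hq0, ?_⟩
      rw [add_halves, ENNReal.ofReal_coe_nnreal]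
      exact hqe.le
    obtain ⟨B, hB⟩ := hOp δ hδ0
    -- The first threshold brings the bad event below `δ`, the second keeps `q b1 - (1 + b2)`
    -- nonnegative, and the third makes `d / cpi` small against `cgap * cpi`.
    filter_upwards [hB, hrate.eventually_ge_atTop ((1 + b2 - Real.log δ) / b1),
      hrate.eventually_ge_atTop ((1 + b2) / b1),
      hrate.eventually_ge_atTop ((τhi + τlo) * |B| * 16 / (τlo * α))] with n hBn hq1 hq2 hq3
    have hcpi := (ha n).cpi_pos
    have hcgap := (ha n).cgap_pos
    have hcpi1 := (ha n).cpi_le_one (hN1 n)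
    have hLn : 0 < L n := by linarith [hL1 n]
    have hsT : 0 < √(T n : ℝ) := Real.sqrt_pos.2 (by exact_mod_cast hT n)
    set q := √(T n : ℝ) * cgap n * cpi n ^ 2 / L n with hq
    change (1 + b2 - Real.log δ) / b1 ≤ q at hq1
    change (1 + b2) / b1 ≤ q at hq2
    change (τhi + τlo) * |B| * 16 / (τlo * α) ≤ q at hq3
    rw [div_le_iff₀ hb1] at hq1 hq2
    set d := B * (((p1 n : ℝ) + p2 n + 3 + Real.log ((N1 n : ℝ) * N2 n)) / √(T n : ℝ)) with hd
    have hqL : q * L n = √(T n : ℝ) * cgap n * cpi n ^ 2 := by rw [hq]; field_simp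
    have hdle : (τhi + τlo) * (d / cpi n) ≤ τlo * α * (cgap n * cpi n) / 16 := by
      have h1 : d * √(T n : ℝ) ≤ |B| * L n := by
        have e1 : d * √(T n : ℝ)
            = B * ((p1 n : ℝ) + p2 n + 3 + Real.log ((N1 n : ℝ) * N2 n)) := by
          rw [hd]; field_simp
        rw [e1]
        refine mul_le_mul (le_abs_self B) ?_ ?_ (abs_nonneg B)
        · rw [hL]; linarith [hlog n]
        · linarith [hlog0 n, hm3 n]
      rw [div_le_iff₀ (by positivity)] at hq3
      have h2 : (τhi + τlo) * |B| * 16 * L n ≤ τlo * α * (√(T n : ℝ) * cgap n * cpi n ^ 2) := by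
        rw [← hqL]
        calc _ ≤ q * (τlo * α) * L n := by gcongr
          _ = _ := by ring
      have h3 : (τhi + τlo) * (d * √(T n : ℝ)) ≤ (τhi + τlo) * (|B| * L n) := by gcongr
      rw [← mul_div_assoc, div_le_iff₀ hcpi]
      refine le_of_mul_le_mul_right ?_ hsT
      linarith
    have hsub : {ω | ¬ ((Function.Surjective (hhat n ω) →
          θhat n ω ∈ (M n).nbhd (ghat n ω) (a * (cgap n * cpi n))) ∧
          ∀ htilde : Fin (H n), ∃ h : Fin (H0 n),
            {j | hhat n ω j = htilde} ⊆ {j | (M n).h0 j = h})}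
        ⊆ {ω | d < (M n).pseudoDist (θhat n ω) (ghat n ω) (lab n ω)}
          ∪ {ω | ¬ (M n).Good (μ n) (T n) (τlo / 8) (τlo * α / 8 * √(cgap n * cpi n)) ω} := by
      intro ω hω
      by_contra hcon
      simp only [Set.mem_union, Set.mem_ofPred_eq, not_or, not_lt, not_not] at hcon
      exact hω ((ha n).labels_refine (hN1 n) (hN2 n) fun j =>
        (ha n).colDisc_labels_lt (hm n) hc hK hτlo (hN1 n) (hN2 n) (hT n) hα0 hα1 hcon.2 hdle
          hcon.1 (hmin n ω) j)
    have hAC : cgap n * cpi n ≤ C :=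
      (mul_le_of_le_one_right hcgap.le hcpi1).trans (hC n)
    refine (measure_mono hsub).trans ((measure_union_le _ _).trans ?_)
    refine (add_le_add hBn (hgood' (hm n) (ha n) (hT n) _ (hA n) hAC)).trans ?_
    refine le_trans ?_ hδe
    rw [ENNReal.ofReal_add hδ0.le hδ0.le]
    refine add_le_add le_rfl (ENNReal.ofReal_le_ofReal ?_)
    have hNpos : 0 < (N1 n : ℝ) * N2 n := by linarith [hNN n]
    nth_rewrite 1 [← Real.exp_log hNpos]
    rw [← Real.exp_add, ← Real.le_log_iff_exp_le hδ0]
    have h1 : q * L n ≤ √(T n : ℝ) * (cgap n * cpi n) := by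
      rw [hqL]
      have : cpi n ^ 2 ≤ cpi n := by
        rw [pow_two]
        exact mul_le_of_le_one_left hcpi.le hcpi1
      calc √(T n : ℝ) * cgap n * cpi n ^ 2 ≤ √(T n : ℝ) * cgap n * cpi n := by gcongr
        _ = _ := by ring
    have h2 := mul_le_mul_of_nonneg_left h1 hb1.le
    have h3 : Real.log ((N1 n : ℝ) * N2 n) + b2 * ((p1 n : ℝ) + p2 n + 3) ≤ (1 + b2) * L n := by
      have h4 : (p1 n : ℝ) + p2 n + 3 ≤ L n := by
        rw [hL]; linarith [hlog n, hlog0 n]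
      have h5 : Real.log ((N1 n : ℝ) * N2 n) ≤ L n := by
        rw [hL]; linarith [hlog n, hm3 n]
      have h6 := mul_le_mul_of_nonneg_left h4 hb2.le
      linarith
    -- The exponent is at most `-(q b1 - (1 + b2)) L`; since `L ≥ 1`, this is at most `log δ`.
    have h7 : q * b1 - (1 + b2) ≤ (q * b1 - (1 + b2)) * L n :=
      le_mul_of_one_le_right (by linarith) (hL1 n)
    linarith
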